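/- Let $X$ be a connected smooth (Hausdorff, second countable) surface without boundary, with a smooth Lorentzian metric $g$, i.e. a smooth family of symmetric bilinear forms of signature $(1,1)$ on the tangent planes. Suppose that all lightlike geodesics of $(X,g)$ are closed: for every $x\in X$ and every nonzero $v\in T_xX$ with $g(v,v)=0$, the geodesic $\gamma$ with $\gamma(0)=x$, $\dot\gamma(0)=v$ is defined up to some time $T>0$ with $\gamma(T)=x$ and $\dot\gamma(T)=c\,v$ for some $c>0$ (this includes periodic geodesics, for which $c=1$). Let $g_E=g_{S^1}-g_{S^1}$ be the Einstein metric on $S^1\times S^1$, i.e. $g_E=\mathrm{pr}_1^*g_{S^1}-\mathrm{pr}_2^*g_{S^1}$ where $g_{S^1}$ is the standard metric of the unit circle. Then there is a surjective smooth covering map (a covering map that is a local diffeomorphism) $p\colon S^1\times S^1\to X$ such that $p^*g$ is conformal to $g_E$, i.e. $p^*g=f\,g_E$ for some smooth function $f\colon S^1\times S^1\to(0,\infty)$. In particular $X$ is compact. -/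

import Mathlib

open Set
open scoped Manifold ContDiff Bundle

/-- A smooth Lorentzian metric on a smooth surface `X` (a manifold modelled on `ℝ²`): a smooth
family of symmetric bilinear forms on the tangent planes, each of signature `(1, 1)`. In
dimension two, signature `(1, 1)` means exactly that the form takes both signs. -/
structure LorentzianMetric (X : Type*) [TopologicalSpace X]
    [ChartedSpace (EuclideanSpace ℝ (Fin 2)) X] [IsManifold (𝓡 2) ∞ X] where
  inner (x : X) : TangentSpace (𝓡 2) x →L[ℝ] TangentSpace (𝓡 2) x →L[ℝ] ℝ
  symm (x : X) (v w : TangentSpace (𝓡 2) x) : inner x v w = inner x w v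
  exists_neg (x : X) : ∃ v : TangentSpace (𝓡 2) x, inner x v v < 0
  exists_pos (x : X) : ∃ v : TangentSpace (𝓡 2) x, 0 < inner x v v
  contMDiff : ContMDiff (𝓡 2)
    ((𝓡 2).prod 𝓘(ℝ, EuclideanSpace ℝ (Fin 2) →L[ℝ] EuclideanSpace ℝ (Fin 2) →L[ℝ] ℝ)) ∞
    (fun x ↦ Bundle.TotalSpace.mk'
      (EuclideanSpace ℝ (Fin 2) →L[ℝ] EuclideanSpace ℝ (Fin 2) →L[ℝ] ℝ)
      (E := fun x : X ↦ TangentSpace (𝓡 2) x →L[ℝ] TangentSpace (𝓡 2) x →L[ℝ] ℝ)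
      x (inner x))

/-- The derivative at `y` of the inverse of the preferred chart around `x₀`. It sends the
coordinate vectors to the coordinate frame of the tangent space at the point with coordinates
`y`. -/
noncomputable def chartSymmDeriv {E H X : Type*} [NormedAddCommGroup E] [NormedSpace ℝ E]
    [TopologicalSpace H] (I : ModelWithCorners ℝ E H) [TopologicalSpace X] [ChartedSpace H X]
    (x₀ : X) (y : E) : E →L[ℝ] TangentSpace I ((extChartAt I x₀).symm y) :=
  mfderiv 𝓘(ℝ, E) I (extChartAt I x₀).symm y

namespace LorentzianMetric

noncomputable section

variable {X : Type*} [TopologicalSpace X] [ChartedSpace (EuclideanSpace ℝ (Fin 2)) X]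
  [IsManifold (𝓡 2) ∞ X]

/-- The coordinate expression `G y (v, w) = ∑ gᵢⱼ(y) vᵢ wⱼ` of the metric `g` in the preferred
chart around `x₀`: the pullback of `g` under the inverse of the chart. -/
def inChart (g : LorentzianMetric X) (x₀ : X) (y v w : EuclideanSpace ℝ (Fin 2)) : ℝ :=
  g.inner ((extChartAt (𝓡 2) x₀).symm y)
    (chartSymmDeriv (𝓡 2) x₀ y v)
    (chartSymmDeriv (𝓡 2) x₀ y w)

/-- `γ` is a (smooth, affinely parametrized) geodesic of `g` on the open set `J` of times.

The equation at time `t` is `g (∇_{γ'} γ', w) = 0` for all `w`, with `∇` the Levi-Civita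
connection, written in the chart around `γ t`: with `u` the coordinate expression of `γ`, and
after lowering the index in `uᵢ'' + ∑ Γⁱⱼₖ uⱼ' uₖ' = 0`, it reads
`∑ gᵢⱼ uⱼ'' + ∑ (∂ₖ gᵢⱼ - ½ ∂ᵢ gⱼₖ) uⱼ' uₖ' = 0`. -/
def IsGeodesicOn (g : LorentzianMetric X) (γ : ℝ → X) (J : Set ℝ) : Prop :=
  ContMDiffOn 𝓘(ℝ, ℝ) (𝓡 2) ∞ γ J ∧
    ∀ t ∈ J, ∀ w : EuclideanSpace ℝ (Fin 2),
      let u : ℝ → EuclideanSpace ℝ (Fin 2) := fun s ↦ extChartAt (𝓡 2) (γ t) (γ s)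
      let G := g.inChart (γ t)
      G (u t) (deriv (deriv u) t) w
        + fderiv ℝ (fun y ↦ G y (deriv u t) w) (u t) (deriv u t)
        - (1 / 2) * fderiv ℝ (fun y ↦ G y (deriv u t) (deriv u t)) (u t) w = 0

/-- The velocity `γ'(t)`, as a point of the tangent bundle. -/
def velocity (γ : ℝ → X) (t : ℝ) : TangentBundle (𝓡 2) X :=
  ⟨γ t, mfderiv 𝓘(ℝ, ℝ) (𝓡 2) γ t (1 : ℝ)⟩

/-- The geodesic with initial velocity `v` at `x` is closed: it is defined at least on some
`[0, T]` with `T > 0` and returns at time `T` to `x` with a velocity that is a positive multiple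
of `v` (so its trace is a smooth closed curve). A periodic geodesic is the case in which the
multiple is `1`. -/
def IsClosedGeodesicFrom (g : LorentzianMetric X) (x : X) (v : TangentSpace (𝓡 2) x) : Prop :=
  ∃ (γ : ℝ → X) (J : Set ℝ) (T c : ℝ), IsOpen J ∧ 0 < T ∧ Icc 0 T ⊆ J ∧ g.IsGeodesicOn γ J ∧
    velocity γ 0 = ⟨x, v⟩ ∧ 0 < c ∧ velocity γ T = ⟨x, c • v⟩

/-- All lightlike geodesics of `g` are closed. A geodesic is determined by its initial velocity,
and it is lightlike iff that vector is nonzero and null. -/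
def AllLightlikeGeodesicsClosed (g : LorentzianMetric X) : Prop :=
  ∀ (x : X) (v : TangentSpace (𝓡 2) x), v ≠ 0 → g.inner x v v = 0 → g.IsClosedGeodesicFrom x v

end

end LorentzianMetric

/-- The metric of the unit circle `S¹ ⊆ ℂ`, induced by the Euclidean inner product of `ℂ = ℝ²`. -/
noncomputable def circleMetric (z : Circle) (v w : TangentSpace (𝓡 1) z) : ℝ :=
  @inner ℝ ℂ _ (mfderiv (𝓡 1) 𝓘(ℝ, ℂ) (fun a : Circle ↦ (a : ℂ)) z v)
    (mfderiv (𝓡 1) 𝓘(ℝ, ℂ) (fun a : Circle ↦ (a : ℂ)) z w)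

/-- The Einstein metric `g_{S¹} - g_{S¹}` on the torus `S¹ × S¹`. -/
noncomputable def einsteinMetric (z : Circle × Circle)
    (v w : TangentSpace ((𝓡 1).prod (𝓡 1)) z) : ℝ :=
  circleMetric z.1 (mfderiv ((𝓡 1).prod (𝓡 1)) (𝓡 1) Prod.fst z v)
      (mfderiv ((𝓡 1).prod (𝓡 1)) (𝓡 1) Prod.fst z w)
    - circleMetric z.2 (mfderiv ((𝓡 1).prod (𝓡 1)) (𝓡 1) Prod.snd z v)
      (mfderiv ((𝓡 1).prod (𝓡 1)) (𝓡 1) Prod.snd z w)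

/-! Around every point there are null coordinates in which g = 2H du dv with H > 0
(`exists_nullNear`). In them the lightlike geodesics are the coordinate lines, traversed so that H
u' (or H v') is constant. Two null coordinate systems that share one oriented coordinate line differ
by a product of increasing maps (`NullNear.exists_eq_prod`), so the geometry reduces to two
transverse families of null curves. The goal is a map P from the plane to X that is null everywhere
and has period 1 in each variable.

Closedness is used twice. First, a lightlike geodesic returning with velocity c v becomes, after a
smooth change of time, a null curve of period 1, even if c ≠ 1 (`exists_isClosedNullCurve`). Second,
it trivializes holonomy (`eventually_add_one_eq`). The return map of a transversal along a closed
null line is increasing and fixes the base point. A nearby null line also lies on a closed null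
curve, which meets a compact piece of the transversal in finitely many points
(`eventually_not_reparam`). The return map preserves this finite set, and an increasing map with a
fixed point can only do so by fixing each of its points (`eq_of_finite_invariant`). Hence a closed
null curve has a neighbourhood parametrized by a periodic strip (`exists_periodic_strip`).

For the global map (`exists_global`), start from closed null curves α and β of the two kinds through
one point and continue row by row in v, keeping P(0, v) = β(v). Near any height V there is a
periodic strip along the closed null curve crossing β there. A whole row already built lifts to the
corresponding closed row of the strip (`exists_lift`), so it extends for all u at once by an amount
depending only on V. Uniqueness is `eqOn_prod`: null maps of a box agreeing on two crossing lines
are equal. Periodicity on the axes then spreads to the plane (`add_one_eq`).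

With u = (θ₁ + θ₂)/2π and v = (θ₁ - θ₂)/2π, du dv is a multiple of the Einstein metric, and P
descends to a local diffeomorphism from the torus to X. Compactness of the torus and connectedness
of X make it a surjective covering, with conformal factor H/(2π²). -/

open Filter Topology

/-! ### Smoothness of superposition operators on spaces of continuous functions -/

section Nemytskii

set_option synthInstance.maxHeartbeats 400000

variable {K E F : Type} [TopologicalSpace K] [CompactSpace K]
  [NormedAddCommGroup E] [NormedSpace ℝ E] [NormedAddCommGroup F] [NormedSpace ℝ F]

/-- Pointwise application of a continuous bilinear map, as a continuous bilinear map. -/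
noncomputable def pointwiseBilinear {G : Type} [NormedAddCommGroup G] [NormedSpace ℝ G]
    (B : G →L[ℝ] E →L[ℝ] F) : C(K, G) →L[ℝ] C(K, E) →L[ℝ] C(K, F) :=
  LinearMap.mkContinuous₂
    (LinearMap.mk₂ ℝ (fun (A : C(K, G)) (z : C(K, E)) ↦
        (⟨fun k ↦ B (A k) (z k), by fun_prop⟩ : C(K, F)))
      (fun _ _ _ ↦ by ext; simp) (fun _ _ _ ↦ by ext; simp) (fun _ _ _ ↦ by ext; simp)
      (fun _ _ _ ↦ by ext; simp)) ‖B‖ (by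
    intro A z
    refine (ContinuousMap.norm_le _ (by positivity)).2 fun k ↦ ?_
    exact (B.le_opNorm₂ _ _).trans (by
      gcongr
      exacts [A.norm_coe_le_norm k, z.norm_coe_le_norm k]))

noncomputable local instance : NormedAddCommGroup C(K, E →L[ℝ] F) :=
  ContinuousMap.instNormedAddCommGroup

noncomputable local instance : NormedSpace ℝ C(K, E →L[ℝ] F) :=
  ContinuousMap.normedSpace

/-- The first-order expansion of `f` is uniform along the image of `z`, because `K` is compact; the
mean value inequality then bounds the remainder in the supremum norm. -/
theorem hasFDerivAt_postcomp {f : E → F} (hf : ContDiff ℝ 1 f) (z : C(K, E)) :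
    HasFDerivAt (fun z : C(K, E) ↦ (⟨f, hf.continuous⟩ : C(E, F)).comp z)
      (pointwiseBilinear (.id ℝ (E →L[ℝ] F))
        ((⟨fderiv ℝ f, hf.continuous_fderiv one_ne_zero⟩ : C(E, E →L[ℝ] F)).comp z)) z := by
  rw [hasFDerivAt_iff_isLittleO_nhds_zero, Asymptotics.isLittleO_iff]
  intro ε hε
  have hD := hf.continuous_fderiv one_ne_zero
  have h1 : ∀ᶠ e in 𝓝 (0 : E), ∀ k ∈ (univ : Set K),
      ‖fderiv ℝ f (z k + e) - fderiv ℝ f (z k)‖ < ε := by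
    refine isCompact_univ.eventually_forall_of_forall_eventually fun k _ ↦ ?_
    have : Continuous fun p : E × K ↦ ‖fderiv ℝ f (z p.2 + p.1) - fderiv ℝ f (z p.2)‖ := by
      fun_prop
    exact this.continuousAt.eventually_lt continuousAt_const (by simpa using hε)
  obtain ⟨δ, hδ, h2⟩ := Metric.eventually_nhds_iff_ball.1 h1
  filter_upwards [Metric.ball_mem_nhds (0 : C(K, E)) hδ] with h hh
  refine (ContinuousMap.norm_le _ (by positivity)).2 fun k ↦ ?_
  change ‖f (z k + h k) - f (z k) - fderiv ℝ f (z k) (h k)‖ ≤ ε * ‖h‖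
  have hk : ‖h k‖ < δ := (h.norm_coe_le_norm k).trans_lt (by simpa using hh)
  have h3 := (convex_ball (z k) δ).norm_image_sub_le_of_norm_fderiv_le' (𝕜 := ℝ) (f := f)
    (φ := fderiv ℝ f (z k)) (C := ε) (x := z k) (y := z k + h k)
    (fun x _ ↦ (hf.differentiable one_ne_zero) x)
    (fun x hx ↦ by
      have := h2 (x - z k) (by simpa [dist_eq_norm] using hx) k (mem_univ _)
      rw [add_sub_cancel] at this
      exact this.le) (Metric.mem_ball_self hδ) (by simpa using hk)
  rw [add_sub_cancel_left] at h3
  exact h3.trans (mul_le_mul_of_nonneg_left (h.norm_coe_le_norm k) hε.le)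

/-- The derivative is again a superposition operator, by `fderiv ℝ f`, followed by a bounded
bilinear map. Its values lie in a different space, so the induction runs over all targets `F` at
once. -/
theorem contDiff_nat_postcomp (n : ℕ) : ∀ {F : Type} [NormedAddCommGroup F] [NormedSpace ℝ F]
    {f : E → F} (hf : ContDiff ℝ ∞ f),
    ContDiff ℝ n (fun z : C(K, E) ↦ (⟨f, hf.continuous⟩ : C(E, F)).comp z) := by
  induction n with
  | zero =>
    intro F _ _ f hf
    exact contDiff_zero.2 (ContinuousMap.continuous_postcomp _)
  | succ n ih =>
    intro F _ _ f hf
    have hf1 : ContDiff ℝ 1 f := hf.of_le (by exact_mod_cast le_top)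
    have hf' : ContDiff ℝ ∞ (fderiv ℝ f) := hf.fderiv_right (by simp)
    push_cast
    refine contDiff_succ_iff_hasFDerivAt.2 ⟨_, ?_, fun z ↦ hasFDerivAt_postcomp hf1 z⟩
    exact (pointwiseBilinear (.id ℝ (E →L[ℝ] F))).contDiff.comp (ih hf')

theorem contDiff_postcomp {f : E → F} (hf : ContDiff ℝ ∞ f) :
    ContDiff ℝ ∞ (fun z : C(K, E) ↦ (⟨f, hf.continuous⟩ : C(E, F)).comp z) :=
  contDiff_infty.2 fun n ↦ contDiff_nat_postcomp n hf

end Nemytskii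

/-- A smooth implicit function is smooth near the base point. -/
theorem ContDiffAt.eventually_contDiffAt_implicitFunction {E₁ E₂ F : Type*}
    [NormedAddCommGroup E₁] [NormedSpace ℝ E₁] [CompleteSpace E₁]
    [NormedAddCommGroup E₂] [NormedSpace ℝ E₂] [CompleteSpace E₂]
    [NormedAddCommGroup F] [NormedSpace ℝ F] [CompleteSpace F]
    {f : E₁ × E₂ → F} (hf : ContDiff ℝ ∞ f) {u : E₁ × E₂} (cdf : ContDiffAt ℝ ∞ f u)
    (pn : (∞ : WithTop ℕ∞) ≠ 0)
    (if₂ : (fderiv ℝ f u ∘L .inr ℝ E₁ E₂).IsInvertible) :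
    ∀ᶠ x in 𝓝 u.1, ContDiffAt ℝ ∞ (cdf.implicitFunction pn if₂) x := by
  set ψ := cdf.implicitFunction pn if₂ with hψ
  have hc : ContinuousAt ψ u.1 := (cdf.contDiffAt_implicitFunction pn if₂).continuousAt
  have hself : ψ u.1 = u.2 := cdf.implicitFunction_apply_self pn if₂
  have htend : Tendsto (fun x ↦ (x, ψ x)) (𝓝 u.1) (𝓝 u) := by
    have : ContinuousAt (fun x ↦ (x, ψ x)) u.1 := continuousAt_id.prodMk hc
    simpa [ContinuousAt, hself] using this
  -- Smoothness of order `∞` at one point only gives neighbourhoods that may shrink with the order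
  -- of differentiability. The implicit function theorem is therefore applied again at each nearby
  -- point of the graph.
  have hiff := (cdf.eventually_apply_eq_iff_implicitFunction pn if₂).eventually_nhds
  have hinv : ∀ᶠ v in 𝓝 u, (fderiv ℝ f v ∘L .inr ℝ E₁ E₂).IsInvertible := by
    have h1 : Continuous fun v ↦ fderiv ℝ f v ∘L .inr ℝ E₁ E₂ := by
      have := hf.continuous_fderiv pn
      fun_prop
    obtain ⟨e, he⟩ := if₂
    refine (h1.continuousAt (x := u)).eventually (p := fun L ↦ L.IsInvertible) ?_
    change ∀ᶠ L in 𝓝 (fderiv ℝ f u ∘L .inr ℝ E₁ E₂), L.IsInvertible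
    rw [← he]
    exact ContinuousLinearEquiv.nhds e
  filter_upwards [htend.eventually hiff, htend.eventually hinv,
    cdf.eventually_apply_implicitFunction pn if₂] with p h1 h2 h3
  have cdf' : ContDiffAt ℝ ∞ f (p, ψ p) := hf.contDiffAt
  have h4 := cdf'.contDiffAt_implicitFunction pn h2
  -- The implicit function based at `(p, ψ p)` solves the same equation as `ψ`, so local uniqueness
  -- for `ψ` identifies the two.
  refine h4.congr_of_eventuallyEq ?_
  have hs : cdf'.implicitFunction pn h2 p = ψ p := cdf'.implicitFunction_apply_self pn h2
  have h5 : Tendsto (fun x ↦ (x, cdf'.implicitFunction pn h2 x)) (𝓝 p) (𝓝 (p, ψ p)) := by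
    have : ContinuousAt (fun x ↦ (x, cdf'.implicitFunction pn h2 x)) p :=
      continuousAt_id.prodMk h4.continuousAt
    simpa [ContinuousAt, hs] using this
  filter_upwards [h5.eventually h1, cdf'.eventually_apply_implicitFunction pn h2] with x hx hx'
  exact hx.1 (hx'.trans h3)

/-! ### First integrals of planar differential equations -/

section FirstIntegral

/-- The primitive vanishing at `1`, as an operator on continuous functions on `[0, 1]`. -/
noncomputable def primitiveCLM : C(unitInterval, ℝ) →L[ℝ] C(unitInterval, ℝ) :=
  LinearMap.mkContinuous
    { toFun := fun w ↦ ⟨fun s ↦ ∫ t in (1 : ℝ)..s, w (projIcc 0 1 zero_le_one t), by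
        have h : Continuous fun t ↦ w (projIcc 0 1 zero_le_one t) :=
          w.continuous.comp continuous_projIcc
        exact (intervalIntegral.continuous_primitive (fun a b ↦ h.intervalIntegrable a b) 1).comp
          continuous_subtype_val⟩
      map_add' := fun w w' ↦ by
        ext s
        have h (w : C(unitInterval, ℝ)) : Continuous fun t ↦ w (projIcc 0 1 zero_le_one t) :=
          w.continuous.comp continuous_projIcc
        exact intervalIntegral.integral_add ((h w).intervalIntegrable _ _)
          ((h w').intervalIntegrable _ _)
      map_smul' := fun c w ↦ by
        ext s
        exact intervalIntegral.integral_const_mul _ _ } 1 (by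
    intro w
    refine (ContinuousMap.norm_le _ (by positivity)).2 fun s ↦ ?_
    refine (intervalIntegral.norm_integral_le_of_norm_le_const (C := ‖w‖)
      fun t _ ↦ w.norm_coe_le_norm _).trans ?_
    rw [mul_comm]
    refine mul_le_mul_of_nonneg_right ?_ (norm_nonneg w)
    rw [abs_le]
    constructor <;> linarith [s.2.1, s.2.2])

theorem primitiveCLM_apply (w : C(unitInterval, ℝ)) (s : unitInterval) :
    primitiveCLM w s = ∫ t in (1 : ℝ)..s, w (projIcc 0 1 zero_le_one t) := rfl

/-- The curve `t ↦ (a t, z t)` over the unit interval. -/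
noncomputable def graphCLM :
    (ℝ × ℝ) × C(unitInterval, ℝ) →L[ℝ] C(unitInterval, ℝ × ℝ) :=
  ((ContinuousLinearMap.inl ℝ ℝ ℝ).compLeftContinuous ℝ unitInterval).comp
    (((ContinuousLinearMap.fst ℝ ℝ ℝ).comp (ContinuousLinearMap.fst ℝ (ℝ × ℝ) _)).smulRight
      (⟨Subtype.val, continuous_subtype_val⟩ : C(unitInterval, ℝ)))
  + ((ContinuousLinearMap.inr ℝ ℝ ℝ).compLeftContinuous ℝ unitInterval).comp
    (ContinuousLinearMap.snd ℝ (ℝ × ℝ) _)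

theorem graphCLM_apply (v : (ℝ × ℝ) × C(unitInterval, ℝ)) (s : unitInterval) :
    graphCLM v s = (v.1.1 * s, v.2 s) := by
  simp [graphCLM]

/-- The defect of `z` in the integral equation `z(s) = y + x ∫₁ˢ m(x t, z t) dt`. -/
noncomputable def odeDefect {m : ℝ × ℝ → ℝ} (hm : ContDiff ℝ ∞ m)
    (v : (ℝ × ℝ) × C(unitInterval, ℝ)) : C(unitInterval, ℝ) :=
  v.2 - ContinuousLinearMap.const ℝ unitInterval v.1.2
    - v.1.1 • primitiveCLM ((⟨m, hm.continuous⟩ : C(ℝ × ℝ, ℝ)).comp (graphCLM v))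

theorem contDiff_odeDefect {m : ℝ × ℝ → ℝ} (hm : ContDiff ℝ ∞ m) :
    ContDiff ℝ ∞ (odeDefect hm) := by
  have h1 := (contDiff_postcomp (K := unitInterval) hm).comp graphCLM.contDiff
  have h2 := primitiveCLM.contDiff.comp h1
  unfold odeDefect
  refine (contDiff_snd.sub ?_).sub ((contDiff_fst.comp contDiff_fst).smul h2)
  refine ContDiff.comp (g := fun y : ℝ ↦ (ContinuousLinearMap.const ℝ unitInterval y :
    C(unitInterval, ℝ))) ?_ (contDiff_snd.comp contDiff_fst)
  have : (fun y : ℝ ↦ (ContinuousLinearMap.const ℝ unitInterval y : C(unitInterval, ℝ)))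
      = fun y ↦ y • (1 : C(unitInterval, ℝ)) := by ext; simp
  rw [this]
  fun_prop

theorem odeDefect_eq_zero_iff {m : ℝ × ℝ → ℝ} (hm : ContDiff ℝ ∞ m)
    (p : ℝ × ℝ) (z : C(unitInterval, ℝ)) :
    odeDefect hm (p, z) = 0 ↔ ∀ s : unitInterval, z s = p.2 + p.1 * ∫ t in (1 : ℝ)..s,
      m (p.1 * projIcc 0 1 zero_le_one t, z (projIcc 0 1 zero_le_one t)) := by
  have h (s) : odeDefect hm (p, z) s = z s - p.2 - p.1 * ∫ t in (1 : ℝ)..s,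
      m (p.1 * projIcc 0 1 zero_le_one t, z (projIcc 0 1 zero_le_one t)) := by
    simp [odeDefect, primitiveCLM_apply, graphCLM_apply]
  rw [ContinuousMap.ext_iff]
  refine forall_congr' fun s ↦ ?_
  rw [h, ContinuousMap.zero_apply]
  constructor <;> intro h <;> linarith

/-- The integral term carries the factor `x`. At `x = y = 0` the defect is `z` itself, so its
partial derivative in `z` is the identity. -/
theorem isInvertible_fderiv_odeDefect {m : ℝ × ℝ → ℝ} (hm : ContDiff ℝ ∞ m) :
    (fderiv ℝ (odeDefect hm) 0 ∘L .inr ℝ (ℝ × ℝ) C(unitInterval, ℝ)).IsInvertible := by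
  have h1 : HasFDerivAt (odeDefect hm) (fderiv ℝ (odeDefect hm) 0)
      (ContinuousLinearMap.inr ℝ (ℝ × ℝ) C(unitInterval, ℝ) 0) := by
    rw [map_zero]
    exact ((contDiff_odeDefect hm).differentiable (by simp) 0).hasFDerivAt
  have h2 := h1.comp 0 (ContinuousLinearMap.inr ℝ (ℝ × ℝ) C(unitInterval, ℝ)).hasFDerivAt
  have h3 : odeDefect hm ∘ ContinuousLinearMap.inr ℝ (ℝ × ℝ) C(unitInterval, ℝ) = id := by
    ext z s
    simp [odeDefect]
  rw [h3] at h2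
  rw [h2.unique (hasFDerivAt_id _)]
  exact ContinuousLinearMap.isInvertible_equiv (f := .refl ℝ _)

/-- A trajectory cut off at time `s` and rescaled to unit length is the trajectory through the
intermediate point `(p.1 * s, z s)`. With uniqueness, this makes the value at time `0` constant
along trajectories. -/
theorem odeDefect_rescale {m : ℝ × ℝ → ℝ} (hm : ContDiff ℝ ∞ m)
    {p : ℝ × ℝ} {z : C(unitInterval, ℝ)} (h : odeDefect hm (p, z) = 0) (s : unitInterval) :
    odeDefect hm ((p.1 * s, z s), ⟨fun t ↦ z (s * t), by fun_prop⟩) = 0 := by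
  rw [odeDefect_eq_zero_iff] at h ⊢
  intro t
  set φ : ℝ → ℝ := fun r ↦ m (p.1 * projIcc 0 1 zero_le_one r, z (projIcc 0 1 zero_le_one r))
  have hφ : Continuous φ := by
    have := hm.continuous
    have := continuous_projIcc (a := (0 : ℝ)) (b := 1) (h := zero_le_one)
    fun_prop
  have h1 : ∫ r in (1 : ℝ)..t, m (p.1 * s * projIcc 0 1 zero_le_one r,
      z (s * projIcc 0 1 zero_le_one r)) = ∫ r in (1 : ℝ)..t, φ (s * r) := by
    refine intervalIntegral.integral_congr fun r hr ↦ ?_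
    have hr' : r ∈ Icc (0 : ℝ) 1 := by
      rw [uIcc_of_ge t.2.2] at hr
      exact ⟨t.2.1.trans hr.1, hr.2⟩
    have hsr : (s : ℝ) * r ∈ Icc (0 : ℝ) 1 :=
      ⟨mul_nonneg s.2.1 hr'.1, mul_le_one₀ s.2.2 hr'.1 hr'.2⟩
    have e1 : s * projIcc 0 1 zero_le_one r = (⟨s * r, hsr⟩ : unitInterval) := by
      rw [projIcc_of_mem _ hr']; rfl
    simp only [φ]
    rw [e1, projIcc_of_mem _ hr', projIcc_of_mem _ hsr, mul_assoc]
  have h2 : (s : ℝ) * ∫ r in (1 : ℝ)..t, φ (s * r) = ∫ r in (s : ℝ)..(s * t), φ r := by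
    simpa only [mul_one, smul_eq_mul] using intervalIntegral.mul_integral_comp_mul_left (f := φ) (a := 1) (b := t) (s : ℝ)
  have h3 := intervalIntegral.integral_add_adjacent_intervals (μ := MeasureTheory.volume)
    (hφ.intervalIntegrable 1 s) (hφ.intervalIntegrable s (s * t))
  simp only [ContinuousMap.coe_mk]
  rw [h1, mul_assoc, h2, h s, h (s * t), add_assoc, ← mul_add]
  rw [h3]
  rfl

/-- The ordinary differential equation `dy/dx = m(x, y)` has a smooth first integral near the
origin that restricts to the identity on the `y`-axis. -/
theorem exists_firstIntegral {m : ℝ × ℝ → ℝ} (hm : ContDiff ℝ ∞ m) :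
    ∃ η : ℝ × ℝ → ℝ, (∀ᶠ p in 𝓝 0, ContDiffAt ℝ ∞ η p) ∧ (∀ᶠ y in 𝓝 0, η (0, y) = y) ∧
      ∀ᶠ p in 𝓝 0, fderiv ℝ η p (1, m p) = 0 := by
  have pn : (∞ : WithTop ℕ∞) ≠ 0 := by simp
  have hN := contDiff_odeDefect hm
  have cdf : ContDiffAt ℝ ∞ (odeDefect hm) 0 := hN.contDiffAt
  have hinv := isInvertible_fderiv_odeDefect hm
  set ψ := cdf.implicitFunction pn hinv
  have hψ : ∀ᶠ p in 𝓝 (0 : ℝ × ℝ), ContDiffAt ℝ ∞ ψ p :=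
    ContDiffAt.eventually_contDiffAt_implicitFunction hN cdf pn hinv
  have hN0 : odeDefect hm 0 = 0 := by
    ext s; simp [odeDefect]
  have hsol : ∀ᶠ p in 𝓝 (0 : ℝ × ℝ), odeDefect hm (p, ψ p) = 0 := by
    have := cdf.eventually_apply_implicitFunction pn hinv
    rw [hN0] at this
    exact this
  have hiff := cdf.eventually_apply_eq_iff_implicitFunction pn hinv
  rw [hN0] at hiff
  have hψ0 : ψ 0 = 0 := cdf.implicitFunction_apply_self pn hinv
  have hη : ∀ᶠ p in 𝓝 (0 : ℝ × ℝ), ContDiffAt ℝ ∞ (fun p ↦ ψ p 0) p := by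
    filter_upwards [hψ] with p hp
    exact (ContinuousMap.evalCLM ℝ (0 : unitInterval)).contDiff.contDiffAt.comp p hp
  have hline : Tendsto (fun y : ℝ ↦ ((0 : ℝ), y)) (𝓝 0) (𝓝 0) :=
    (Continuous.tendsto (by fun_prop) _ : Tendsto (fun y : ℝ ↦ ((0 : ℝ), y)) (𝓝 0) (𝓝 (0, 0)))
  -- The first integral of `p` is the height at which the trajectory through `p` meets the `y`-axis.
  refine ⟨fun p ↦ ψ p 0, hη, ?_, ?_⟩
  · filter_upwards [hline.eventually hsol] with y hy
    simpa using (odeDefect_eq_zero_iff hm _ _).1 hy 0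
  obtain ⟨ε, hε, hball⟩ := Metric.eventually_nhds_iff_ball.1 hiff
  have hψc : ContinuousAt ψ 0 := (cdf.contDiffAt_implicitFunction pn hinv).continuousAt
  have hψs : ∀ᶠ p in 𝓝 (0 : ℝ × ℝ), ‖ψ p‖ < ε := by
    have h0 : ‖ψ 0‖ < ε := by rwa [hψ0, norm_zero]
    exact hψc.norm.eventually (gt_mem_nhds h0)
  have hconst : ∀ᶠ p in 𝓝 (0 : ℝ × ℝ), ∀ s : unitInterval, ψ (p.1 * s, ψ p s) 0 = ψ p 0 := by
    filter_upwards [hsol, hψs, Metric.ball_mem_nhds 0 hε] with p h1 h2 h3 s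
    have h4 := odeDefect_rescale hm h1 s
    have h5 := (hball ((p.1 * s, ψ p s), ⟨fun t ↦ ψ p (s * t), by fun_prop⟩) ?_).1 h4
    · simp only at h5
      change ψ (p.1 * s, ψ p s) = _ at h5
      rw [h5]; simp
    · rw [mem_ball_zero_iff] at h3 ⊢
      have h6 : ‖p.1 * s‖ < ε := by
        rw [norm_mul]
        refine (mul_le_of_le_one_right (norm_nonneg _) ?_).trans_lt ((norm_fst_le p).trans_lt h3)
        rw [Real.norm_of_nonneg s.2.1]; exact s.2.2
      have h7 := ((ψ p).norm_coe_le_norm s).trans_lt h2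
      refine max_lt (max_lt h6 h7) ((ContinuousMap.norm_lt_iff _ hε).2 fun t ↦ ?_)
      exact ((ψ p).norm_coe_le_norm (s * t)).trans_lt h2
  have hne : ∀ᶠ p in 𝓝 (0 : ℝ × ℝ), p.1 ≠ 0 → fderiv ℝ (fun p ↦ ψ p 0) p (1, m p) = 0 := by
    filter_upwards [hconst, hsol, hη] with p h1 h2 h3 hp
    rw [odeDefect_eq_zero_iff] at h2
    set φ : ℝ → ℝ := fun t ↦ m (p.1 * projIcc 0 1 zero_le_one t, ψ p (projIcc 0 1 zero_le_one t))
    have hφ : Continuous φ := by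
      have := hm.continuous
      have := continuous_projIcc (a := (0 : ℝ)) (b := 1) (h := zero_le_one)
      fun_prop
    have hp2 : ψ p 1 = p.2 := by simpa using h2 1
    have hφ1 : φ 1 = m p := by simp [φ, hp2]
    have d1 : HasDerivAt (fun s : ℝ ↦ p.2 + p.1 * ∫ t in (1 : ℝ)..s, φ t) (p.1 * m p) 1 := by
      rw [← hφ1]
      exact ((intervalIntegral.integral_hasDerivAt_right (hφ.intervalIntegrable _ _)
        (hφ.stronglyMeasurableAtFilter _ _) hφ.continuousAt).const_mul p.1).const_add p.2
    have d2 : HasDerivAt (fun s : ℝ ↦ (p.1 * s, p.2 + p.1 * ∫ t in (1 : ℝ)..s, φ t))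
        (p.1, p.1 * m p) 1 := by
      simpa using ((hasDerivAt_id (1 : ℝ)).const_mul p.1).prodMk d1
    have h3' : HasFDerivAt (fun p ↦ ψ p 0) (fderiv ℝ (fun p ↦ ψ p 0) p)
        ((fun s : ℝ ↦ (p.1 * s, p.2 + p.1 * ∫ t in (1 : ℝ)..s, φ t)) 1) := by
      simpa using (h3.differentiableAt (by simp)).hasFDerivAt
    -- Constancy is known only for `s ≤ 1`, so derivatives within `[0, 1]` are compared at its
    -- endpoint. The chain rule leaves a factor `p.1`.
    have d3 := (h3'.comp_hasDerivAt (1 : ℝ) d2).hasDerivWithinAt (s := Icc 0 1)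
    have d4 : HasDerivWithinAt ((fun p ↦ ψ p 0) ∘
        (fun s : ℝ ↦ (p.1 * s, p.2 + p.1 * ∫ t in (1 : ℝ)..s, φ t))) 0 (Icc 0 1) 1 := by
      refine (hasDerivWithinAt_const (1 : ℝ) (Icc 0 1) (ψ p 0)).congr_of_mem (fun s hs ↦ ?_)
        (by simp)
      have := h1 ⟨s, hs⟩
      rw [h2 ⟨s, hs⟩] at this
      exact this
    have d5 := (uniqueDiffOn_Icc zero_lt_one 1 (by simp)).eq_deriv _ d3 d4
    have : (p.1, p.1 * m p) = p.1 • ((1 : ℝ), m p) := by simp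
    rw [this, map_smul, smul_eq_mul] at d5
    exact (mul_eq_zero.1 d5).resolve_left hp
  filter_upwards [hne.eventually_nhds, hη] with p h1 h2
  by_cases hp : p.1 = 0
  swap
  · exact h1.self_of_nhds hp
  -- On the `y`-axis the factor `p.1` vanishes; the equation there is the limit of the equation off
  -- the axis.
  have hc : ContinuousAt (fun x : ℝ ↦ fderiv ℝ (fun p ↦ ψ p 0) (x, p.2) (1, m (x, p.2))) p.1 := by
    have e1 : ContinuousAt (fderiv ℝ (fun p ↦ ψ p 0)) p :=
      (h2.fderiv_right (m := 0) (by simp)).continuousAt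
    have e2 : ContinuousAt (fun x : ℝ ↦ (x, p.2)) p.1 := by fun_prop
    have e3 : ContinuousAt (fun x : ℝ ↦ ((1 : ℝ), m (x, p.2))) p.1 := by
      have := hm.continuous
      fun_prop
    exact (ContinuousAt.comp (g := fderiv ℝ (fun p ↦ ψ p 0)) (f := fun x : ℝ ↦ (x, p.2)) e1 e2).clm_apply e3
  have hz : ∀ᶠ x in 𝓝[≠] p.1, fderiv ℝ (fun p ↦ ψ p 0) (x, p.2) (1, m (x, p.2)) = 0 := by
    have e2 : Tendsto (fun x : ℝ ↦ (x, p.2)) (𝓝 p.1) (𝓝 p) :=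
      (Continuous.tendsto (by fun_prop) _ : Tendsto (fun x : ℝ ↦ (x, p.2)) (𝓝 p.1) (𝓝 (p.1, p.2)))
    filter_upwards [nhdsWithin_le_nhds (e2.eventually h1), self_mem_nhdsWithin] with x hx hx'
    exact hx (by rw [← hp]; exact hx')
  have := tendsto_nhds_unique (hc.tendsto.mono_left nhdsWithin_le_nhds)
    (tendsto_const_nhds.congr' (EventuallyEq.symm hz))
  exact this

end FirstIntegral

/-! ### Pullbacks of the metric -/

namespace LorentzianMetric

section Pullback

variable {X : Type*} [TopologicalSpace X] [ChartedSpace (EuclideanSpace ℝ (Fin 2)) X]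
  [IsManifold (𝓡 2) ∞ X] {E F : Type*} [NormedAddCommGroup E] [NormedSpace ℝ E]
  [NormedAddCommGroup F] [NormedSpace ℝ F]

/-- The pullback of the metric under a map from a normed space. -/
noncomputable def pull (g : LorentzianMetric X) (P : E → X) (z : E) : E →L[ℝ] E →L[ℝ] ℝ :=
  let B : EuclideanSpace ℝ (Fin 2) →L[ℝ] EuclideanSpace ℝ (Fin 2) →L[ℝ] ℝ := g.inner (P z)
  let L : E →L[ℝ] EuclideanSpace ℝ (Fin 2) := mfderiv 𝓘(ℝ, E) (𝓡 2) P z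
  B.bilinearComp L L

theorem pull_apply (g : LorentzianMetric X) (P : E → X) (z a b : E) :
    g.pull P z a b = g.inner (P z) (mfderiv 𝓘(ℝ, E) (𝓡 2) P z a)
      (mfderiv 𝓘(ℝ, E) (𝓡 2) P z b) := rfl

theorem pull_symm (g : LorentzianMetric X) (P : E → X) (z a b : E) :
    g.pull P z a b = g.pull P z b a := g.symm _ _ _

theorem pull_congr (g : LorentzianMetric X) {P Q : E → X} {z : E} (h : P =ᶠ[𝓝 z] Q) :
    g.pull P z = g.pull Q z := by
  ext a b
  rw [pull_apply, pull_apply, h.mfderiv_eq, h.eq_of_nhds]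

theorem pull_comp (g : LorentzianMetric X) {P : E → X} {Φ : F → E} {w : F}
    (hP : MDifferentiableAt 𝓘(ℝ, E) (𝓡 2) P (Φ w)) (hΦ : DifferentiableAt ℝ Φ w) (a b : F) :
    g.pull (P ∘ Φ) w a b = g.pull P (Φ w) (fderiv ℝ Φ w a) (fderiv ℝ Φ w b) := by
  have h : mfderiv 𝓘(ℝ, F) (𝓡 2) (P ∘ Φ) w
      = (mfderiv 𝓘(ℝ, E) (𝓡 2) P (Φ w)).comp (fderiv ℝ Φ w) := by
    rw [mfderiv_comp w hP hΦ.mdifferentiableAt, mfderiv_eq_fderiv]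
    rfl
  rw [pull_apply, h]
  rfl

theorem contMDiffAt_mfderiv_section {P : E → X} {z : E}
    (hP : ContMDiffAt 𝓘(ℝ, E) (𝓡 2) ∞ P z) (a : E) :
    ContMDiffAt 𝓘(ℝ, E) ((𝓡 2).prod 𝓘(ℝ, EuclideanSpace ℝ (Fin 2))) ∞
      (fun w ↦ Bundle.TotalSpace.mk' (EuclideanSpace ℝ (Fin 2))
        (E := fun x : X ↦ TangentSpace (𝓡 2) x) (P w) (mfderiv 𝓘(ℝ, E) (𝓡 2) P w a)) z := by
  have A := ContMDiffAt.mfderiv_const hP (m := ∞) (by simp)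
  have hv : ContMDiffAt 𝓘(ℝ, E) (𝓘(ℝ, E).prod 𝓘(ℝ, E)) ∞
      (fun w ↦ Bundle.TotalSpace.mk' E (E := fun x : E ↦ TangentSpace 𝓘(ℝ, E) x) w a) z := by
    rw [Bundle.contMDiffAt_totalSpace]
    refine ⟨contMDiffAt_id, ?_⟩
    simp
    exact contMDiffAt_const
  exact ContMDiffAt.clm_apply_of_inCoordinates (b₁ := id) (b₂ := P) A hv hP

theorem contDiffAt_pull_apply (g : LorentzianMetric X) {P : E → X} {z : E}
    (hP : ContMDiffAt 𝓘(ℝ, E) (𝓡 2) ∞ P z) (a b : E) :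
    ContDiffAt ℝ ∞ (fun w ↦ g.pull P w a b) z := by
  have h1 := g.contMDiff.contMDiffAt.comp z hP
  have h2 := ContMDiffAt.clm_bundle_apply₂ (E₃ := fun _ : X ↦ ℝ) (F₃ := ℝ)
    (ψ := fun w ↦ g.inner (P w)) (b := P) h1
    (contMDiffAt_mfderiv_section hP a) (contMDiffAt_mfderiv_section hP b)
  rw [Bundle.contMDiffAt_totalSpace] at h2
  have h3 : ContMDiffAt 𝓘(ℝ, E) 𝓘(ℝ, ℝ) ∞ (fun w ↦ g.pull P w a b) z := h2.2
  exact h3.contDiffAt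

theorem contDiffAt_pull [FiniteDimensional ℝ E] (g : LorentzianMetric X) {P : E → X} {z : E}
    (hP : ∀ᶠ w in 𝓝 z, ContMDiffAt 𝓘(ℝ, E) (𝓡 2) ∞ P w) :
    ContDiffAt ℝ ∞ (g.pull P) z := by
  obtain ⟨U, hU, hUo, hz⟩ := eventually_nhds_iff.1 hP
  have : ContDiffOn ℝ ∞ (g.pull P) U := by
    rw [contDiffOn_clm_apply]
    intro a
    rw [contDiffOn_clm_apply]
    intro b w hw
    exact (g.contDiffAt_pull_apply (hU w hw) a b).contDiffWithinAt
  exact this.contDiffAt (hUo.mem_nhds hz)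

end Pullback

end LorentzianMetric

/-! ### Extension of germs and the inverse function theorem -/

/-- A germ of smooth function extends to a globally smooth function. -/
theorem exists_contDiff_eventuallyEq {E : Type*} [NormedAddCommGroup E] [InnerProductSpace ℝ E]
    [FiniteDimensional ℝ E] {f : E → ℝ} {x : E} (hf : ∀ᶠ y in 𝓝 x, ContDiffAt ℝ ∞ f y) :
    ∃ h : E → ℝ, ContDiff ℝ ∞ h ∧ h =ᶠ[𝓝 x] f := by
  obtain ⟨ε, hε, hball⟩ := Metric.eventually_nhds_iff_ball.1 hf
  let χ : ContDiffBump x := ⟨ε / 4, ε / 2, by positivity, by linarith⟩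
  refine ⟨fun y ↦ χ y * f y, contDiff_iff_contDiffAt.2 fun y ↦ ?_, ?_⟩
  · by_cases hy : y ∈ Metric.ball x ε
    · exact χ.contDiffAt.mul (hball y hy)
    · have : (fun y ↦ χ y * f y) =ᶠ[𝓝 y] fun _ ↦ 0 := by
        have h1 : ∀ᶠ w in 𝓝 y, ε / 2 < dist w x := by
          refine (continuous_id.dist continuous_const).continuousAt.eventually (lt_mem_nhds ?_)
          simp only [Metric.mem_ball, not_lt] at hy
          simp only [id]
          linarith
        filter_upwards [h1] with w hw
        rw [χ.zero_of_le_dist hw.le, zero_mul]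
      exact contDiffAt_const.congr_of_eventuallyEq this
  · filter_upwards [χ.eventuallyEq_one] with y hy
    rw [hy, Pi.one_apply, one_mul]

/-- A germ of smooth function on the plane extends to a globally smooth function. -/
theorem exists_contDiff_eventuallyEq_prod {f : ℝ × ℝ → ℝ} {x : ℝ × ℝ}
    (hf : ∀ᶠ y in 𝓝 x, ContDiffAt ℝ ∞ f y) :
    ∃ h : ℝ × ℝ → ℝ, ContDiff ℝ ∞ h ∧ h =ᶠ[𝓝 x] f := by
  -- The bump functions in use live on an inner product space, which the plane with the supremum
  -- norm is not.
  let L : (ℝ × ℝ) ≃L[ℝ] EuclideanSpace ℝ (Fin 2) :=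
    ContinuousLinearEquiv.ofFinrankEq (by simp)
  obtain ⟨h, h1, h2⟩ := exists_contDiff_eventuallyEq (f := f ∘ L.symm) (x := L x) (by
    have : Tendsto L.symm (𝓝 (L x)) (𝓝 x) := by simpa using L.symm.continuous.tendsto (L x)
    filter_upwards [this.eventually hf] with y hy
    exact hy.comp y L.symm.contDiff.contDiffAt)
  refine ⟨h ∘ L, h1.comp L.contDiff, ?_⟩
  filter_upwards [L.continuous.continuousAt.eventually h2] with y hy
  simpa using hy

/-- The inverse function theorem for maps that are smooth near a point. -/
theorem exists_openPartialHomeomorph_of_injective_fderiv {E F : Type*}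
    [NormedAddCommGroup E] [NormedSpace ℝ E] [FiniteDimensional ℝ E]
    [NormedAddCommGroup F] [NormedSpace ℝ F] [FiniteDimensional ℝ F]
    (hEF : Module.finrank ℝ E = Module.finrank ℝ F) {f : E → F} {z : E}
    (hf : ∀ᶠ w in 𝓝 z, ContDiffAt ℝ ∞ f w) (hinj : Function.Injective (fderiv ℝ f z)) :
    ∃ e : OpenPartialHomeomorph E F, z ∈ e.source ∧ (∀ w, e w = f w) ∧
      ∀ y ∈ e.target, ContDiffAt ℝ ∞ e.symm y := by
  have hequiv (L : E →L[ℝ] F) (hL : Function.Injective L) : ∃ L' : E ≃L[ℝ] F, (L' : E →L[ℝ] F) = L :=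
    ⟨(LinearEquiv.ofInjectiveOfFinrankEq (L : E →ₗ[ℝ] F) hL hEF).toContinuousLinearEquiv, by
      ext; rfl⟩
  obtain ⟨L, hL⟩ := hequiv _ hinj
  have hz := hf.self_of_nhds
  have hd : HasFDerivAt f (L : E →L[ℝ] F) z := by
    rw [hL]; exact (hz.differentiableAt (by simp)).hasFDerivAt
  -- Invertibility of the derivative is an open condition, so shrinking the source makes the inverse
  -- smooth on the whole target.
  have hinj' : ∀ᶠ w in 𝓝 z, ∃ L' : E ≃L[ℝ] F, (L' : E →L[ℝ] F) = fderiv ℝ f w := by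
    have hc : ContinuousAt (fderiv ℝ f) z := (hz.fderiv_right (m := 0) (by simp)).continuousAt
    refine hc.eventually (p := fun L : E →L[ℝ] F ↦ ∃ L' : E ≃L[ℝ] F, (L' : E →L[ℝ] F) = L) ?_
    rw [← hL]
    exact ContinuousLinearEquiv.nhds L
  obtain ⟨U, hU, hUo, hzU⟩ := eventually_nhds_iff.1 (hf.and hinj')
  let e := (hz.toOpenPartialHomeomorph f hd (by simp)).restrOpen U hUo
  refine ⟨e, ⟨hz.mem_toOpenPartialHomeomorph_source hd (by simp), hzU⟩, fun w ↦ rfl, fun y hy ↦ ?_⟩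
  have hw := (e.map_target hy).2
  obtain ⟨L', hL'⟩ := (hU _ hw).2
  refine e.contDiffAt_symm (f₀' := L') hy ?_ (hU _ hw).1
  rw [hL']
  exact ((hU _ hw).1.differentiableAt (by simp)).hasFDerivAt

/-! ### Null parametrizations -/

namespace LorentzianMetric

variable {X : Type*} [TopologicalSpace X] [ChartedSpace (EuclideanSpace ℝ (Fin 2)) X]
  [IsManifold (𝓡 2) ∞ X]

/-- `P` is smooth at `z`, and it pulls the metric back to a positive multiple of `du dv` there. -/
structure NullAt (g : LorentzianMetric X) (P : ℝ × ℝ → X) (z : ℝ × ℝ) : Prop where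
  contMDiffAt : ContMDiffAt 𝓘(ℝ, ℝ × ℝ) (𝓡 2) ∞ P z
  pull_left : g.pull P z (1, 0) (1, 0) = 0
  pull_right : g.pull P z (0, 1) (0, 1) = 0
  pull_pos : 0 < g.pull P z (1, 0) (0, 1)

/-- `P` parametrizes a neighbourhood of `P z` by null coordinates near `z`. -/
def NullNear (g : LorentzianMetric X) (P : ℝ × ℝ → X) (z : ℝ × ℝ) : Prop :=
  ∀ᶠ w in 𝓝 z, g.NullAt P w

variable {g : LorentzianMetric X} {P Q : ℝ × ℝ → X} {z w : ℝ × ℝ}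

theorem NullAt.mdifferentiableAt (h : g.NullAt P z) :
    MDifferentiableAt 𝓘(ℝ, ℝ × ℝ) (𝓡 2) P z := h.contMDiffAt.mdifferentiableAt (by simp)

theorem NullAt.pull_eq (h : g.NullAt P z) (a b : ℝ × ℝ) :
    g.pull P z a b = g.pull P z (1, 0) (0, 1) * (a.1 * b.2 + a.2 * b.1) := by
  have ha : a = a.1 • (1, 0) + a.2 • (0, 1) := by ext <;> simp
  have hb : b = b.1 • (1, 0) + b.2 • (0, 1) := by ext <;> simp
  have h1 := g.pull_symm P z (0, 1) (1, 0)
  have h2 := h.pull_left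
  have h3 := h.pull_right
  conv_lhs => rw [ha, hb]
  simp only [map_add, map_smul, add_apply, smul_apply, smul_eq_mul, h1, h2, h3]
  ring

theorem NullAt.congr (h : g.NullAt P z) (hPQ : Q =ᶠ[𝓝 z] P) : g.NullAt Q z where
  contMDiffAt := h.contMDiffAt.congr_of_eventuallyEq hPQ
  pull_left := by rw [g.pull_congr hPQ]; exact h.pull_left
  pull_right := by rw [g.pull_congr hPQ]; exact h.pull_right
  pull_pos := by rw [g.pull_congr hPQ]; exact h.pull_pos

theorem NullNear.congr (h : g.NullNear P z) (hPQ : Q =ᶠ[𝓝 z] P) : g.NullNear Q z := by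
  filter_upwards [h, hPQ.eventually_nhds] with w h1 h2 using h1.congr h2

theorem NullNear.nullAt (h : g.NullNear P z) : g.NullAt P z := h.self_of_nhds

theorem NullNear.eventually (h : g.NullNear P z) : ∀ᶠ w in 𝓝 z, g.NullNear P w :=
  h.eventually_nhds

theorem NullNear.continuousAt (h : g.NullNear P z) : ContinuousAt P z :=
  h.nullAt.contMDiffAt.continuousAt

/-- Changing null coordinates by a local diffeomorphism preserving `du dv` up to a positive
factor. -/
theorem NullAt.comp {Φ : ℝ × ℝ → ℝ × ℝ} (h : g.NullAt P (Φ w)) (hΦ : ContDiffAt ℝ ∞ Φ w)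
    (h1 : (fderiv ℝ Φ w (1, 0)).1 * (fderiv ℝ Φ w (1, 0)).2 = 0)
    (h2 : (fderiv ℝ Φ w (0, 1)).1 * (fderiv ℝ Φ w (0, 1)).2 = 0)
    (h3 : 0 < (fderiv ℝ Φ w (1, 0)).1 * (fderiv ℝ Φ w (0, 1)).2
      + (fderiv ℝ Φ w (1, 0)).2 * (fderiv ℝ Φ w (0, 1)).1) : g.NullAt (P ∘ Φ) w := by
  have hd := hΦ.differentiableAt (by simp)
  refine ⟨h.contMDiffAt.comp w hΦ.contMDiffAt, ?_, ?_, ?_⟩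
  · rw [g.pull_comp h.mdifferentiableAt hd, h.pull_eq]
    linear_combination (2 * g.pull P (Φ w) (1, 0) (0, 1)) * h1
  · rw [g.pull_comp h.mdifferentiableAt hd, h.pull_eq]
    linear_combination (2 * g.pull P (Φ w) (1, 0) (0, 1)) * h2
  · rw [g.pull_comp h.mdifferentiableAt hd, h.pull_eq]
    exact mul_pos h.pull_pos h3

/-- A null parametrization is a local diffeomorphism. -/
theorem NullNear.exists_openPartialHomeomorph (h : g.NullNear P z) :
    ∃ e : OpenPartialHomeomorph (ℝ × ℝ) X, z ∈ e.source ∧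
      (∀ w ∈ e.source, e w = P w ∧ g.NullAt P w) ∧
      ∀ x ∈ e.target, ContMDiffAt (𝓡 2) 𝓘(ℝ, ℝ × ℝ) ∞ e.symm x := by
  set κ := chartAt (EuclideanSpace ℝ (Fin 2)) (P z) with hκ
  have hsrc : ∀ᶠ w in 𝓝 z, P w ∈ κ.source :=
    h.continuousAt.eventually (κ.open_source.mem_nhds (mem_chart_source _ _))
  have hf : ∀ᶠ w in 𝓝 z, ContDiffAt ℝ ∞ (κ ∘ P) w := by
    filter_upwards [h, hsrc] with w h1 h2
    have : ContMDiffAt (𝓡 2) 𝓘(ℝ, EuclideanSpace ℝ (Fin 2)) ∞ κ (P w) :=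
      (contMDiffOn_chart (P w) h2).contMDiffAt (κ.open_source.mem_nhds h2)
    exact (this.comp w h1.contMDiffAt).contDiffAt
  have hPκ : P =ᶠ[𝓝 z] κ.symm ∘ (κ ∘ P) := by
    filter_upwards [hsrc] with w hw
    exact (κ.left_inv hw).symm
  have hinj : Function.Injective (fderiv ℝ (κ ∘ P) z) := by
    rw [injective_iff_map_eq_zero]
    intro a ha
    have hs : MDifferentiableAt 𝓘(ℝ, EuclideanSpace ℝ (Fin 2)) (𝓡 2) κ.symm ((κ ∘ P) z) := by
      have h2 : κ (P z) ∈ κ.target := κ.map_source (mem_chart_source _ _)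
      exact ((contMDiffOn_chart_symm (n := ∞) _ h2).contMDiffAt
        (κ.open_target.mem_nhds h2)).mdifferentiableAt (by simp)
    -- A vector killed by the derivative is orthogonal to every vector for the pulled-back form,
    -- which is nondegenerate.
    have h3 (b) : g.pull P z a b = 0 := by
      rw [g.pull_congr hPκ, g.pull_comp hs (hf.self_of_nhds.differentiableAt (by simp)), ha]
      simp
    have hp := h.nullAt.pull_pos
    have h4 := h3 (1, 0)
    have h5 := h3 (0, 1)
    rw [h.nullAt.pull_eq] at h4 h5
    simp only [mul_one, mul_zero, zero_add, add_zero, mul_eq_zero, hp.ne', false_or] at h4 h5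
    exact Prod.ext h5 h4
  obtain ⟨e₀, hz, hcoe, hsymm⟩ := exists_openPartialHomeomorph_of_injective_fderiv
    (by simp) hf hinj
  obtain ⟨U, hU, hUo, hzU⟩ := eventually_nhds_iff.1 (h.and hsrc)
  refine ⟨(e₀.restrOpen U hUo) ≫ₕ κ.symm, ?_, ?_, ?_⟩
  · simp only [mfld_simps]
    exact ⟨⟨hz, hzU⟩, by rw [hcoe]; exact κ.map_source (mem_chart_source _ _)⟩
  · intro w hw
    simp only [mfld_simps] at hw ⊢
    refine ⟨?_, (hU w hw.1.2).1⟩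
    change κ.symm (e₀ w) = P w
    rw [hcoe]
    exact κ.left_inv (hU w hw.1.2).2
  · intro x hx
    simp only [mfld_simps] at hx
    have h1 : ContMDiffAt (𝓡 2) 𝓘(ℝ, EuclideanSpace ℝ (Fin 2)) ∞ κ x :=
      (contMDiffOn_chart x hx.1).contMDiffAt (κ.open_source.mem_nhds hx.1)
    exact (hsymm _ hx.2.1).contMDiffAt.comp x h1

end LorentzianMetric

/-! ### Existence of null coordinates -/

/-- The two null slopes of an indefinite quadratic form depending smoothly on a parameter. -/
theorem contDiffAt_slope {E : Type*} [NormedAddCommGroup E] [NormedSpace ℝ E] {a b c : E → ℝ}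
    {z : E} (ha : ContDiffAt ℝ ∞ a z) (hb : ContDiffAt ℝ ∞ b z) (hc : ContDiffAt ℝ ∞ c z)
    (ha0 : 0 < a z) (hc0 : c z < 0) (ε : ℝ) :
    ContDiffAt ℝ ∞ (fun w ↦ (-b w + ε * √(b w ^ 2 - a w * c w)) / c w) z := by
  have : b z ^ 2 - a z * c z ≠ 0 := by nlinarith [sq_nonneg (b z)]
  exact (hb.neg.add (contDiffAt_const.mul (((hb.pow 2).sub (ha.mul hc)).sqrt this))).div hc hc0.ne

theorem slope_eq {a b c ε : ℝ} (ha : 0 < a) (hc : c < 0) (hε : ε ^ 2 = 1) :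
    a + 2 * b * ((-b + ε * √(b ^ 2 - a * c)) / c)
      + c * ((-b + ε * √(b ^ 2 - a * c)) / c) ^ 2 = 0 := by
  have h : 0 ≤ b ^ 2 - a * c := by nlinarith [sq_nonneg b]
  have h2 := Real.sq_sqrt h
  set r := √(b ^ 2 - a * c)
  have hc' := hc.ne
  field_simp
  linear_combination r ^ 2 * hε + h2

/-- A function vanishing on `(1, m)` but not on `(0, 1)` has kernel spanned by `(1, m)`. -/
theorem snd_eq_of_map_eq_zero {L : ℝ × ℝ →L[ℝ] ℝ} {m : ℝ} (h1 : L (1, m) = 0)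
    (h2 : L (0, 1) ≠ 0) {a : ℝ × ℝ} (ha : L a = 0) : a = a.1 • (1, m) := by
  have h3 : a = a.1 • (1, m) + (a.2 - a.1 * m) • (0, 1) := by ext <;> simp
  have h4 : L a = (a.2 - a.1 * m) * L (0, 1) := by
    conv_lhs => rw [h3]
    rw [map_add, map_smul, map_smul, h1, smul_zero, zero_add, smul_eq_mul]
  rw [ha] at h4
  have h5 := (mul_eq_zero.1 h4.symm).resolve_right h2
  rw [h5, zero_smul, add_zero] at h3
  exact h3

namespace LorentzianMetric

variable {X : Type*} [TopologicalSpace X] [ChartedSpace (EuclideanSpace ℝ (Fin 2)) X]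
  [IsManifold (𝓡 2) ∞ X]

/-- Around each point there are coordinates in which the first coordinate direction is spacelike
and the second one timelike. -/
theorem exists_pull_pos_neg (g : LorentzianMetric X) (x : X) :
    ∃ P : ℝ × ℝ → X, P 0 = x ∧ (∀ᶠ z in 𝓝 0, ContMDiffAt 𝓘(ℝ, ℝ × ℝ) (𝓡 2) ∞ P z) ∧
      0 < g.pull P 0 (1, 0) (1, 0) ∧ g.pull P 0 (0, 1) (0, 1) < 0 := by
  set κ := chartAt (EuclideanSpace ℝ (Fin 2)) x with hκ
  have ht : κ x ∈ κ.target := κ.map_source (mem_chart_source _ _)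
  have hx : κ.symm (κ x) = x := κ.left_inv (mem_chart_source _ _)
  have hsmooth (y) (hy : y ∈ κ.target) :
      ContMDiffAt 𝓘(ℝ, EuclideanSpace ℝ (Fin 2)) (𝓡 2) ∞ κ.symm y :=
    (contMDiffOn_chart_symm (n := ∞) _ hy).contMDiffAt (κ.open_target.mem_nhds hy)
  have hsurj : Function.Surjective (mfderiv 𝓘(ℝ, EuclideanSpace ℝ (Fin 2)) (𝓡 2) κ.symm (κ x)) :=
    (mdifferentiable_chart x).symm.mfderiv_surjective ht
  obtain ⟨v', hv'⟩ := g.exists_pos (κ.symm (κ x))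
  obtain ⟨w', hw'⟩ := g.exists_neg (κ.symm (κ x))
  obtain ⟨v, rfl⟩ := hsurj v'
  obtain ⟨w, rfl⟩ := hsurj w'
  let A : ℝ × ℝ →L[ℝ] EuclideanSpace ℝ (Fin 2) :=
    (ContinuousLinearMap.fst ℝ ℝ ℝ).smulRight v + (ContinuousLinearMap.snd ℝ ℝ ℝ).smulRight w
  have hAvw (v w : EuclideanSpace ℝ (Fin 2)) :
      ((ContinuousLinearMap.fst ℝ ℝ ℝ).smulRight v + (ContinuousLinearMap.snd ℝ ℝ ℝ).smulRight w)
        (1, 0) = v ∧ ((ContinuousLinearMap.fst ℝ ℝ ℝ).smulRight v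
        + (ContinuousLinearMap.snd ℝ ℝ ℝ).smulRight w) (0, 1) = w := by simp
  have hA (z) : HasFDerivAt (fun z ↦ κ x + A z) A z := A.hasFDerivAt.const_add _
  have hA0 : κ x + A 0 = κ x := by simp
  refine ⟨κ.symm ∘ fun z ↦ κ x + A z, by simp [hx], ?_, ?_, ?_⟩
  · have h1 : ContinuousAt (fun z ↦ κ x + A z) 0 := (hA 0).continuousAt
    have h2 : ∀ᶠ z in 𝓝 0, κ x + A z ∈ κ.target :=
      h1.eventually (κ.open_target.mem_nhds (by simpa using ht))
    filter_upwards [h2] with z hz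
    have h3 : ContDiff ℝ ∞ fun z ↦ κ x + A z := by fun_prop
    exact (hsmooth _ hz).comp z h3.contDiffAt.contMDiffAt
  all_goals
    rw [g.pull_comp (by rw [hA0]; exact (hsmooth _ ht).mdifferentiableAt (by simp))
      (hA 0).differentiableAt, (hA 0).fderiv, hA0]
  · have : A (1, 0) = v := (hAvw v w).1
    rw [this]
    exact hv'
  · have : A (0, 1) = w := (hAvw v w).2
    rw [this]
    exact hw'

/-- Null coordinates exist around each point. -/
theorem exists_nullNear (g : LorentzianMetric X) (x : X) :
    ∃ P : ℝ × ℝ → X, P 0 = x ∧ g.NullNear P 0 := by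
  obtain ⟨P, hP0, hP, hpos, hneg⟩ := g.exists_pull_pos_neg x
  set a : ℝ × ℝ → ℝ := fun z ↦ g.pull P z (1, 0) (1, 0) with ha_def
  set b : ℝ × ℝ → ℝ := fun z ↦ g.pull P z (1, 0) (0, 1) with hb_def
  set c : ℝ × ℝ → ℝ := fun z ↦ g.pull P z (0, 1) (0, 1) with hc_def
  have hpull (z : ℝ × ℝ) (s m : ℝ) : g.pull P z (s • (1, m)) (s • (1, m))
      = s ^ 2 * (a z + 2 * b z * m + c z * m ^ 2) := by
    have h1 : ((1 : ℝ), m) = (1, 0) + m • (0, 1) := by ext <;> simp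
    have h2 := g.pull_symm P z (0, 1) (1, 0)
    rw [h1]
    simp only [map_add, map_smul, add_apply, smul_apply, smul_eq_mul, h2, a, b, c]
    ring
  have ha : ∀ᶠ z in 𝓝 0, ContDiffAt ℝ ∞ a z := hP.mono fun z hz ↦ g.contDiffAt_pull_apply hz _ _
  have hb : ∀ᶠ z in 𝓝 0, ContDiffAt ℝ ∞ b z := hP.mono fun z hz ↦ g.contDiffAt_pull_apply hz _ _
  have hc : ∀ᶠ z in 𝓝 0, ContDiffAt ℝ ∞ c z := hP.mono fun z hz ↦ g.contDiffAt_pull_apply hz _ _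
  have ha0 : ∀ᶠ z in 𝓝 0, 0 < a z := ha.self_of_nhds.continuousAt.eventually (lt_mem_nhds hpos)
  have hc0 : ∀ᶠ z in 𝓝 0, c z < 0 := hc.self_of_nhds.continuousAt.eventually (gt_mem_nhds hneg)
  -- The sign `ε` selects one of the roots `m` of `a + 2bm + cm² = 0`, real and distinct since `a >
  -- 0 > c`. The root is cut off to a global smooth function, as the first integral is built from a
  -- globally defined slope.
  have hslope (ε : ℝ) (hε : ε ^ 2 = 1) : ∃ (m η : ℝ × ℝ → ℝ),
      (∀ᶠ z in 𝓝 0, m z = (-b z + ε * √(b z ^ 2 - a z * c z)) / c z) ∧ η 0 = 0 ∧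
      fderiv ℝ η 0 (0, 1) = 1 ∧
      (∀ᶠ z in 𝓝 0, ContDiffAt ℝ ∞ η z) ∧ (∀ᶠ z in 𝓝 0, fderiv ℝ η z (0, 1) ≠ 0) ∧
      (∀ᶠ z in 𝓝 0, fderiv ℝ η z (1, m z) = 0) ∧
      ∀ᶠ z in 𝓝 0, ∀ s : ℝ, g.pull P z (s • (1, m z)) (s • (1, m z)) = 0 := by
    obtain ⟨m, hm, hm'⟩ := exists_contDiff_eventuallyEq_prod
      (f := fun z ↦ (-b z + ε * √(b z ^ 2 - a z * c z)) / c z) (x := 0) (by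
        filter_upwards [ha, hb, hc, ha0, hc0] with z h1 h2 h3 h4 h5
        exact contDiffAt_slope h1 h2 h3 h4 h5 ε)
    obtain ⟨η, h1, h2, h3⟩ := exists_firstIntegral hm
    have hd := h1.self_of_nhds
    have h4 : fderiv ℝ η 0 (0, 1) = 1 := by
      have e1 : HasFDerivAt η (fderiv ℝ η 0) ((fun y : ℝ ↦ ((0 : ℝ), y)) 0) :=
        (hd.differentiableAt (by simp)).hasFDerivAt
      have e2 : HasDerivAt (fun y : ℝ ↦ ((0 : ℝ), y)) (0, 1) 0 :=
        (hasDerivAt_const (0 : ℝ) (0 : ℝ)).prodMk (hasDerivAt_id 0)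
      have e3 := e1.comp_hasDerivAt (0 : ℝ) e2
      have e4 : HasDerivAt (η ∘ fun y : ℝ ↦ ((0 : ℝ), y)) 1 0 :=
        (hasDerivAt_id (0 : ℝ)).congr_of_eventuallyEq h2
      exact e3.unique e4
    have h5 : ContinuousAt (fun z ↦ fderiv ℝ η z (0, 1)) 0 :=
      ((hd.fderiv_right (m := 0) (by simp)).continuousAt).clm_apply continuousAt_const
    refine ⟨m, η, hm', h2.self_of_nhds, h4, h1, ?_, h3, ?_⟩
    · exact h5.eventually_ne (by rw [h4]; exact one_ne_zero)
    · filter_upwards [hm', ha0, hc0] with z e1 e2 e3 s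
      rw [hpull, e1, slope_eq e2 e3 hε, mul_zero]
  obtain ⟨m₁, η₁, hm₁, hη₁0, hη₁d, hη₁, hη₁n, hη₁m, hnull₁⟩ := hslope 1 (by norm_num)
  obtain ⟨m₂, η₂, hm₂, hη₂0, hη₂d, hη₂, hη₂n, hη₂m, hnull₂⟩ := hslope (-1) (by norm_num)
  have hmne : m₁ 0 ≠ m₂ 0 := by
    rw [hm₁.self_of_nhds, hm₂.self_of_nhds]
    intro h
    have hc0' := hc0.self_of_nhds.ne
    have : 0 < √(b 0 ^ 2 - a 0 * c 0) :=
      Real.sqrt_pos.2 (by nlinarith [sq_nonneg (b 0), ha0.self_of_nhds, hc0.self_of_nhds])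
    rw [div_left_inj' hc0'] at h
    linarith
  -- With the order `(η₂, η₁)`, moving along the first coordinate keeps `η₁` fixed and so follows
  -- the null direction `(1, m₁)`.
  have hΨ : ∀ᶠ z in 𝓝 0, ContDiffAt ℝ ∞ (fun p ↦ (η₂ p, η₁ p)) z := by
    filter_upwards [hη₁, hη₂] with z h1 h2 using h2.prodMk h1
  have hΨd {z : ℝ × ℝ} (h1 : ContDiffAt ℝ ∞ η₁ z) (h2 : ContDiffAt ℝ ∞ η₂ z) (v : ℝ × ℝ) :
      fderiv ℝ (fun p ↦ (η₂ p, η₁ p)) z v = (fderiv ℝ η₂ z v, fderiv ℝ η₁ z v) := by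
    rw [(h2.differentiableAt (by simp)).fderiv_prodMk (h1.differentiableAt (by simp))]
    rfl
  have hinj : Function.Injective (fderiv ℝ (fun p ↦ (η₂ p, η₁ p)) 0) := by
    rw [injective_iff_map_eq_zero]
    intro v hv
    rw [hΨd hη₁.self_of_nhds hη₂.self_of_nhds, Prod.mk_eq_zero] at hv
    have e1 := snd_eq_of_map_eq_zero hη₁m.self_of_nhds hη₁n.self_of_nhds hv.2
    have e2 := snd_eq_of_map_eq_zero hη₂m.self_of_nhds hη₂n.self_of_nhds hv.1
    have e3 : v.2 = v.1 * m₁ 0 := by simpa using congrArg Prod.snd e1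
    have e4 : v.2 = v.1 * m₂ 0 := by simpa using congrArg Prod.snd e2
    have e5 : v.1 * (m₁ 0 - m₂ 0) = 0 := by linarith
    have e6 := (mul_eq_zero.1 e5).resolve_right (sub_ne_zero.2 hmne)
    rw [e6, zero_smul] at e1
    exact e1
  obtain ⟨e, he0, hcoe, hsymm⟩ := exists_openPartialHomeomorph_of_injective_fderiv rfl hΨ hinj
  have he00 : e 0 = 0 := by rw [hcoe, hη₁0, hη₂0]; rfl
  have ht0 : (0 : ℝ × ℝ) ∈ e.target := by rw [← he00]; exact e.map_source he0
  have hs0 : e.symm 0 = 0 := by conv_lhs => rw [← he00]; exact e.left_inv he0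
  have htend : Tendsto e.symm (𝓝 0) (𝓝 0) := by
    have := (e.continuousAt_symm ht0).tendsto
    rwa [hs0] at this
  have htarget : ∀ᶠ y in 𝓝 (0 : ℝ × ℝ), y ∈ e.target := e.open_target.mem_nhds ht0
  have hinvd : ∀ᶠ y in 𝓝 (0 : ℝ × ℝ), ∀ v, fderiv ℝ η₂ (e.symm y) (fderiv ℝ e.symm y v) = v.1 ∧
      fderiv ℝ η₁ (e.symm y) (fderiv ℝ e.symm y v) = v.2 := by
    filter_upwards [htarget, htend.eventually hη₁, htend.eventually hη₂] with y h1 h2 h3 v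
    have e1 := ((h3.prodMk h2).differentiableAt (by simp)).hasFDerivAt.comp y
      ((hsymm y h1).differentiableAt (by simp)).hasFDerivAt
    have e2 : HasFDerivAt ((fun p ↦ (η₂ p, η₁ p)) ∘ e.symm) (.id ℝ (ℝ × ℝ)) y := by
      refine (hasFDerivAt_id y).congr_of_eventuallyEq ?_
      filter_upwards [e.open_target.mem_nhds h1] with y' hy'
      have := e.right_inv hy'
      rwa [hcoe] at this
    have e3 := congrArg (fun L ↦ L v) (e1.unique e2)
    simp only [ContinuousLinearMap.comp_apply, hΨd h2 h3, ContinuousLinearMap.id_apply] at e3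
    exact ⟨congrArg Prod.fst e3, congrArg Prod.snd e3⟩
  set R : ℝ × ℝ → X := P ∘ e.symm with hR
  have hRs : ∀ᶠ y in 𝓝 (0 : ℝ × ℝ), ContMDiffAt 𝓘(ℝ, ℝ × ℝ) (𝓡 2) ∞ R y := by
    filter_upwards [htarget, htend.eventually hP] with y h1 h2
    exact h2.comp y (hsymm y h1).contMDiffAt
  have hRpull : ∀ᶠ y in 𝓝 (0 : ℝ × ℝ), ∀ v w, g.pull R y v w
      = g.pull P (e.symm y) (fderiv ℝ e.symm y v) (fderiv ℝ e.symm y w) := by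
    filter_upwards [htarget, htend.eventually hP] with y h1 h2 v w
    exact g.pull_comp (h2.mdifferentiableAt (by simp)) ((hsymm y h1).differentiableAt (by simp)) _ _
  have hleft : ∀ᶠ y in 𝓝 (0 : ℝ × ℝ), g.pull R y (1, 0) (1, 0) = 0 := by
    filter_upwards [hRpull, hinvd, htend.eventually hη₁n, htend.eventually hη₁m,
      htend.eventually hnull₁] with y h1 h2 h3 h4 h5
    have := snd_eq_of_map_eq_zero h4 h3 (h2 (1, 0)).2
    rw [h1, this]
    exact h5 _
  have hright : ∀ᶠ y in 𝓝 (0 : ℝ × ℝ), g.pull R y (0, 1) (0, 1) = 0 := by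
    filter_upwards [hRpull, hinvd, htend.eventually hη₂n, htend.eventually hη₂m,
      htend.eventually hnull₂] with y h1 h2 h3 h4 h5
    have := snd_eq_of_map_eq_zero h4 h3 (h2 (0, 1)).1
    rw [h1, this]
    exact h5 _
  -- If the mixed term also vanished, the quadratic form would be zero at the origin, whereas `(1,
  -- 0)` is spacelike for `P`.
  have hcross : g.pull R 0 (1, 0) (0, 1) ≠ 0 := by
    intro h0
    have hzero (v : ℝ × ℝ) : g.pull R 0 v v = 0 := by
      have e1 : v = v.1 • (1, 0) + v.2 • (0, 1) := by ext <;> simp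
      have e2 := g.pull_symm R 0 (0, 1) (1, 0)
      rw [e1]
      simp only [map_add, map_smul, add_apply, smul_apply, smul_eq_mul, e2, h0,
        hleft.self_of_nhds, hright.self_of_nhds]
      ring
    have hsurj : Function.Surjective (fderiv ℝ e.symm 0) := by
      have : Function.Injective (fderiv ℝ e.symm 0 : ℝ × ℝ →ₗ[ℝ] ℝ × ℝ) := by
        intro v w hvw
        have hvw' : fderiv ℝ e.symm 0 v = fderiv ℝ e.symm 0 w := hvw
        have e1 := hinvd.self_of_nhds v
        have e2 := hinvd.self_of_nhds w
        rw [hvw'] at e1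
        exact Prod.ext (e1.1.symm.trans e2.1) (e1.2.symm.trans e2.2)
      exact LinearMap.surjective_of_injective this
    obtain ⟨v, hv⟩ := hsurj (1, 0)
    have h1 := hzero v
    rw [hRpull.self_of_nhds, hv, hs0] at h1
    exact hpos.ne' h1
  have hcc : ContinuousAt (fun y ↦ g.pull R y (1, 0) (0, 1)) 0 :=
    (g.contDiffAt_pull_apply hRs.self_of_nhds _ _).continuousAt
  rcases lt_or_gt_of_ne hcross with hlt | hgt
  -- A negative mixed term is corrected by reversing the second coordinate.
  · let σ : ℝ × ℝ →L[ℝ] ℝ × ℝ :=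
      (ContinuousLinearMap.fst ℝ ℝ ℝ).prod (-ContinuousLinearMap.snd ℝ ℝ ℝ)
    have hσ : Tendsto σ (𝓝 0) (𝓝 0) := by simpa using σ.continuous.tendsto 0
    refine ⟨R ∘ σ, by simp [hR, hs0, hP0], ?_⟩
    filter_upwards [hσ.eventually hleft, hσ.eventually hright, hσ.eventually hRs,
      hσ.eventually (hcc.eventually (gt_mem_nhds hlt))] with y h1 h2 h3 h4
    have h5 (v w) : g.pull (R ∘ σ) y v w = g.pull R (σ y) (σ v) (σ w) := by
      rw [g.pull_comp (h3.mdifferentiableAt (by simp)) σ.differentiableAt, σ.fderiv]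
    have e1 : σ (1, 0) = (1, 0) := by simp [σ]
    have e2 : σ (0, 1) = -(0, 1) := by simp [σ]
    refine ⟨h3.comp y σ.contDiff.contDiffAt.contMDiffAt, ?_, ?_, ?_⟩
    · rw [h5, e1, h1]
    · rw [h5, e2, map_neg, map_neg, neg_apply, h2, neg_zero, neg_zero]
    · rw [h5, e1, e2, map_neg]; exact neg_pos.2 h4
  · refine ⟨R, by simp [hR, hs0, hP0], ?_⟩
    filter_upwards [hleft, hright, hRs, hcc.eventually (lt_mem_nhds hgt)] with y h1 h2 h3 h4
    exact ⟨h3, h1, h2, h4⟩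

end LorentzianMetric

/-! ### Increasing changes of parameter -/

theorem HasDerivAt.fst_comp {f : ℝ → ℝ × ℝ} {f' : ℝ × ℝ} {t : ℝ} (h : HasDerivAt f f' t) :
    HasDerivAt (fun s ↦ (f s).1) f'.1 t :=
  (ContinuousLinearMap.fst ℝ ℝ ℝ).hasFDerivAt.comp_hasDerivAt t h

theorem HasDerivAt.snd_comp {f : ℝ → ℝ × ℝ} {f' : ℝ × ℝ} {t : ℝ} (h : HasDerivAt f f' t) :
    HasDerivAt (fun s ↦ (f s).2) f'.2 t :=
  (ContinuousLinearMap.snd ℝ ℝ ℝ).hasFDerivAt.comp_hasDerivAt t h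

/-- `h` is a smooth map with positive derivative near `t`. -/
def SmoothIncrNear (h : ℝ → ℝ) (t : ℝ) : Prop :=
  ∀ᶠ s in 𝓝 t, ContDiffAt ℝ ∞ h s ∧ 0 < deriv h s

namespace SmoothIncrNear

variable {h k : ℝ → ℝ} {t : ℝ}

theorem continuousAt (hh : SmoothIncrNear h t) : ContinuousAt h t :=
  hh.self_of_nhds.1.continuousAt

theorem congr (hh : SmoothIncrNear h t) (hk : k =ᶠ[𝓝 t] h) : SmoothIncrNear k t := by
  filter_upwards [hh, hk.eventually_nhds] with s h1 h2
  exact ⟨h1.1.congr_of_eventuallyEq h2, by rw [EventuallyEq.deriv_eq h2]; exact h1.2⟩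

theorem id (t : ℝ) : SmoothIncrNear (fun s ↦ s) t :=
  .of_forall fun s ↦ ⟨contDiffAt_id, by simp⟩

theorem add_const (t c : ℝ) : SmoothIncrNear (fun s ↦ s + c) t :=
  .of_forall fun s ↦ ⟨by fun_prop, by simp⟩

theorem comp (hk : SmoothIncrNear k (h t)) (hh : SmoothIncrNear h t) :
    SmoothIncrNear (fun s ↦ k (h s)) t := by
  filter_upwards [hh.continuousAt.eventually hk, hh] with s h1 h2
  refine ⟨h1.1.comp s h2.1, ?_⟩
  have := deriv_comp s (h1.1.differentiableAt (by simp)) (h2.1.differentiableAt (by simp))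
  rw [Function.comp_def] at this
  rw [this]
  exact mul_pos h1.2 h2.2

theorem exists_inverse (hh : SmoothIncrNear h t) :
    ∃ k, k (h t) = t ∧ SmoothIncrNear k (h t) ∧ (∀ᶠ s in 𝓝 (h t), h (k s) = s) ∧
      ∀ᶠ s in 𝓝 t, k (h s) = s := by
  have hinj : Function.Injective (fderiv ℝ h t) := by
    rw [injective_iff_map_eq_zero]
    intro a ha
    have h1 : fderiv ℝ h t a = a * deriv h t := by
      rw [← fderiv_apply_one_eq_deriv, ← smul_eq_mul, ← map_smul, smul_eq_mul, mul_one]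
    rw [h1, mul_eq_zero] at ha
    exact ha.resolve_right hh.self_of_nhds.2.ne'
  obtain ⟨e, he, hcoe, hsymm⟩ :=
    exists_openPartialHomeomorph_of_injective_fderiv rfl (hh.mono fun s hs ↦ hs.1) hinj
  have ht : h t ∈ e.target := by rw [← hcoe]; exact e.map_source he
  have hs : e.symm (h t) = t := by rw [← hcoe]; exact e.left_inv he
  have htgt : ∀ᶠ s in 𝓝 (h t), s ∈ e.target := e.open_target.mem_nhds ht
  have hright : ∀ᶠ s in 𝓝 (h t), h (e.symm s) = s := by
    filter_upwards [htgt] with s hs'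
    rw [← hcoe]; exact e.right_inv hs'
  have htend : Tendsto e.symm (𝓝 (h t)) (𝓝 t) := by
    have := (e.continuousAt_symm ht).tendsto
    rwa [hs] at this
  refine ⟨e.symm, hs, ?_, hright, ?_⟩
  · filter_upwards [htgt, htend.eventually hh, hright.eventually_nhds] with s h1 h2 h3
    refine ⟨hsymm s h1, ?_⟩
    have d1 := (h2.1.differentiableAt (by simp)).hasDerivAt.comp s
      ((hsymm s h1).differentiableAt (by simp)).hasDerivAt
    have d2 : HasDerivAt (h ∘ e.symm) 1 s := (hasDerivAt_id s).congr_of_eventuallyEq h3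
    have d3 := d1.unique d2
    by_contra hneg
    have : deriv h (e.symm s) * deriv e.symm s ≤ 0 :=
      mul_nonpos_of_nonneg_of_nonpos h2.2.le (not_lt.1 hneg)
    linarith
  · filter_upwards [e.open_source.mem_nhds he] with s hs'
    rw [← hcoe]; exact e.left_inv hs'

end SmoothIncrNear

/-- Near `t`, the curve `c₂` is a smooth orientation preserving reparametrization of the curve `c₁`
near `s`. -/
def Reparam {X : Type*} (c₁ : ℝ → X) (s : ℝ) (c₂ : ℝ → X) (t : ℝ) : Prop :=
  ∃ h : ℝ → ℝ, h t = s ∧ SmoothIncrNear h t ∧ ∀ᶠ τ in 𝓝 t, c₂ τ = c₁ (h τ)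

namespace Reparam

variable {X : Type*} {c₁ c₂ c₃ : ℝ → X} {r s t : ℝ}

theorem eq (h : Reparam c₁ s c₂ t) : c₁ s = c₂ t := by
  obtain ⟨k, rfl, -, hk⟩ := h
  exact hk.self_of_nhds.symm

theorem of_eventuallyEq (h : c₂ =ᶠ[𝓝 t] c₁) : Reparam c₁ t c₂ t :=
  ⟨fun s ↦ s, rfl, .id t, h⟩

theorem symm (h : Reparam c₁ s c₂ t) : Reparam c₂ t c₁ s := by
  obtain ⟨k, rfl, hk, hc⟩ := h
  obtain ⟨l, hl, hl', hkl, -⟩ := hk.exists_inverse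
  have : Tendsto l (𝓝 (k t)) (𝓝 t) := by
    have := hl'.continuousAt.tendsto
    rwa [hl] at this
  refine ⟨l, hl, hl', ?_⟩
  filter_upwards [hkl, this.eventually hc] with τ h1 h2
  rw [h2, h1]

theorem trans (h : Reparam c₁ r c₂ s) (h' : Reparam c₂ s c₃ t) : Reparam c₁ r c₃ t := by
  obtain ⟨k, rfl, hk, hc⟩ := h
  obtain ⟨l, rfl, hl, hc'⟩ := h'
  refine ⟨fun τ ↦ k (l τ), rfl, hk.comp hl, ?_⟩
  filter_upwards [hc', hl.continuousAt.eventually hc] with τ h1 h2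
  rw [h1, h2]

end Reparam

/-! ### Self-maps of the plane preserving null directions -/

/-- `Φ` is smooth at `w` and preserves `du dv` up to a positive factor there. -/
structure NullMapAt (Φ : ℝ × ℝ → ℝ × ℝ) (w : ℝ × ℝ) : Prop where
  contDiffAt : ContDiffAt ℝ ∞ Φ w
  left : (fderiv ℝ Φ w (1, 0)).1 * (fderiv ℝ Φ w (1, 0)).2 = 0
  right : (fderiv ℝ Φ w (0, 1)).1 * (fderiv ℝ Φ w (0, 1)).2 = 0
  pos : 0 < (fderiv ℝ Φ w (1, 0)).1 * (fderiv ℝ Φ w (0, 1)).2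
      + (fderiv ℝ Φ w (1, 0)).2 * (fderiv ℝ Φ w (0, 1)).1

namespace NullMapAt

variable {Φ : ℝ × ℝ → ℝ × ℝ} {w : ℝ × ℝ}

theorem hasFDerivAt (h : NullMapAt Φ w) : HasFDerivAt Φ (fderiv ℝ Φ w) w :=
  (h.contDiffAt.differentiableAt (by simp)).hasFDerivAt

theorem continuousAt_fderiv_apply (h : NullMapAt Φ w) (a : ℝ × ℝ) :
    ContinuousAt (fun y ↦ fderiv ℝ Φ y a) w :=
  ((h.contDiffAt.fderiv_right (m := 0) (by simp)).continuousAt).clm_apply continuousAt_const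

/-- A map preserving `du dv` up to a positive factor either keeps or exchanges the two null
directions. A positive first entry selects the case that keeps both of them with their orientations.
-/
theorem of_fst_pos (h : NullMapAt Φ w) (hp : 0 < (fderiv ℝ Φ w (1, 0)).1) :
    (fderiv ℝ Φ w (1, 0)).2 = 0 ∧ (fderiv ℝ Φ w (0, 1)).1 = 0 ∧ 0 < (fderiv ℝ Φ w (0, 1)).2 := by
  have h1 := h.left
  have h2 := h.right
  have h3 := h.pos
  have h4 := (mul_eq_zero.1 h1).resolve_left hp.ne'
  rw [h4, zero_mul, add_zero] at h3
  have h5 := (pos_iff_pos_of_mul_pos h3).1 hp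
  exact ⟨h4, (mul_eq_zero.1 h2).resolve_right h5.ne', h5⟩

/-- Nondegeneracy prevents a switch between the possible behaviours in the limit: a negative entry
persists nearby, and if the entry is zero then `(1, 0)` goes to the other null direction, which
persists as well. -/
theorem fst_pos_of_frequently (h : NullMapAt Φ w)
    (hf : ∃ᶠ y in 𝓝 w, NullMapAt Φ y ∧ 0 < (fderiv ℝ Φ y (1, 0)).1) :
    0 < (fderiv ℝ Φ w (1, 0)).1 := by
  have hc := (h.continuousAt_fderiv_apply (1, 0)).fst
  have hc' := (h.continuousAt_fderiv_apply (1, 0)).snd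
  by_contra hneg
  rcases (not_lt.1 hneg).lt_or_eq with h1 | h1
  · obtain ⟨y, hy, hy'⟩ := (hf.and_eventually (hc.eventually (gt_mem_nhds h1))).exists
    exact lt_asymm hy.2 hy'
  · have h2 : (fderiv ℝ Φ w (1, 0)).2 ≠ 0 := by
      intro h2
      have := h.pos
      simp [h1, h2] at this
    obtain ⟨y, hy, hy'⟩ := (hf.and_eventually (hc'.eventually_ne h2)).exists
    exact hy' (hy.1.of_fst_pos hy.2).1

/-- A null self-map of the plane that preserves the first coordinate direction is a product of
increasing maps. -/
theorem exists_prod (h : ∀ᶠ y in 𝓝 w, NullMapAt Φ y) (hp : 0 < (fderiv ℝ Φ w (1, 0)).1) :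
    ∃ a b : ℝ → ℝ, SmoothIncrNear a w.1 ∧ SmoothIncrNear b w.2 ∧
      ∀ᶠ y in 𝓝 w, Φ y = (a y.1, b y.2) := by
  have hp' : ∀ᶠ y in 𝓝 w, 0 < (fderiv ℝ Φ y (1, 0)).1 :=
    (h.self_of_nhds.continuousAt_fderiv_apply (1, 0)).fst.eventually (lt_mem_nhds hp)
  obtain ⟨ε, hε, hball⟩ := Metric.eventually_nhds_iff_ball.1 (h.and hp')
  have hbox {u v : ℝ} (hu : u ∈ Metric.ball w.1 ε) (hv : v ∈ Metric.ball w.2 ε) :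
      NullMapAt Φ (u, v) ∧ 0 < (fderiv ℝ Φ (u, v) (1, 0)).1 := by
    refine hball _ ?_
    rw [← ball_prod_same]
    exact ⟨hu, hv⟩
  have hu0 := Metric.mem_ball_self hε (x := w.1)
  have hv0 := Metric.mem_ball_self hε (x := w.2)
  have dl {u v : ℝ} (hu : u ∈ Metric.ball w.1 ε) (hv : v ∈ Metric.ball w.2 ε) :
      HasDerivAt (fun s ↦ Φ (s, v)) (fderiv ℝ Φ (u, v) (1, 0)) u :=
    (hbox hu hv).1.hasFDerivAt.comp_hasDerivAt u
      ((hasDerivAt_id u).prodMk (hasDerivAt_const u v))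
  have dr {u v : ℝ} (hu : u ∈ Metric.ball w.1 ε) (hv : v ∈ Metric.ball w.2 ε) :
      HasDerivAt (fun s ↦ Φ (u, s)) (fderiv ℝ Φ (u, v) (0, 1)) v :=
    (hbox hu hv).1.hasFDerivAt.comp_hasDerivAt v
      ((hasDerivAt_const v u).prodMk (hasDerivAt_id v))
  have hconv (x : ℝ) : IsPreconnected (Metric.ball x ε) := (convex_ball x ε).isPreconnected
  refine ⟨fun u ↦ (Φ (u, w.2)).1, fun v ↦ (Φ (w.1, v)).2, ?_, ?_, ?_⟩
  · filter_upwards [Metric.ball_mem_nhds w.1 hε] with u hu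
    have h1 := (hbox hu hv0)
    refine ⟨contDiffAt_fst.comp u (h1.1.contDiffAt.comp u (by fun_prop)), ?_⟩
    rw [(dl hu hv0).fst_comp.deriv]
    exact h1.2
  · filter_upwards [Metric.ball_mem_nhds w.2 hε] with v hv
    have h1 := (hbox hu0 hv)
    refine ⟨contDiffAt_snd.comp v (h1.1.contDiffAt.comp v (by fun_prop)), ?_⟩
    rw [(dr hu0 hv).snd_comp.deriv]
    exact (h1.1.of_fst_pos h1.2).2.2
  · filter_upwards [Metric.ball_mem_nhds w hε] with y hy
    rw [← ball_prod_same] at hy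
    obtain ⟨hu, hv⟩ := hy
    refine Prod.ext ?_ ?_
    · refine Metric.isOpen_ball.is_const_of_deriv_eq_zero (f := fun s ↦ (Φ (y.1, s)).1) (hconv w.2)
        (fun s hs ↦ (dr hu hs).fst_comp.differentiableAt.differentiableWithinAt) (fun s hs ↦ ?_) hv hv0
      rw [(dr hu hs).fst_comp.deriv]
      exact ((hbox hu hs).1.of_fst_pos (hbox hu hs).2).2.1
    · refine Metric.isOpen_ball.is_const_of_deriv_eq_zero (f := fun s ↦ (Φ (s, y.2)).2) (hconv w.1)
        (fun s hs ↦ (dl hs hv).snd_comp.differentiableAt.differentiableWithinAt) (fun s hs ↦ ?_) hu hu0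
      rw [(dl hs hv).snd_comp.deriv]
      exact ((hbox hs hv).1.of_fst_pos (hbox hs hv).2).1

end NullMapAt

/-! ### Comparison of null parametrizations -/

namespace LorentzianMetric

variable {X : Type*} [TopologicalSpace X] [ChartedSpace (EuclideanSpace ℝ (Fin 2)) X]
  [IsManifold (𝓡 2) ∞ X] {g : LorentzianMetric X} {P Q : ℝ × ℝ → X} {z w : ℝ × ℝ}

theorem NullAt.swap (h : g.NullAt P w.swap) : g.NullAt (P ∘ Prod.swap) w := by
  have h1 : HasFDerivAt (Prod.swap : ℝ × ℝ → ℝ × ℝ)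
      ((ContinuousLinearMap.snd ℝ ℝ ℝ).prod (ContinuousLinearMap.fst ℝ ℝ ℝ)) w :=
    ((ContinuousLinearMap.snd ℝ ℝ ℝ).prod (ContinuousLinearMap.fst ℝ ℝ ℝ)).hasFDerivAt
  refine h.comp (contDiff_snd.prodMk contDiff_fst).contDiffAt ?_ ?_ ?_ <;> rw [h1.fderiv] <;> simp

theorem NullNear.swap (h : g.NullNear P w.swap) : g.NullNear (P ∘ Prod.swap) w := by
  filter_upwards [continuous_swap.continuousAt.eventually h] with y hy using hy.swap

theorem NullAt.comp_prod {a b : ℝ → ℝ} (h : g.NullAt P (a w.1, b w.2))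
    (ha : ContDiffAt ℝ ∞ a w.1) (hb : ContDiffAt ℝ ∞ b w.2) (hab : 0 < deriv a w.1 * deriv b w.2) :
    g.NullAt (fun y ↦ P (a y.1, b y.2)) w := by
  have da := (ha.differentiableAt (by simp)).hasDerivAt.hasFDerivAt.comp w hasFDerivAt_fst
  have db := (hb.differentiableAt (by simp)).hasDerivAt.hasFDerivAt.comp w hasFDerivAt_snd
  have hd := da.prodMk db
  refine NullAt.comp (Φ := fun y ↦ (a y.1, b y.2)) h
    ((ha.comp w contDiffAt_fst).prodMk (hb.comp w contDiffAt_snd)) ?_ ?_ ?_ <;>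
  · simp only [Function.comp_def] at hd
    rw [hd.fderiv]
    first
    | simp; done
    | simpa using hab

theorem NullNear.comp_prod {a b : ℝ → ℝ} (h : g.NullNear P (a w.1, b w.2))
    (ha : SmoothIncrNear a w.1) (hb : SmoothIncrNear b w.2) :
    g.NullNear (fun y ↦ P (a y.1, b y.2)) w := by
  have hc : ContinuousAt (fun y : ℝ × ℝ ↦ (a y.1, b y.2)) w :=
    (ha.continuousAt.comp continuousAt_fst).prodMk (hb.continuousAt.comp continuousAt_snd)
  filter_upwards [hc.eventually h, continuousAt_fst.eventually ha, continuousAt_snd.eventually hb]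
    with y h1 h2 h3
  exact h1.comp_prod h2.1 h3.1 (mul_pos h2.2 h3.2)

theorem NullNear.exists_injOn (h : g.NullNear P z) : ∃ U ∈ 𝓝 z, InjOn P U := by
  obtain ⟨e, he, h1, -⟩ := h.exists_openPartialHomeomorph
  exact ⟨e.source, e.open_source.mem_nhds he, e.injOn.congr fun w hw ↦ (h1 w hw).1⟩

/-- Two null parametrizations of neighbourhoods of the same point differ by a null self-map of the
plane. -/
theorem NullNear.exists_transition (hP : g.NullNear P z) (hQ : g.NullNear Q w) (h : P z = Q w) :
    ∃ Φ : ℝ × ℝ → ℝ × ℝ, Φ w = z ∧ (∀ᶠ y in 𝓝 w, NullMapAt Φ y) ∧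
      (∀ᶠ y in 𝓝 w, Q y = P (Φ y)) ∧ ∀ᶠ p in 𝓝 (z, w), P p.1 = Q p.2 → p.1 = Φ p.2 := by
  obtain ⟨e, he, h1, h2⟩ := hP.exists_openPartialHomeomorph
  have hz : e z = Q w := (h1 z he).1.trans h
  have hw : Q w ∈ e.target := by rw [← hz]; exact e.map_source he
  have hΦw : e.symm (Q w) = z := by rw [← hz]; exact e.left_inv he
  have htgt : ∀ᶠ y in 𝓝 w, Q y ∈ e.target :=
    hQ.continuousAt.eventually (e.open_target.mem_nhds hw)
  have hQP : ∀ᶠ y in 𝓝 w, Q y = P (e.symm (Q y)) := by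
    filter_upwards [htgt] with y hy
    rw [← (h1 _ (e.map_target hy)).1, e.right_inv hy]
  refine ⟨e.symm ∘ Q, hΦw, ?_, hQP, ?_⟩
  · filter_upwards [htgt, hQ, hQP.eventually_nhds] with y hy h3 h4
    have hs : ContDiffAt ℝ ∞ (e.symm ∘ Q) y := ((h2 _ hy).comp y h3.contMDiffAt).contDiffAt
    have hn := (h1 _ (e.map_target hy)).2
    have hpull (a b) : g.pull Q y a b = g.pull P (e.symm (Q y)) (1, 0) (0, 1) *
        ((fderiv ℝ (e.symm ∘ Q) y a).1 * (fderiv ℝ (e.symm ∘ Q) y b).2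
        + (fderiv ℝ (e.symm ∘ Q) y a).2 * (fderiv ℝ (e.symm ∘ Q) y b).1) := by
      rw [g.pull_congr (z := y) (P := Q) (Q := P ∘ (e.symm ∘ Q)) h4,
        g.pull_comp (P := P) (Φ := e.symm ∘ Q) hn.mdifferentiableAt (hs.differentiableAt (by simp))]
      exact hn.pull_eq _ _
    have e1 := h3.pull_left
    have e2 := h3.pull_right
    have e3 := h3.pull_pos
    rw [hpull] at e1 e2 e3
    have e4 := (mul_eq_zero.1 e1).resolve_left hn.pull_pos.ne'
    have e5 := (mul_eq_zero.1 e2).resolve_left hn.pull_pos.ne'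
    exact ⟨hs, by linarith, by linarith, (pos_iff_pos_of_mul_pos e3).1 hn.pull_pos⟩
  · filter_upwards [(continuousAt_fst (p := (z, w))).eventually (e.open_source.mem_nhds he)]
      with p hp hpq
    rw [Function.comp_apply, ← hpq, ← (h1 _ hp).1, e.left_inv hp]

/-- One common coordinate line suffices to decide which of the two null directions `(1, 0)` is sent
to, and with what sign. -/
theorem NullMapAt.fst_of_line {Φ : ℝ × ℝ → ℝ × ℝ} {w : ℝ × ℝ} (hΦ : NullMapAt Φ w) {h : ℝ → ℝ}
    {v : ℝ} (hh : ∀ᶠ t in 𝓝 w.1, Φ (t, w.2) = (h t, v)) :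
    (fderiv ℝ Φ w (1, 0)).1 = deriv h w.1 := by
  have d1 : HasDerivAt (fun s ↦ Φ (s, w.2)) (fderiv ℝ Φ w (1, 0)) w.1 :=
    hΦ.hasFDerivAt.comp_hasDerivAt w.1 ((hasDerivAt_id w.1).prodMk (hasDerivAt_const w.1 w.2))
  rw [← d1.fst_comp.deriv]
  refine EventuallyEq.deriv_eq ?_
  filter_upwards [hh] with t ht
  rw [ht]

/-- If two null parametrizations have a first coordinate line in common, they differ by a product
of increasing maps. -/
theorem NullNear.exists_eq_prod (hP : g.NullNear P z) (hQ : g.NullNear Q w) {h : ℝ → ℝ}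
    (hh : SmoothIncrNear h w.1) (hz : h w.1 = z.1)
    (hPQ : ∀ᶠ t in 𝓝 w.1, Q (t, w.2) = P (h t, z.2)) :
    ∃ b : ℝ → ℝ, b w.2 = z.2 ∧ SmoothIncrNear b w.2 ∧ ∀ᶠ y in 𝓝 w, Q y = P (h y.1, b y.2) := by
  have hzw : P z = Q w := by
    have := hPQ.self_of_nhds
    rw [hz] at this
    exact this.symm
  obtain ⟨Φ, hΦw, hΦ, hQP, hinj⟩ := hP.exists_transition hQ hzw
  -- Local injectivity of `P` turns agreement of curves in `X` into agreement of their coordinates.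
  have hline : ∀ᶠ t in 𝓝 w.1, Φ (t, w.2) = (h t, z.2) := by
    have hc : Tendsto (fun t ↦ ((h t, z.2), (t, w.2))) (𝓝 w.1) (𝓝 (z, w)) := by
      have : ContinuousAt (fun t ↦ ((h t, z.2), (t, w.2))) w.1 :=
        (hh.continuousAt.prodMk continuousAt_const).prodMk (continuousAt_id.prodMk
          continuousAt_const)
      simpa [ContinuousAt, hz] using this
    filter_upwards [hc.eventually hinj, hPQ] with t h1 h2
    exact (h1 h2.symm).symm
  obtain ⟨a, b, ha, hb, hab⟩ := NullMapAt.exists_prod hΦ (by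
    rw [NullMapAt.fst_of_line hΦ.self_of_nhds hline]; exact hh.self_of_nhds.2)
  have hw1 : Tendsto (fun t ↦ (t, w.2)) (𝓝 w.1) (𝓝 w) :=
    (Continuous.tendsto (by fun_prop) _ : Tendsto (fun t : ℝ ↦ (t, w.2)) (𝓝 w.1) (𝓝 (w.1, w.2)))
  have hah : ∀ᶠ t in 𝓝 w.1, a t = h t := by
    filter_upwards [hline, hw1.eventually hab] with t h1 h2
    rw [h1] at h2
    exact (congrArg Prod.fst h2).symm
  refine ⟨b, ?_, hb, ?_⟩
  · have := hab.self_of_nhds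
    rw [hΦw] at this
    exact (congrArg Prod.snd this).symm
  · filter_upwards [hQP, hab, continuousAt_fst.eventually hah] with y h1 h2 h3
    rw [h1, h2, h3]

/-- Being reparametrizations of each other is a closed relation between first coordinate lines of
two null parametrizations. -/
theorem NullNear.reparam_of_frequently (hP : g.NullNear P z) (hQ : g.NullNear Q w) (h : P z = Q w)
    (hf : ∃ᶠ p in 𝓝 (z, w), Reparam (fun t ↦ P (t, p.1.2)) p.1.1 (fun t ↦ Q (t, p.2.2)) p.2.1) :
    Reparam (fun t ↦ P (t, z.2)) z.1 (fun t ↦ Q (t, w.2)) w.1 := by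
  obtain ⟨Φ, hΦw, hΦ, hQP, hinj⟩ := hP.exists_transition hQ h
  have hpos : ∃ᶠ p in 𝓝 (z, w), NullMapAt Φ p.2 ∧ 0 < (fderiv ℝ Φ p.2 (1, 0)).1 := by
    refine (hf.and_eventually (((continuousAt_snd (p := (z, w))).eventually hΦ).and
      hinj.eventually_nhds)).mono ?_
    rintro ⟨z', w'⟩ ⟨⟨k, hk0, hk, hkc⟩, h1, h2⟩
    refine ⟨h1, ?_⟩
    have hline : ∀ᶠ t in 𝓝 w'.1, Φ (t, w'.2) = (k t, z'.2) := by
      have hc : Tendsto (fun t ↦ ((k t, z'.2), (t, w'.2))) (𝓝 w'.1) (𝓝 (z', w')) := by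
        have : ContinuousAt (fun t ↦ ((k t, z'.2), (t, w'.2))) w'.1 :=
          (hk.continuousAt.prodMk continuousAt_const).prodMk (continuousAt_id.prodMk
            continuousAt_const)
        simpa [ContinuousAt, hk0] using this
      filter_upwards [hc.eventually h2, hkc] with t e1 e2
      exact (e1 e2.symm).symm
    rw [NullMapAt.fst_of_line h1 hline]
    exact hk.self_of_nhds.2
  have hpos' := hΦ.self_of_nhds.fst_pos_of_frequently
    ((continuousAt_snd (p := (z, w))).tendsto.frequently hpos)
  obtain ⟨a, b, ha, hb, hab⟩ := NullMapAt.exists_prod hΦ hpos'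
  have h0 := hab.self_of_nhds
  rw [hΦw] at h0
  have hw1 : Tendsto (fun t ↦ (t, w.2)) (𝓝 w.1) (𝓝 w) :=
    (Continuous.tendsto (by fun_prop) _ : Tendsto (fun t : ℝ ↦ (t, w.2)) (𝓝 w.1) (𝓝 (w.1, w.2)))
  refine ⟨a, (congrArg Prod.fst h0).symm, ha, ?_⟩
  filter_upwards [hw1.eventually hab, hw1.eventually hQP] with t h1 h2
  rw [h2, h1, h0]

/-- Two null parametrizations that agree on coordinate lines accumulating at a point agree near
that point. -/
theorem NullNear.eventuallyEq_of_frequently [T2Space X] (hP : g.NullNear P z)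
    (hQ : g.NullNear Q z) (h1 : ∃ᶠ v in 𝓝 z.2, ∀ᶠ u in 𝓝 z.1, P (u, v) = Q (u, v))
    (h2 : ∃ᶠ u in 𝓝 z.1, ∀ᶠ v in 𝓝 z.2, P (u, v) = Q (u, v)) : P =ᶠ[𝓝 z] Q := by
  have hl : Tendsto (fun v ↦ (z.1, v)) (𝓝 z.2) (𝓝 z) :=
    (Continuous.tendsto (by fun_prop) _ : Tendsto (fun t : ℝ ↦ (z.1, t)) (𝓝 z.2) (𝓝 (z.1, z.2)))
  have hr : Tendsto (fun u ↦ (u, z.2)) (𝓝 z.1) (𝓝 z) :=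
    (Continuous.tendsto (by fun_prop) _ : Tendsto (fun t : ℝ ↦ (t, z.2)) (𝓝 z.1) (𝓝 (z.1, z.2)))
  have hzz : P z = Q z := by
    by_contra hne
    obtain ⟨U, V, hU, hV, hPU, hQV, hUV⟩ := t2_separation hne
    obtain ⟨v, hv, hv1, hv2⟩ := (h1.and_eventually
      ((hl.eventually (hP.continuousAt.eventually (hU.mem_nhds hPU))).and
      (hl.eventually (hQ.continuousAt.eventually (hV.mem_nhds hQV))))).exists
    have := hv.self_of_nhds
    exact disjoint_left.1 hUV hv1 (this ▸ hv2)
  obtain ⟨Φ, hΦz, hΦ, hQP, hinj⟩ := hP.exists_transition hQ hzz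
  have hinj' : ∀ᶠ y in 𝓝 z, P y = Q y → Φ y = y := by
    have : Tendsto (fun y : ℝ × ℝ ↦ (y, y)) (𝓝 z) (𝓝 (z, z)) :=
      Continuous.tendsto (by fun_prop) z
    filter_upwards [this.eventually hinj] with y hy hPQ
    exact (hy hPQ).symm
  have hline : ∃ᶠ v in 𝓝 z.2, (∀ᶠ u in 𝓝 z.1, Φ (u, v) = (u, v)) ∧ NullMapAt Φ (z.1, v) := by
    refine (h1.and_eventually (hl.eventually (hinj'.eventually_nhds.and hΦ))).mono ?_
    rintro v ⟨e1, e2, e3⟩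
    have : Tendsto (fun u ↦ (u, v)) (𝓝 z.1) (𝓝 (z.1, v)) := Continuous.tendsto (by fun_prop) _
    refine ⟨?_, e3⟩
    filter_upwards [e1, this.eventually e2] with u e4 e5 using e5 e4
  have hpos := hΦ.self_of_nhds.fst_pos_of_frequently
    (hl.frequently (hline.mono (fun v hv ↦ ⟨hv.2, by
      rw [NullMapAt.fst_of_line (w := (z.1, v)) (h := fun t ↦ t) hv.2 hv.1]; simp⟩)))
  obtain ⟨a, b, ha, hb, hab⟩ := NullMapAt.exists_prod hΦ hpos
  -- The transition map is a product `(a, b)`. A fixed horizontal segment forces `a` to be the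
  -- identity, and a fixed vertical one does the same for `b`.
  have haid : ∀ᶠ u in 𝓝 z.1, a u = u := by
    have hab' := (nhds_prod_eq (x := z.1) (y := z.2) ▸ hab : ∀ᶠ y in 𝓝 z.1 ×ˢ 𝓝 z.2, _)
    obtain ⟨pa, hpa, pb, hpb, hpab⟩ := eventually_prod_iff.1 hab'
    obtain ⟨v, hv, hv'⟩ := (hline.and_eventually hpb).exists
    filter_upwards [hv.1, hpa] with u e1 e2
    have := hpab e2 hv'
    rw [e1] at this
    exact (congrArg Prod.fst this).symm
  have hbid : ∀ᶠ v in 𝓝 z.2, b v = v := by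
    have hab' := (nhds_prod_eq (x := z.1) (y := z.2) ▸ (hab.and hinj') :
      ∀ᶠ y in 𝓝 z.1 ×ˢ 𝓝 z.2, _)
    obtain ⟨pa, hpa, pb, hpb, hpab⟩ := eventually_prod_iff.1 hab'
    obtain ⟨u, hu, hu'⟩ := (h2.and_eventually hpa).exists
    filter_upwards [hu, hpb] with v e1 e2
    obtain ⟨e3, e4⟩ := hpab hu' e2
    rw [e4 e1] at e3
    exact (congrArg Prod.snd e3).symm
  filter_upwards [hQP, hab, continuousAt_fst.eventually haid, continuousAt_snd.eventually hbid]
    with y e1 e2 e3 e4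
  rw [e1, e2, e3, e4]

end LorentzianMetric

/-! ### The geodesic equation in null coordinates -/

/-- The Euler-Lagrange expression of the energy of a family `H` of bilinear forms along a curve. -/
noncomputable def eulerLagrange {E : Type*} [NormedAddCommGroup E] [NormedSpace ℝ E]
    (H : E → E →L[ℝ] E →L[ℝ] ℝ) (y : ℝ → E) (t : ℝ) (w : E) : ℝ :=
  H (y t) (deriv (deriv y) t) w + fderiv ℝ (fun z ↦ H z (deriv y t) w) (y t) (deriv y t)
    - (1 / 2) * fderiv ℝ (fun z ↦ H z (deriv y t) (deriv y t)) (y t) w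

theorem ContDiffAt.deriv_of_infty {E : Type*} [NormedAddCommGroup E] [NormedSpace ℝ E] {y : ℝ → E}
    {t : ℝ} (hy : ContDiffAt ℝ ∞ y t) : ContDiffAt ℝ ∞ (deriv y) t := by
  have h := (hy.fderiv_right (m := ∞) (by simp)).clm_apply (contDiffAt_const (c := (1 : ℝ)))
  simpa only [fderiv_apply_one_eq_deriv] using h

set_option synthInstance.maxHeartbeats 400000 in
theorem fderiv_bilinear_apply {E F : Type*} [NormedAddCommGroup E] [NormedSpace ℝ E]
    [NormedAddCommGroup F] [NormedSpace ℝ F] {G : E → F →L[ℝ] F →L[ℝ] ℝ} {a b : E → F} {z : E}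
    {G' : E →L[ℝ] F →L[ℝ] F →L[ℝ] ℝ} {a' b' : E →L[ℝ] F} (hG : HasFDerivAt G G' z)
    (ha : HasFDerivAt a a' z) (hb : HasFDerivAt b b' z) (c : E) :
    fderiv ℝ (fun w ↦ G w (a w) (b w)) z c
      = G' c (a z) (b z) + G z (a' c) (b z) + G z (a z) (b' c) := by
  rw [((hG.clm_apply ha).clm_apply hb).fderiv]
  simp only [add_apply, ContinuousLinearMap.comp_apply, ContinuousLinearMap.flip_apply]
  ring

set_option synthInstance.maxHeartbeats 400000 in
set_option maxHeartbeats 1000000 in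
/-- The Euler-Lagrange expression does not depend on the coordinates. -/
theorem eulerLagrange_comp {E F : Type*} [NormedAddCommGroup E] [NormedSpace ℝ E]
    [NormedAddCommGroup F] [NormedSpace ℝ F] {G : F → F →L[ℝ] F →L[ℝ] ℝ}
    {H : E → E →L[ℝ] E →L[ℝ] ℝ} {Φ : E → F} {y : ℝ → E} {u : ℝ → F} {t : ℝ}
    (hG : DifferentiableAt ℝ G (Φ (y t))) (hsymm : ∀ᶠ z in 𝓝 (Φ (y t)), ∀ a b, G z a b = G z b a)
    (hΦ : ∀ᶠ z in 𝓝 (y t), ContDiffAt ℝ ∞ Φ z) (hy : ∀ᶠ s in 𝓝 t, ContDiffAt ℝ ∞ y s)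
    (hu : ∀ᶠ s in 𝓝 t, u s = Φ (y s))
    (hH : ∀ᶠ z in 𝓝 (y t), ∀ a b, H z a b = G (Φ z) (fderiv ℝ Φ z a) (fderiv ℝ Φ z b)) (w : E) :
    eulerLagrange G u t (fderiv ℝ Φ (y t) w) = eulerLagrange H y t w := by
  have hΦ0 := hΦ.self_of_nhds
  have hy0 := hy.self_of_nhds
  have hu0 := hu.self_of_nhds
  have dy : HasDerivAt y (deriv y t) t := (hy0.differentiableAt (by simp)).hasDerivAt
  have hdy : ContDiffAt ℝ ∞ (deriv y) t := hy0.deriv_of_infty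
  have dy' : HasDerivAt (deriv y) (deriv (deriv y) t) t :=
    (hdy.differentiableAt (by simp)).hasDerivAt
  have dDΦ : HasFDerivAt (fderiv ℝ Φ) (fderiv ℝ (fderiv ℝ Φ) (y t)) (y t) :=
    ((hΦ0.fderiv_right (m := ∞) (by simp)).differentiableAt (by simp)).hasFDerivAt
  have dΦ : HasFDerivAt Φ (fderiv ℝ Φ (y t)) (y t) :=
    (hΦ0.differentiableAt (by simp)).hasFDerivAt
  have du : ∀ᶠ s in 𝓝 t, deriv u s = fderiv ℝ Φ (y s) (deriv y s) := by
    filter_upwards [hu.eventually_nhds, hy, hy0.continuousAt.eventually hΦ] with s h1 h2 h3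
    rw [EventuallyEq.deriv_eq h1]
    exact ((h3.differentiableAt (by simp)).hasFDerivAt.comp_hasDerivAt s
      (h2.differentiableAt (by simp)).hasDerivAt).deriv
  have ddu : deriv (deriv u) t = fderiv ℝ (fderiv ℝ Φ) (y t) (deriv y t) (deriv y t)
      + fderiv ℝ Φ (y t) (deriv (deriv y) t) := by
    rw [EventuallyEq.deriv_eq du]
    exact ((dDΦ.comp_hasDerivAt t dy).clm_apply dy').deriv
  have hsnd (a b : E) : fderiv ℝ (fderiv ℝ Φ) (y t) a b = fderiv ℝ (fderiv ℝ Φ) (y t) b a :=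
    (hΦ0.isSymmSndFDerivAt (by simp only [minSmoothness_of_isRCLikeNormedField]; exact WithTop.coe_le_coe.2 (le_top : (2 : ℕ∞) ≤ ⊤))) a b
  have dG : HasFDerivAt G (fderiv ℝ G (Φ (y t))) (Φ (y t)) := hG.hasFDerivAt
  have hGab (a b c : F) : fderiv ℝ (fun z ↦ G z a b) (Φ (y t)) c = fderiv ℝ G (Φ (y t)) c a b := by
    rw [fderiv_bilinear_apply dG (hasFDerivAt_const a _) (hasFDerivAt_const b _)]
    simp
  have hHab (a b c : E) : fderiv ℝ (fun z ↦ H z a b) (y t) c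
      = fderiv ℝ G (Φ (y t)) (fderiv ℝ Φ (y t) c) (fderiv ℝ Φ (y t) a) (fderiv ℝ Φ (y t) b)
      + G (Φ (y t)) (fderiv ℝ (fderiv ℝ Φ) (y t) c a) (fderiv ℝ Φ (y t) b)
      + G (Φ (y t)) (fderiv ℝ Φ (y t) a) (fderiv ℝ (fderiv ℝ Φ) (y t) c b) := by
    have e1 : (fun z ↦ H z a b) =ᶠ[𝓝 (y t)]
        fun z ↦ G (Φ z) (fderiv ℝ Φ z a) (fderiv ℝ Φ z b) := by
      filter_upwards [hH] with z hz using hz a b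
    have e2 (a : E) : HasFDerivAt (fun z ↦ fderiv ℝ Φ z a)
        ((fderiv ℝ (fderiv ℝ Φ) (y t)).flip a) (y t) := by
      simpa using dDΦ.clm_apply (hasFDerivAt_const a (y t))
    have e3 : HasFDerivAt (fun z ↦ G (Φ z)) ((fderiv ℝ G (Φ (y t))).comp (fderiv ℝ Φ (y t)))
        (y t) :=
      HasFDerivAt.comp (F := F) (G := F →L[ℝ] F →L[ℝ] ℝ) (y t) dG dΦ
    rw [EventuallyEq.fderiv_eq e1]
    exact fderiv_bilinear_apply e3 (e2 a) (e2 b) c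
  unfold eulerLagrange
  rw [hu0, du.self_of_nhds, ddu, hGab, hGab, hHab, hHab, hH.self_of_nhds]
  -- The Hessian of `Φ` contributes through `u''` on one side and through the derivatives of `H` on
  -- the other; these terms match by the symmetry of the Hessian and of `G`.
  have s1 := hsymm.self_of_nhds (fderiv ℝ (fderiv ℝ Φ) (y t) w (deriv y t))
    (fderiv ℝ Φ (y t) (deriv y t))
  rw [hsnd w (deriv y t)] at s1 ⊢
  simp only [map_add, add_apply]
  linarith

namespace LorentzianMetric

variable {X : Type*} [TopologicalSpace X] [ChartedSpace (EuclideanSpace ℝ (Fin 2)) X]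
  [IsManifold (𝓡 2) ∞ X] {g : LorentzianMetric X} {P Q : ℝ × ℝ → X} {z w : ℝ × ℝ}

theorem IsGeodesicOn.contMDiffAt {γ : ℝ → X} {J : Set ℝ} (hγ : g.IsGeodesicOn γ J)
    (hJ : IsOpen J) {t : ℝ} (ht : t ∈ J) : ContMDiffAt 𝓘(ℝ, ℝ) (𝓡 2) ∞ γ t :=
  (hγ.1 t ht).contMDiffAt (hJ.mem_nhds ht)

/-- The geodesic equation in arbitrary coordinates. -/
theorem IsGeodesicOn.eulerLagrange_eq_zero {γ : ℝ → X} {J : Set ℝ} (hγ : g.IsGeodesicOn γ J)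
    {t : ℝ} (ht : t ∈ J) {y : ℝ → ℝ × ℝ}
    (hP : ∀ᶠ z in 𝓝 (y t), ContMDiffAt 𝓘(ℝ, ℝ × ℝ) (𝓡 2) ∞ P z)
    (hy : ∀ᶠ s in 𝓝 t, ContDiffAt ℝ ∞ y s) (hPy : ∀ᶠ s in 𝓝 t, γ s = P (y s)) (w : ℝ × ℝ) :
    eulerLagrange (g.pull P) y t w = 0 := by
  have hx : γ t = P (y t) := hPy.self_of_nhds
  set κ := extChartAt (𝓡 2) (γ t) with hκ
  have hsrc0 : P (y t) ∈ κ.source := by rw [← hx]; exact mem_extChartAt_source _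
  have hsrc : ∀ᶠ z in 𝓝 (y t), P z ∈ κ.source :=
    hP.self_of_nhds.continuousAt.eventually ((isOpen_extChartAt_source _).mem_nhds hsrc0)
  have hΦ : ∀ᶠ z in 𝓝 (y t), ContDiffAt ℝ ∞ (κ ∘ P) z := by
    filter_upwards [hP, hsrc] with z h1 h2
    have : ContMDiffAt (𝓡 2) 𝓘(ℝ, EuclideanSpace ℝ (Fin 2)) ∞ κ (P z) :=
      contMDiffAt_extChartAt' (by rwa [← extChartAt_source (𝓡 2)])
    exact (this.comp z h1).contDiffAt
  have hκs (v) (hv : v ∈ κ.target) :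
      ContMDiffAt 𝓘(ℝ, EuclideanSpace ℝ (Fin 2)) (𝓡 2) ∞ κ.symm v :=
    (contMDiffOn_extChartAt_symm (γ t) v hv).contMDiffAt
      ((isOpen_extChartAt_target (γ t)).mem_nhds hv)
  have hκt : ∀ᶠ v in 𝓝 ((κ ∘ P) (y t)), v ∈ κ.target :=
    (isOpen_extChartAt_target (γ t)).mem_nhds (κ.map_source hsrc0)
  have hG : ContDiffAt ℝ ∞ (g.pull κ.symm) ((κ ∘ P) (y t)) :=
    g.contDiffAt_pull (hκt.mono hκs)
  rw [← eulerLagrange_comp (G := g.pull κ.symm) (Φ := κ ∘ P) (u := fun s ↦ κ (γ s))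
    (hG.differentiableAt (by simp)) (.of_forall fun z a b ↦ g.pull_symm _ z a b) hΦ hy
    (hPy.mono fun s hs ↦ by rw [hs]; rfl) ?_]
  · exact hγ.2 t ht _
  · filter_upwards [hP, hsrc, hsrc.eventually_nhds, hΦ] with z h1 h2 h3 h4 a b
    rw [← g.pull_comp (P := κ.symm) (Φ := κ ∘ P) ((hκs _ (κ.map_source h2)).mdifferentiableAt (by simp))
      (h4.differentiableAt (by simp))]
    refine congrArg (fun L ↦ L a b) (g.pull_congr ?_)
    filter_upwards [h3] with z' hz'
    exact (κ.left_inv hz').symm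

/-- The geodesic equation in null coordinates. -/
theorem IsGeodesicOn.null_equation {γ : ℝ → X} {J : Set ℝ} (hγ : g.IsGeodesicOn γ J)
    {t : ℝ} (ht : t ∈ J) {y : ℝ → ℝ × ℝ} (hP : g.NullNear P (y t))
    (hy : ∀ᶠ s in 𝓝 t, ContDiffAt ℝ ∞ y s) (hPy : ∀ᶠ s in 𝓝 t, γ s = P (y s)) :
    g.pull P (y t) (1, 0) (0, 1) * (deriv (deriv y) t).1
      + fderiv ℝ (fun z ↦ g.pull P z (1, 0) (0, 1)) (y t) (1, 0) * (deriv y t).1 ^ 2 = 0 := by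
  -- Testing against `(0, 1)` isolates the second derivative of the first coordinate; the
  -- contributions of the derivative of the metric coefficient in the second variable cancel.
  have h1 := hγ.eulerLagrange_eq_zero ht (hP.mono fun z hz ↦ hz.contMDiffAt) hy hPy (0, 1)
  have hd : DifferentiableAt ℝ (fun z ↦ g.pull P z (1, 0) (0, 1)) (y t) :=
    (g.contDiffAt_pull_apply hP.nullAt.contMDiffAt _ _).differentiableAt (by simp)
  have h2 (a b c : ℝ × ℝ) : fderiv ℝ (fun z ↦ g.pull P z a b) (y t) c
      = fderiv ℝ (fun z ↦ g.pull P z (1, 0) (0, 1)) (y t) c * (a.1 * b.2 + a.2 * b.1) := by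
    have : (fun z ↦ g.pull P z a b) =ᶠ[𝓝 (y t)]
        fun z ↦ g.pull P z (1, 0) (0, 1) * (a.1 * b.2 + a.2 * b.1) := by
      filter_upwards [hP] with z hz using hz.pull_eq a b
    rw [EventuallyEq.fderiv_eq this, fderiv_mul_const hd]
    simp [mul_comm]
  unfold eulerLagrange at h1
  rw [h2 (deriv y t) (0, 1) (deriv y t), h2 (deriv y t) (deriv y t) (0, 1), hP.nullAt.pull_eq] at h1
  have h3 : deriv y t = (deriv y t).1 • (1, 0) + (deriv y t).2 • (0, 1) := by ext <;> simp
  have h4 : fderiv ℝ (fun z ↦ g.pull P z (1, 0) (0, 1)) (y t) (deriv y t)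
      = (deriv y t).1 * fderiv ℝ (fun z ↦ g.pull P z (1, 0) (0, 1)) (y t) (1, 0)
      + (deriv y t).2 * fderiv ℝ (fun z ↦ g.pull P z (1, 0) (0, 1)) (y t) (0, 1) := by
    conv_lhs => rw [h3]
    simp only [map_add, map_smul, smul_eq_mul]
  rw [h4] at h1
  simp only [mul_one, mul_zero, add_zero] at h1
  linear_combination h1

end LorentzianMetric

/-! ### Uniqueness for scalar equations and a connectedness principle -/

theorem eventually_eq_zero_of_hasDerivAt_mul {x m : ℝ → ℝ} {t : ℝ} (hm : ContinuousAt m t)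
    (hx : ∀ᶠ s in 𝓝 t, HasDerivAt x (m s * x s) s) (h0 : x t = 0) : ∀ᶠ s in 𝓝 t, x s = 0 := by
  have hb : ∀ᶠ s in 𝓝 t, |m s| < |m t| + 1 :=
    hm.abs.eventually (gt_mem_nhds (lt_add_one _))
  refine ODE_solution_unique_of_eventually (v := fun s x ↦ m s * x) (s := fun _ ↦ univ)
    (K := ⟨|m t| + 1, by positivity⟩) ?_ (hx.mono fun s hs ↦ ⟨hs, mem_univ _⟩) (g := fun _ ↦ 0)
    (.of_forall fun s ↦ ⟨by simpa using hasDerivAt_const s (0 : ℝ), mem_univ _⟩) h0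
  filter_upwards [hb] with s hs
  refine (LipschitzWith.of_dist_le_mul fun a b ↦ ?_).lipschitzOnWith
  rw [Real.dist_eq, Real.dist_eq, ← mul_sub, abs_mul]
  exact mul_le_mul_of_nonneg_right hs.le (abs_nonneg _)

theorem eventuallyEq_of_hasDerivAt_autonomous {F x₁ x₂ : ℝ → ℝ} {t : ℝ}
    (hF : ContDiffAt ℝ 1 F (x₁ t)) (h₁ : ∀ᶠ s in 𝓝 t, HasDerivAt x₁ (F (x₁ s)) s)
    (h₂ : ∀ᶠ s in 𝓝 t, HasDerivAt x₂ (F (x₂ s)) s) (h : x₁ t = x₂ t) : x₁ =ᶠ[𝓝 t] x₂ := by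
  obtain ⟨K, U, hU, hK⟩ := hF.exists_lipschitzOnWith
  refine ODE_solution_unique_of_eventually (v := fun _ ↦ F) (s := fun _ ↦ U) (.of_forall fun _ ↦ hK)
    ?_ ?_ h
  · filter_upwards [h₁, h₁.self_of_nhds.continuousAt.eventually hU] with s h3 h4 using ⟨h3, h4⟩
  · rw [h] at hU
    filter_upwards [h₂, h₂.self_of_nhds.continuousAt.eventually hU] with s h3 h4 using ⟨h3, h4⟩

/-- A property that is locally closed and locally open holds on a connected set as soon as it holds
at one of its points. -/
theorem IsPreconnected.forall_of_frequently {A : Type*} [TopologicalSpace A] {S : Set A}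
    (hS : IsPreconnected S) {Q : A → Prop} {x₀ : A} (hx₀ : x₀ ∈ S) (h₀ : Q x₀)
    (h : ∀ x ∈ S, (∃ᶠ y in 𝓝 x, Q y) → ∀ᶠ y in 𝓝 x, Q y) : ∀ x ∈ S, Q x := by
  have h1 : x₀ ∈ {x | ∀ᶠ y in 𝓝 x, Q y} :=
    h x₀ hx₀ (mem_closure_iff_frequently.1 (subset_closure h₀))
  have h2 : S ⊆ {x | ∀ᶠ y in 𝓝 x, Q y} := by
    refine hS.subset_left_of_subset_union (v := {x | ∀ᶠ y in 𝓝 x, ¬ Q y}) ?_ ?_ ?_ ?_ ⟨x₀, hx₀, h1⟩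
    · exact isOpen_setOfPred_eventually_nhds
    · exact isOpen_setOfPred_eventually_nhds
    · refine Set.disjoint_left.2 fun x hx hx' ↦ ?_
      exact hx'.self_of_nhds hx.self_of_nhds
    · intro x hx
      by_cases hf : ∃ᶠ y in 𝓝 x, Q y
      · exact .inl (h x hx hf)
      · exact .inr (not_frequently.1 hf)
  exact fun x hx ↦ (h2 hx).self_of_nhds

/-! ### Null curves and lightlike geodesics -/

namespace LorentzianMetric

variable {X : Type*} [TopologicalSpace X] [ChartedSpace (EuclideanSpace ℝ (Fin 2)) X]
  [IsManifold (𝓡 2) ∞ X] {g : LorentzianMetric X} {P Q : ℝ × ℝ → X} {z w : ℝ × ℝ}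

/-- Near `t`, the curve `c` is a horizontal line in null coordinates. -/
def NullCurveAt (g : LorentzianMetric X) (c : ℝ → X) (t : ℝ) : Prop :=
  ∃ P, g.NullNear P (t, 0) ∧ ∀ᶠ s in 𝓝 t, P (s, 0) = c s

/-- The scale `σ` has the sign of the derivative of `k`: a line traversed backwards is also a null
curve, because reversing both coordinates keeps `du dv`. -/
theorem NullNear.comp_prodMk (h : g.NullNear P (z.1, z.2)) {k : ℝ → ℝ} {t σ : ℝ} (hz : k t = z.1)
    (hk : ∀ᶠ s in 𝓝 t, ContDiffAt ℝ ∞ k s) (hσ : 0 < deriv k t * σ) :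
    g.NullNear (fun y ↦ P (k y.1, z.2 + σ * y.2)) (t, 0) := by
  have hpos : ∀ᶠ s in 𝓝 t, 0 < deriv k s * σ :=
    (hk.self_of_nhds.deriv_of_infty.continuousAt.mul continuousAt_const).eventually (lt_mem_nhds hσ)
  have hc : ContinuousAt (fun y : ℝ × ℝ ↦ (k y.1, z.2 + σ * y.2)) (t, 0) := by
    refine ContinuousAt.prodMk ?_ (by fun_prop)
    exact ContinuousAt.comp (f := Prod.fst) (x := (t, (0 : ℝ))) hk.self_of_nhds.continuousAt
      continuousAt_fst
  have h' : g.NullNear P (k (t, (0 : ℝ)).1, z.2 + σ * (t, (0 : ℝ)).2) := by simpa [hz] using h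
  have hfst : Tendsto Prod.fst (𝓝 (t, (0 : ℝ))) (𝓝 t) := continuousAt_fst
  filter_upwards [hc.eventually h', hfst.eventually hk, hfst.eventually hpos] with y h1 h2 h3
  have hd : HasDerivAt (fun v ↦ z.2 + σ * v) σ y.2 := by
    simpa using ((hasDerivAt_id y.2).const_mul σ).const_add z.2
  refine NullAt.comp_prod (b := fun v ↦ z.2 + σ * v) h1 h2 (by fun_prop) ?_
  rwa [hd.deriv]

namespace NullCurveAt

variable {c c' : ℝ → X} {t : ℝ}

theorem eventually (h : g.NullCurveAt c t) : ∀ᶠ s in 𝓝 t, g.NullCurveAt c s := by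
  obtain ⟨P, hP, h⟩ := h
  have hc : ContinuousAt (fun s : ℝ ↦ (s, (0 : ℝ))) t := by fun_prop
  filter_upwards [hc.eventually hP.eventually, h.eventually_nhds] with s h1 h2 using ⟨P, h1, h2⟩

theorem congr (h : g.NullCurveAt c t) (hc : c' =ᶠ[𝓝 t] c) : g.NullCurveAt c' t := by
  obtain ⟨P, hP, h⟩ := h
  exact ⟨P, hP, by filter_upwards [h, hc] with s h1 h2 using h1.trans h2.symm⟩

theorem comp {k : ℝ → ℝ} (h : g.NullCurveAt c (k t)) (hk : SmoothIncrNear k t) :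
    g.NullCurveAt (fun s ↦ c (k s)) t := by
  obtain ⟨P, hP, h⟩ := h
  exact ⟨fun y ↦ P (k y.1, y.2), NullNear.comp_prod (w := (t, 0)) hP hk (.id _),
    hk.continuousAt.eventually h⟩

theorem of_nullNear (h : g.NullNear P z) : g.NullCurveAt (fun u ↦ P (u, z.2)) z.1 := by
  refine ⟨fun y ↦ P (y.1, y.2 + z.2), ?_, by simp⟩
  exact NullNear.comp_prod (w := (z.1, 0)) (a := fun s ↦ s) (b := fun s ↦ s + z.2)
    (by simpa using h) (.id _) (.add_const _ _)

end NullCurveAt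

/-- Near `t`, the curve `γ` is given by the smooth curve `y` in the null coordinates `P`. -/
structure CoordNear (g : LorentzianMetric X) (P : ℝ × ℝ → X) (γ : ℝ → X) (y : ℝ → ℝ × ℝ)
    (t : ℝ) : Prop where
  nullNear : g.NullNear P (y t)
  contDiffAt : ∀ᶠ s in 𝓝 t, ContDiffAt ℝ ∞ y s
  eq : ∀ᶠ s in 𝓝 t, γ s = P (y s)

namespace CoordNear

variable {γ : ℝ → X} {y : ℝ → ℝ × ℝ} {t : ℝ}

theorem continuousAt (h : g.CoordNear P γ y t) : ContinuousAt y t :=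
  h.contDiffAt.self_of_nhds.continuousAt

theorem hasDerivAt (h : g.CoordNear P γ y t) : HasDerivAt y (deriv y t) t :=
  (h.contDiffAt.self_of_nhds.differentiableAt (by simp)).hasDerivAt

theorem continuousAt_deriv (h : g.CoordNear P γ y t) : ContinuousAt (deriv y) t :=
  h.contDiffAt.self_of_nhds.deriv_of_infty.continuousAt

theorem hasDerivAt_deriv (h : g.CoordNear P γ y t) : HasDerivAt (deriv y) (deriv (deriv y) t) t :=
  (h.contDiffAt.self_of_nhds.deriv_of_infty.differentiableAt (by simp)).hasDerivAt

theorem eventually (h : g.CoordNear P γ y t) : ∀ᶠ s in 𝓝 t, g.CoordNear P γ y s := by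
  filter_upwards [h.continuousAt.eventually h.nullNear.eventually, h.contDiffAt.eventually_nhds,
    h.eq.eventually_nhds] with s h1 h2 h3 using ⟨h1, h2, h3⟩

theorem swap (h : g.CoordNear P γ y t) :
    g.CoordNear (P ∘ Prod.swap) γ (fun s ↦ (y s).swap) t where
  nullNear := NullNear.swap (by simpa using h.nullNear)
  contDiffAt := h.contDiffAt.mono fun s hs ↦ (contDiff_snd.prodMk contDiff_fst).contDiffAt.comp s hs
  eq := by simpa using h.eq

theorem deriv_swap (h : g.CoordNear P γ y t) : deriv (fun s ↦ (y s).swap) t = (deriv y t).swap :=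
  (h.hasDerivAt.snd_comp.prodMk h.hasDerivAt.fst_comp).deriv

theorem mfderiv_eq (h : g.CoordNear P γ y t) :
    mfderiv 𝓘(ℝ, ℝ) (𝓡 2) γ t (1 : ℝ) = mfderiv 𝓘(ℝ, ℝ × ℝ) (𝓡 2) P (y t) (deriv y t) := by
  have h1 : γ =ᶠ[𝓝 t] P ∘ y := h.eq
  have h2 : MDifferentiableAt 𝓘(ℝ, ℝ) 𝓘(ℝ, ℝ × ℝ) y t := h.hasDerivAt.differentiableAt.mdifferentiableAt
  rw [h1.mfderiv_eq, mfderiv_comp t h.nullNear.nullAt.mdifferentiableAt h2, mfderiv_eq_fderiv]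
  exact congrArg (fun a : ℝ × ℝ ↦ (mfderiv 𝓘(ℝ, ℝ × ℝ) (𝓡 2) P (y t) a : EuclideanSpace ℝ (Fin 2)))
    (fderiv_apply_one_eq_deriv (f := y) (x := t))

theorem deriv_eq (h : g.CoordNear P γ y t) {a : ℝ × ℝ} (hz : y t = z)
    (hv : velocity γ t = ⟨P z, mfderiv 𝓘(ℝ, ℝ × ℝ) (𝓡 2) P z a⟩) : deriv y t = a := by
  subst hz
  have h1 : mfderiv 𝓘(ℝ, ℝ) (𝓡 2) γ t (1 : ℝ) = mfderiv 𝓘(ℝ, ℝ × ℝ) (𝓡 2) P (y t) a :=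
    congrArg (fun p : TangentBundle (𝓡 2) X ↦ (p.2 : EuclideanSpace ℝ (Fin 2))) hv
  rw [h.mfderiv_eq] at h1
  have hn := h.nullNear.nullAt
  have h2 (b : ℝ × ℝ) : g.pull P (y t) (deriv y t) b = g.pull P (y t) a b :=
    congrArg (fun v : TangentSpace (𝓡 2) (P (y t)) ↦
      g.inner (P (y t)) v (mfderiv 𝓘(ℝ, ℝ × ℝ) (𝓡 2) P (y t) b)) h1
  have h3 := h2 (1, 0)
  have h4 := h2 (0, 1)
  rw [hn.pull_eq, hn.pull_eq a] at h3 h4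
  have h5 := mul_left_cancel₀ hn.pull_pos.ne' h3
  have h6 := mul_left_cancel₀ hn.pull_pos.ne' h4
  simp only [mul_one, mul_zero, zero_add, add_zero] at h5 h6
  exact Prod.ext h6 h5

theorem nullCurveAt_of_snd (h : g.CoordNear P γ y t) (h1 : (deriv y t).1 ≠ 0)
    (h2 : ∀ᶠ s in 𝓝 t, (y s).2 = (y t).2) : g.NullCurveAt γ t := by
  refine ⟨_, NullNear.comp_prodMk (z := y t) h.nullNear (k := fun s ↦ (y s).1)
    (σ := (deriv y t).1) rfl (h.contDiffAt.mono fun s hs ↦ hs.fst) ?_, ?_⟩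
  · rw [h.hasDerivAt.fst_comp.deriv]
    exact mul_self_pos.2 h1
  · filter_upwards [h2, h.eq] with s h3 h4
    simp only [mul_zero, add_zero]
    rw [h4, ← h3]

/-- A null curve moves in one coordinate direction. -/
theorem deriv_of_nullCurveAt (h : g.CoordNear P γ y t) (hγ : g.NullCurveAt γ t) :
    (deriv y t).1 * (deriv y t).2 = 0 ∧ deriv y t ≠ 0 := by
  obtain ⟨K, hK, hKγ⟩ := hγ
  have h0 : P (y t) = K (t, 0) := by rw [hKγ.self_of_nhds, h.eq.self_of_nhds]
  obtain ⟨Φ, hΦ, h1, -, h2⟩ := h.nullNear.exists_transition hK h0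
  have hc : Tendsto (fun s ↦ (y s, (s, (0 : ℝ)))) (𝓝 t) (𝓝 (y t, (t, 0))) :=
    h.continuousAt.prodMk (by fun_prop)
  have h3 : y =ᶠ[𝓝 t] fun s ↦ Φ (s, 0) := by
    filter_upwards [hc.eventually h2, hKγ, h.eq] with s h4 h5 h6
    exact h4 (h6.symm.trans h5.symm)
  have hn := h1.self_of_nhds
  have h4 : deriv y t = fderiv ℝ Φ (t, 0) (1, 0) := by
    rw [EventuallyEq.deriv_eq h3]
    exact (hn.hasFDerivAt.comp_hasDerivAt t ((hasDerivAt_id t).prodMk (hasDerivAt_const t 0))).deriv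
  rw [h4]
  refine ⟨hn.left, fun h5 ↦ ?_⟩
  have := hn.pos
  simp [h5] at this

end CoordNear

namespace IsGeodesicOn

variable {γ : ℝ → X} {J : Set ℝ} {y : ℝ → ℝ × ℝ} {t : ℝ}

theorem exists_coordNear (hγ : g.IsGeodesicOn γ J) (hJ : IsOpen J) (ht : t ∈ J)
    (hP : g.NullNear P z) (hz : P z = γ t) : ∃ y, y t = z ∧ g.CoordNear P γ y t := by
  obtain ⟨e, he, h1, h2⟩ := hP.exists_openPartialHomeomorph
  have hez : e z = γ t := (h1 z he).1.trans hz
  have htgt : γ t ∈ e.target := by rw [← hez]; exact e.map_source he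
  have hyt : e.symm (γ t) = z := by rw [← hez]; exact e.left_inv he
  have hev : ∀ᶠ s in 𝓝 t, γ s ∈ e.target :=
    (hγ.contMDiffAt hJ ht).continuousAt.eventually (e.open_target.mem_nhds htgt)
  refine ⟨e.symm ∘ γ, hyt, by simpa [hyt] using hP, ?_, ?_⟩
  · filter_upwards [hev, hJ.mem_nhds ht] with s h3 h4
    exact ((h2 _ h3).comp s (hγ.contMDiffAt hJ h4)).contDiffAt
  · filter_upwards [hev] with s h3
    rw [Function.comp_apply, ← (h1 _ (e.map_target h3)).1, e.right_inv h3]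

/-- Along the given curve, `H u'' + H_u u'² = 0` reads as a homogeneous linear equation for `u'`
with continuous coefficient, so a zero of `u'` spreads to a neighbourhood. -/
theorem eventually_fst_eq_zero (hγ : g.IsGeodesicOn γ J) (hJ : IsOpen J) (ht : t ∈ J)
    (h : g.CoordNear P γ y t) (h0 : (deriv y t).1 = 0) : ∀ᶠ s in 𝓝 t, (deriv y s).1 = 0 := by
  set H := fun z ↦ g.pull P z (1, 0) (0, 1) with hH
  have hHs : ContDiffAt ℝ ∞ H (y t) := g.contDiffAt_pull_apply h.nullNear.nullAt.contMDiffAt _ _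
  have hm : ContinuousAt (fun s ↦ -(fderiv ℝ H (y s) (1, 0) * (deriv y s).1 / H (y s))) t := by
    have h1 : ContinuousAt (fun z ↦ fderiv ℝ H z (1, 0)) (y t) :=
      ((hHs.fderiv_right (m := 0) (by simp)).continuousAt).clm_apply continuousAt_const
    have h2 : ContinuousAt (fun s ↦ fderiv ℝ H (y s) (1, 0)) t :=
      ContinuousAt.comp (f := y) (g := fun z ↦ fderiv ℝ H z (1, 0)) h1 h.continuousAt
    have h3 : ContinuousAt (fun s ↦ H (y s)) t :=
      ContinuousAt.comp (f := y) (g := H) hHs.continuousAt h.continuousAt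
    exact ((h2.mul h.continuousAt_deriv.fst).div h3 h.nullNear.nullAt.pull_pos.ne').neg
  refine eventually_eq_zero_of_hasDerivAt_mul hm ?_ h0
  filter_upwards [h.eventually, hJ.mem_nhds ht] with s h1 h2
  refine h1.hasDerivAt_deriv.fst_comp.congr_deriv ?_
  have h3 := hγ.null_equation h2 h1.nullNear h1.contDiffAt h1.eq
  have h4 : H (y s) ≠ 0 := h1.nullNear.nullAt.pull_pos.ne'
  change H (y s) * (deriv (deriv y) s).1 + fderiv ℝ H (y s) (1, 0) * (deriv y s).1 ^ 2 = 0 at h3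
  field_simp
  linarith

theorem eventually_snd_eq_zero (hγ : g.IsGeodesicOn γ J) (hJ : IsOpen J) (ht : t ∈ J)
    (h : g.CoordNear P γ y t) (h0 : (deriv y t).2 = 0) : ∀ᶠ s in 𝓝 t, (deriv y s).2 = 0 := by
  have h1 := hγ.eventually_fst_eq_zero hJ ht h.swap (by rw [h.deriv_swap]; exact h0)
  filter_upwards [h1, h.eventually] with s h2 h3
  rw [h3.deriv_swap] at h2
  exact h2

theorem eventually_snd_eq (hγ : g.IsGeodesicOn γ J) (hJ : IsOpen J) (ht : t ∈ J)
    (h : g.CoordNear P γ y t) (h0 : (deriv y t).2 = 0) : ∀ᶠ s in 𝓝 t, (y s).2 = (y t).2 := by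
  refine eventuallyEq_of_hasDerivAt_autonomous (F := fun _ ↦ 0) contDiffAt_const ?_
    (.of_forall fun s ↦ hasDerivAt_const s _) (x₂ := fun _ ↦ (y t).2) rfl
  filter_upwards [hγ.eventually_snd_eq_zero hJ ht h h0, h.eventually] with s h1 h2
  exact h2.hasDerivAt.snd_comp.congr_deriv h1

theorem nullCurveAt (hγ : g.IsGeodesicOn γ J) (hJ : IsOpen J) (ht : t ∈ J)
    (h : g.CoordNear P γ y t) (h1 : (deriv y t).1 * (deriv y t).2 = 0) (h2 : deriv y t ≠ 0) :
    g.NullCurveAt γ t := by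
  rcases mul_eq_zero.1 h1 with h3 | h3
  · refine h.swap.nullCurveAt_of_snd ?_ ?_
    · rw [h.deriv_swap]
      exact fun h4 ↦ h2 (Prod.ext h3 h4)
    · exact hγ.eventually_snd_eq hJ ht h.swap (by rw [h.deriv_swap]; exact h3)
  · exact h.nullCurveAt_of_snd (fun h4 ↦ h2 (Prod.ext h4 h3)) (hγ.eventually_snd_eq hJ ht h h3)

/-- The condition `u'v' = 0` passes to limits by continuity. The velocity cannot vanish in the
limit, since both of its components would then vanish nearby. -/
theorem nullCurveAt_of_frequently (hγ : g.IsGeodesicOn γ J) (hJ : IsOpen J) (ht : t ∈ J)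
    (hf : ∃ᶠ s in 𝓝 t, g.NullCurveAt γ s) : g.NullCurveAt γ t := by
  obtain ⟨P, hP0, hP⟩ := g.exists_nullNear (γ t)
  obtain ⟨y, hy, h⟩ := hγ.exists_coordNear hJ ht hP hP0
  have h1 : ∃ᶠ s in 𝓝 t, (deriv y s).1 * (deriv y s).2 = 0 ∧ deriv y s ≠ 0 :=
    (hf.and_eventually h.eventually).mono fun s hs ↦ hs.2.deriv_of_nullCurveAt hs.1
  refine hγ.nullCurveAt hJ ht h ?_ fun h0 ↦ ?_
  · by_contra hne
    have h2 := (h.continuousAt_deriv.fst.mul h.continuousAt_deriv.snd).eventually_ne hne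
    obtain ⟨s, h3, h4⟩ := (h1.and_eventually h2).exists
    exact h4 h3.1
  · obtain ⟨s, h3, h4, h5⟩ := (h1.and_eventually ((hγ.eventually_fst_eq_zero hJ ht h (by simp [h0])).and
      (hγ.eventually_snd_eq_zero hJ ht h (by simp [h0])))).exists
    exact h3.2 (Prod.ext h4 h5)

/-- An affinely parametrized null geodesic has constant momentum. -/
theorem hasDerivAt_fst (hγ : g.IsGeodesicOn γ J) (hJ : IsOpen J) (ht : t ∈ J)
    (h : g.CoordNear P γ y t) (h0 : (deriv y t).2 = 0) : ∀ᶠ s in 𝓝 t, HasDerivAt (fun s ↦ (y s).1)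
      (g.pull P (y t) (1, 0) (0, 1) * (deriv y t).1 /
        g.pull P ((y s).1, (y t).2) (1, 0) (0, 1)) s := by
  set H := fun z ↦ g.pull P z (1, 0) (0, 1) with hH
  have h1 : ∀ᶠ s in 𝓝 t, H (y s) * (deriv y s).1 = H (y t) * (deriv y t).1 := by
    refine eventuallyEq_of_hasDerivAt_autonomous (F := fun _ ↦ 0) contDiffAt_const ?_
      (.of_forall fun s ↦ hasDerivAt_const s _) (x₂ := fun _ ↦ H (y t) * (deriv y t).1) rfl
    filter_upwards [hγ.eventually_snd_eq_zero hJ ht h h0, h.eventually, hJ.mem_nhds ht]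
      with s h2 h3 h4
    have hHs : HasFDerivAt H (fderiv ℝ H (y s)) (y s) :=
      ((g.contDiffAt_pull_apply h3.nullNear.nullAt.contMDiffAt _ _).differentiableAt
        (by simp)).hasFDerivAt
    refine ((hHs.comp_hasDerivAt s h3.hasDerivAt).mul h3.hasDerivAt_deriv.fst_comp).congr_deriv ?_
    have h5 : deriv y s = (deriv y s).1 • (1, 0) := by ext <;> simp [h2]
    have h6 := hγ.null_equation h4 h3.nullNear h3.contDiffAt h3.eq
    have h7 : fderiv ℝ H (y s) (deriv y s) = (deriv y s).1 * fderiv ℝ H (y s) (1, 0) := by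
      conv_lhs => rw [h5]
      rw [map_smul, smul_eq_mul]
    rw [h7]
    simp only [Function.comp_apply]
    linear_combination h6
  filter_upwards [h1, h.eventually, hγ.eventually_snd_eq hJ ht h h0] with s h2 h3 h4
  refine h3.hasDerivAt.fst_comp.congr_deriv ?_
  rw [eq_div_iff, ← h4]
  · linear_combination h2
  · rw [← h4]
    exact h3.nullNear.nullAt.pull_pos.ne'

end IsGeodesicOn

end LorentzianMetric

/-! ### From closed geodesics to periodic null curves -/

/-- A map that repeats itself near `0` and `1` gives a periodic map that agrees locally with a
translate of it. -/
theorem eventually_fract_eq {A : Type*} {F : ℝ → A} (hF : ∀ᶠ s in 𝓝 0, F (1 + s) = F s) (u : ℝ) :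
    ∀ᶠ s in 𝓝 u, F (Int.fract s) = F (s - ⌊u⌋) := by
  have hlt : ∀ᶠ s : ℝ in 𝓝 u, s < ⌊u⌋ + 1 := gt_mem_nhds (Int.lt_floor_add_one u)
  rcases (Int.floor_le u).lt_or_eq with h | h
  · filter_upwards [hlt, lt_mem_nhds h] with s h1 h2
    rw [Int.fract, Int.floor_eq_iff.2 ⟨h2.le, h1⟩]
  · have hc : Tendsto (fun s : ℝ ↦ s - ⌊u⌋) (𝓝 u) (𝓝 0) := by
      have : ContinuousAt (fun s ↦ s - (⌊u⌋ : ℝ)) u := by fun_prop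
      rwa [ContinuousAt, sub_eq_zero.2 h.symm] at this
    have hgt : ∀ᶠ s : ℝ in 𝓝 u, (⌊u⌋ : ℝ) - 1 < s := lt_mem_nhds (by linarith)
    filter_upwards [hlt, hgt, hc.eventually hF] with s h1 h2 h3
    rcases le_or_gt (⌊u⌋ : ℝ) s with h4 | h4
    · rw [Int.fract, Int.floor_eq_iff.2 ⟨h4, h1⟩]
    · have h5 : ⌊s⌋ = ⌊u⌋ - 1 := Int.floor_eq_iff.2 ⟨by push_cast; linarith, by push_cast; linarith⟩
      rw [← h3, Int.fract, h5]
      congr 1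
      push_cast
      ring

/-- A change of time that turns the scaling by `μ` after time `T` into a translation. -/
theorem exists_time_change {T μ : ℝ} (hT : 0 < T) (hμ : 0 < μ) :
    ∃ τ : ℝ → ℝ, τ 0 = 0 ∧ τ 1 = T ∧ (∀ s, τ (1 + s) = T + μ * τ s) ∧ ∀ s, SmoothIncrNear τ s := by
  by_cases h1 : μ = 1
  · refine ⟨fun s ↦ T * s, by simp, by simp, fun s ↦ by rw [h1]; ring, fun s ↦ .of_forall fun x ↦ ?_⟩
    have : HasDerivAt (fun s ↦ T * s) T x := by simpa using (hasDerivAt_id x).const_mul T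
    exact ⟨by fun_prop, by rwa [this.deriv]⟩
  have hne : 1 - μ ≠ 0 := sub_ne_zero.2 (Ne.symm h1)
  have hpos : 0 < -Real.log μ / (1 - μ) := by
    rcases lt_or_gt_of_ne h1 with h | h
    · exact div_pos (neg_pos.2 (Real.log_neg hμ h)) (by linarith)
    · exact div_pos_of_neg_of_neg (neg_neg_of_pos (Real.log_pos h)) (by linarith)
  -- This is `T (1 - μ ^ s) / (1 - μ)`, which conjugates the affine map `t ↦ T + μ t` to the unit
  -- translation.
  refine ⟨fun s ↦ T * (1 - Real.exp (s * Real.log μ)) / (1 - μ), by simp, ?_, fun s ↦ ?_,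
    fun s ↦ .of_forall fun x ↦ ⟨by fun_prop, ?_⟩⟩
  · simp only [one_mul, Real.exp_log hμ]
    field_simp
  · simp only [add_mul, one_mul, Real.exp_add, Real.exp_log hμ]
    field_simp
    ring
  · have h2 : HasDerivAt (fun s ↦ T * (1 - Real.exp (s * Real.log μ)) / (1 - μ))
        (T * (-(Real.exp (x * Real.log μ) * (1 * Real.log μ))) / (1 - μ)) x :=
      ((((hasDerivAt_id x).mul_const (Real.log μ)).exp.const_sub 1).const_mul T).div_const _
    rw [h2.deriv]
    have h3 := mul_pos (mul_pos hT (Real.exp_pos (x * Real.log μ))) hpos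
    rwa [show T * (-(Real.exp (x * Real.log μ) * (1 * Real.log μ))) / (1 - μ)
      = T * Real.exp (x * Real.log μ) * (-Real.log μ / (1 - μ)) by ring]

namespace LorentzianMetric

variable {X : Type*} [TopologicalSpace X] [ChartedSpace (EuclideanSpace ℝ (Fin 2)) X]
  [IsManifold (𝓡 2) ∞ X] {g : LorentzianMetric X} {P Q : ℝ × ℝ → X} {z w : ℝ × ℝ}

/-- The curve `c` is a null curve of period `1`. -/
structure IsClosedNullCurve (g : LorentzianMetric X) (c : ℝ → X) : Prop where
  add_one : ∀ t, c (t + 1) = c t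
  nullCurveAt : ∀ t, g.NullCurveAt c t

/-- The first null coordinate line through a point lies on a closed null curve. -/
theorem AllLightlikeGeodesicsClosed.exists_isClosedNullCurve (hg : g.AllLightlikeGeodesicsClosed)
    (hP : g.NullNear P z) :
    ∃ c, g.IsClosedNullCurve c ∧ Reparam (fun u ↦ P (u, z.2)) z.1 c 0 := by
  set A : ℝ × ℝ →L[ℝ] TangentSpace (𝓡 2) (P z) := mfderiv 𝓘(ℝ, ℝ × ℝ) (𝓡 2) P z with hA
  have hv0 : A (1, 0) ≠ 0 := by
    intro h
    have : g.pull P z (1, 0) (0, 1) = 0 := by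
      change g.inner (P z) (A (1, 0)) (A (0, 1)) = 0
      rw [h]
      simp
    exact hP.nullAt.pull_pos.ne' this
  obtain ⟨γ, J, T, c, hJ, hT, hTJ, hγ, hγ0, hc, hγT⟩ := hg (P z) (A (1, 0)) hv0 hP.nullAt.pull_left
  have h0J : (0 : ℝ) ∈ J := hTJ ⟨le_rfl, hT.le⟩
  have hTJ' : T ∈ J := hTJ ⟨hT.le, le_rfl⟩
  have hP0 : P z = γ 0 := (congrArg (fun p : TangentBundle (𝓡 2) X ↦ p.1) hγ0).symm
  have hPT : P z = γ T := (congrArg (fun p : TangentBundle (𝓡 2) X ↦ p.1) hγT).symm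
  obtain ⟨y, hy0, hy⟩ := hγ.exists_coordNear hJ h0J hP hP0
  obtain ⟨x, hxT, hx⟩ := hγ.exists_coordNear hJ hTJ' hP hPT
  have dy : deriv y 0 = (1, 0) := hy.deriv_eq hy0 hγ0
  have dx : deriv x T = (c, 0) := by
    refine hx.deriv_eq hxT (hγT.trans ?_)
    have : c • A (1, 0) = A (c, 0) := by rw [← map_smul]; simp
    rw [this]
    rfl
  have hnull : ∀ t ∈ Icc 0 T, g.NullCurveAt γ t :=
    isPreconnected_Icc.forall_of_frequently ⟨le_rfl, hT.le⟩
      (hγ.nullCurveAt hJ h0J hy (by simp [dy]) (by simp [dy]))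
      fun t ht hf ↦ (hγ.nullCurveAt_of_frequently hJ (hTJ ht) hf).eventually
  -- The velocity at `T` is `c` times the one at `0`. By conservation of `H u'`, the first
  -- coordinates of both sides solve the same autonomous first-order equation with the same initial
  -- value.
  have hret : ∀ᶠ s in 𝓝 0, γ (T + s) = γ (c * s) := by
    have e1 := hγ.hasDerivAt_fst hJ h0J hy (by simp [dy])
    have e2 := hγ.hasDerivAt_fst hJ hTJ' hx (by simp [dx])
    have e3 := hγ.eventually_snd_eq hJ h0J hy (by simp [dy])
    have e4 := hγ.eventually_snd_eq hJ hTJ' hx (by simp [dx])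
    rw [hy0] at e1 e3
    rw [hxT] at e2 e4
    simp only [dy, dx, mul_one] at e1 e2
    have t1 : Tendsto (fun s ↦ c * s) (𝓝 0) (𝓝 0) := by
      have : ContinuousAt (fun s ↦ c * s) 0 := by fun_prop
      simpa [ContinuousAt] using this
    have t2 : Tendsto (fun s ↦ T + s) (𝓝 0) (𝓝 T) := by
      have : ContinuousAt (fun s ↦ T + s) 0 := by fun_prop
      simpa [ContinuousAt] using this
    have hF : ContDiffAt ℝ 1 (fun r ↦ g.pull P z (1, 0) (0, 1) * c /
        g.pull P (r, z.2) (1, 0) (0, 1)) (x (T + 0)).1 := by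
      rw [add_zero, hxT]
      have h1 : ContDiffAt ℝ ∞ (fun r : ℝ ↦ g.pull P (r, z.2) (1, 0) (0, 1)) z.1 :=
        ContDiffAt.comp (f := fun r : ℝ ↦ (r, z.2)) (g := fun w ↦ g.pull P w (1, 0) (0, 1)) z.1
          (g.contDiffAt_pull_apply hP.nullAt.contMDiffAt _ _) (by fun_prop)
      exact (contDiffAt_const.div h1 hP.nullAt.pull_pos.ne').of_le (by exact_mod_cast le_top)
    have e5 : (fun s ↦ (x (T + s)).1) =ᶠ[𝓝 0] fun s ↦ (y (c * s)).1 := by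
      refine eventuallyEq_of_hasDerivAt_autonomous hF ?_ ?_ (by simp [hxT, hy0])
      · filter_upwards [t2.eventually e2] with s hs
        exact hs.comp_const_add T s
      · filter_upwards [t1.eventually e1] with s hs
        have h2 : HasDerivAt (fun s ↦ c * s) c s := by simpa using (hasDerivAt_id s).const_mul c
        exact (hs.comp s h2).congr_deriv (by ring)
    filter_upwards [e5, t1.eventually e3, t2.eventually e4, t1.eventually hy.eq,
      t2.eventually hx.eq] with s h1 h2 h3 h4 h5
    rw [h5, h4]
    exact congrArg P (Prod.ext h1 (h3.trans h2.symm))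
  -- The factor is `c⁻¹`, since `γ (T + c⁻¹ * r) = γ r` for small `r`.
  obtain ⟨τ, hτ0, hτ1, hτ, hτs⟩ := exists_time_change hT (inv_pos.2 hc)
  have hτm : StrictMono τ := strictMono_of_deriv_pos fun s ↦ (hτs s).self_of_nhds.2
  have hrep : ∀ᶠ s in 𝓝 0, (γ ∘ τ) (1 + s) = (γ ∘ τ) s := by
    have t1 : Tendsto (fun s ↦ c⁻¹ * τ s) (𝓝 0) (𝓝 0) := by
      have : ContinuousAt (fun s ↦ c⁻¹ * τ s) 0 := continuousAt_const.mul (hτs 0).continuousAt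
      simpa [ContinuousAt, hτ0] using this
    filter_upwards [t1.eventually hret] with s hs
    rw [Function.comp_apply, hτ, hs, mul_inv_cancel_left₀ hc.ne', Function.comp_apply]
  refine ⟨fun s ↦ γ (τ (Int.fract s)), ⟨fun s ↦ by simp, fun t ↦ ?_⟩, ?_⟩
  · have hk : SmoothIncrNear (fun s ↦ τ (s - ⌊t⌋)) t := by
      simp only [sub_eq_add_neg]
      exact SmoothIncrNear.comp (hτs _) (.add_const _ _)
    refine NullCurveAt.congr (NullCurveAt.comp (c := γ) (hnull _ ?_) hk) (eventually_fract_eq hrep t)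
    have h0 := hτm.monotone (Int.fract_nonneg t)
    have h1 := hτm.monotone (Int.fract_lt_one t).le
    rw [hτ0] at h0
    rw [hτ1] at h1
    exact ⟨h0, h1⟩
  · have t1 : Tendsto τ (𝓝 0) (𝓝 0) := by simpa [ContinuousAt, hτ0] using (hτs 0).continuousAt
    have hs : SmoothIncrNear (fun s ↦ (y s).1) (τ 0) := by
      rw [hτ0]
      have h1 : ∀ᶠ s in 𝓝 0, 0 < (deriv y s).1 :=
        hy.continuousAt_deriv.fst.eventually (lt_mem_nhds (by simp [dy]))
      filter_upwards [h1, hy.eventually] with s h2 h3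
      exact ⟨h3.contDiffAt.self_of_nhds.fst, by rwa [h3.hasDerivAt.fst_comp.deriv]⟩
    refine ⟨fun s ↦ (y (τ s)).1, by simp [hτ0, hy0], hs.comp (hτs 0), ?_⟩
    have e3 := hγ.eventually_snd_eq hJ h0J hy (by simp [dy])
    rw [hy0] at e3
    filter_upwards [eventually_fract_eq hrep 0, t1.eventually hy.eq, t1.eventually e3]
      with s h1 h2 h3
    simp only [Function.comp_apply, Int.floor_zero, Int.cast_zero, sub_zero] at h1
    rw [h1, h2, ← h3]

end LorentzianMetric

/-! ### Continuation along intervals -/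

theorem frequently_nhds_of_self {A : Type*} [TopologicalSpace A] {Q : A → Prop} {a : A} (h : Q a) :
    ∃ᶠ x in 𝓝 a, Q x := fun hn ↦ hn.self_of_nhds h

theorem IsCompact.exists_frequently {A B : Type*} [TopologicalSpace A] [TopologicalSpace B]
    {K : Set B} (hK : IsCompact K) {R : A → B → Prop} {a : A}
    (h : ∃ᶠ x in 𝓝 a, ∃ t ∈ K, R x t) : ∃ t ∈ K, ∃ᶠ p in 𝓝 (a, t), R p.1 p.2 := by
  by_contra hne
  simp only [not_exists, not_and, not_frequently] at hne
  refine h ((hK.eventually_forall_of_forall_eventually (P := fun x t ↦ ¬ R x t) hne).mono ?_)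
  rintro x hx ⟨t, ht, hR⟩
  exact hx t ht hR

/-- Continuation along an interval: local solutions of a problem that can be extended to a uniform
neighbourhood, and that are determined by one value, extend to a global solution. -/
theorem exists_continuation {A : Type*} {Good : (ℝ → A) → ℝ → Prop}
    (hcongr : ∀ f f' x, f' =ᶠ[𝓝 x] f → Good f x → Good f' x)
    (huniq : ∀ U, IsOpen U → IsPreconnected U → ∀ f f', (∀ x ∈ U, Good f x) →
      (∀ x ∈ U, Good f' x) → ∀ y ∈ U, f y = f' y → EqOn f f' U)
    {I : Set ℝ} (hIo : IsOpen I) (hI : IsPreconnected I)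
    (hext : ∀ x ∈ I, ∃ W, IsOpen W ∧ IsPreconnected W ∧ x ∈ W ∧ ∀ y ∈ W, ∀ f, Good f y →
      ∃ f', f' y = f y ∧ ∀ u ∈ W, Good f' u)
    {x₀ : ℝ} (hx₀ : x₀ ∈ I) {f₀ : ℝ → A} (h₀ : Good f₀ x₀) :
    ∃ f, f x₀ = f₀ x₀ ∧ ∀ x ∈ I, Good f x := by
  classical
  have key : ∀ x ∈ I, ∃ U f, IsOpen U ∧ IsPreconnected U ∧ x₀ ∈ U ∧ x ∈ U ∧ f x₀ = f₀ x₀ ∧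
      ∀ u ∈ U, Good f u := by
    refine hI.forall_of_frequently hx₀ ?_ fun x hx hf ↦ ?_
    · obtain ⟨W, hWo, hW, hxW, h⟩ := hext x₀ hx₀
      obtain ⟨f, h1, h2⟩ := h x₀ hxW f₀ h₀
      exact ⟨W, f, hWo, hW, hxW, hxW, h1, h2⟩
    · obtain ⟨W, hWo, hW, hxW, h⟩ := hext x hx
      obtain ⟨y, ⟨U, f, hUo, hU, hx₀U, hyU, h1, h2⟩, hyW⟩ :=
        (hf.and_eventually (hWo.mem_nhds hxW)).exists
      obtain ⟨f', h3, h4⟩ := h y hyW f (h2 y hyU)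
      -- Connected subsets of the line are order convex, so the overlap is connected and uniqueness
      -- applies to it.
      have heq : EqOn f f' (U ∩ W) :=
        huniq _ (hUo.inter hWo) (hU.ordConnected.inter hW.ordConnected).isPreconnected f f'
          (fun u hu ↦ h2 u hu.1) (fun u hu ↦ h4 u hu.2) y ⟨hyU, hyW⟩ h3.symm
      filter_upwards [hWo.mem_nhds hxW] with x' hx'
      refine ⟨U ∪ W, U.piecewise f f', hUo.union hWo, hU.union y hyU hyW hW, .inl hx₀U, .inr hx',
        by rw [piecewise_eq_of_mem _ _ _ hx₀U, h1], ?_⟩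
      rintro u (hu | hu)
      · refine hcongr f _ u ?_ (h2 u hu)
        filter_upwards [hUo.mem_nhds hu] with v hv using piecewise_eq_of_mem _ _ _ hv
      · refine hcongr f' _ u ?_ (h4 u hu)
        filter_upwards [hWo.mem_nhds hu] with v hv
        by_cases hvU : v ∈ U
        · rw [piecewise_eq_of_mem _ _ _ hvU, heq ⟨hvU, hv⟩]
        · rw [piecewise_eq_of_notMem _ _ _ hvU]
  have : Nonempty A := ⟨f₀ 0⟩
  choose! U f hUo hU hx₀U hxU h1 h2 using key
  refine ⟨fun x ↦ f x x, h1 x₀ hx₀, fun x hx ↦ hcongr (f x) _ x ?_ (h2 x hx x (hxU x hx))⟩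
  filter_upwards [hIo.mem_nhds hx, (hUo x hx).mem_nhds (hxU x hx)] with y hy hyU
  exact huniq _ ((hUo y hy).inter (hUo x hx))
    ((hU y hy).ordConnected.inter (hU x hx).ordConnected).isPreconnected (f y) (f x)
    (fun u hu ↦ h2 y hy u hu.1) (fun u hu ↦ h2 x hx u hu.2) x₀ ⟨hx₀U y hy, hx₀U x hx⟩
    ((h1 y hy).trans (h1 x hx).symm) ⟨hxU y hy, hyU⟩

/-! ### Uniqueness of null parametrizations and lifting of null curves -/

namespace LorentzianMetric

variable {X : Type*} [TopologicalSpace X] [ChartedSpace (EuclideanSpace ℝ (Fin 2)) X]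
  [IsManifold (𝓡 2) ∞ X] {g : LorentzianMetric X} {P Q : ℝ × ℝ → X} {z w : ℝ × ℝ}

/-- Two null parametrizations that agree on lines accumulating at a segment, and on a transversal
line, agree near the segment. -/
theorem eventuallyEq_of_row [T2Space X] {I : Set ℝ} (hI : IsPreconnected I) {a b : ℝ} (ha : a ∈ I)
    (hP : ∀ u ∈ I, g.NullNear P (u, b)) (hQ : ∀ u ∈ I, g.NullNear Q (u, b))
    (h1 : ∀ u ∈ I, ∃ᶠ v in 𝓝 b, ∀ᶠ u' in 𝓝 u, P (u', v) = Q (u', v))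
    (h2 : ∀ᶠ v in 𝓝 b, P (a, v) = Q (a, v)) : ∀ u ∈ I, P =ᶠ[𝓝 (u, b)] Q := by
  have key (u) (hu : u ∈ I) (hf : ∃ᶠ u' in 𝓝 u, ∀ᶠ v in 𝓝 b, P (u', v) = Q (u', v)) :
      P =ᶠ[𝓝 (u, b)] Q := (hP u hu).eventuallyEq_of_frequently (hQ u hu) (h1 u hu) hf
  have hall : ∀ u ∈ I, ∀ᶠ v in 𝓝 b, P (u, v) = Q (u, v) := by
    refine hI.forall_of_frequently ha h2 fun u hu hf ↦ ?_
    have h3 := key u hu hf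
    rw [EventuallyEq, nhds_prod_eq] at h3
    exact h3.curry
  intro u hu
  exact key u hu (frequently_nhds_of_self (hall u hu))

/-- Two null parametrizations of a box that agree on two crossing lines are equal. -/
theorem eqOn_prod [T2Space X] {I J : Set ℝ} (hIo : IsOpen I) (hI : IsPreconnected I)
    (hJo : IsOpen J) (hJ : IsPreconnected J) (hP : ∀ z ∈ I ×ˢ J, g.NullNear P z)
    (hQ : ∀ z ∈ I ×ˢ J, g.NullNear Q z) {a b : ℝ} (ha : a ∈ I) (hb : b ∈ J)
    (h1 : ∀ u ∈ I, P (u, b) = Q (u, b)) (h2 : ∀ v ∈ J, P (a, v) = Q (a, v)) :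
    EqOn P Q (I ×ˢ J) := by
  rintro ⟨u, v⟩ ⟨hu, hv⟩
  have hK : uIcc a u ⊆ I := hI.ordConnected.uIcc_subset ha hu
  have hline (u v : ℝ) : Tendsto (fun u' ↦ (u', v)) (𝓝 u) (𝓝 (u, v)) :=
    Continuous.tendsto (by fun_prop) _
  have row (v₀) (hv₀ : v₀ ∈ J) := eventuallyEq_of_row (P := P) (Q := Q) (g := g) (b := v₀)
    (isPreconnected_uIcc (a := a) (b := u)) left_mem_uIcc (fun u' hu' ↦ hP _ ⟨hK hu', hv₀⟩)
    (fun u' hu' ↦ hQ _ ⟨hK hu', hv₀⟩)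
  have h2' (v₀) (hv₀ : v₀ ∈ J) : ∀ᶠ v in 𝓝 v₀, P (a, v) = Q (a, v) := by
    filter_upwards [hJo.mem_nhds hv₀] with v hv using h2 v hv
  -- Agreement is propagated from row to row in `v'`. Compactness of the segment from `a` to `u`
  -- provides one neighbourhood of heights for the entire row.
  have main : ∀ v' ∈ J, ∀ u' ∈ uIcc a u, P =ᶠ[𝓝 (u', v')] Q := by
    refine hJ.forall_of_frequently hb ?_ fun v₀ hv₀ hf ↦ ?_
    · refine row b hb (fun u' hu' ↦ frequently_nhds_of_self ?_) (h2' b hb)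
      filter_upwards [hIo.mem_nhds (hK hu')] with x hx using h1 x hx
    · have h3 := row v₀ hv₀
        (fun u' hu' ↦ hf.mono fun v' hv' ↦ (hline u' v').eventually (hv' u' hu')) (h2' v₀ hv₀)
      refine isCompact_uIcc.eventually_forall_of_forall_eventually fun u' hu' ↦ ?_
      have hs : Tendsto (fun z : ℝ × ℝ ↦ (z.2, z.1)) (𝓝 (v₀, u')) (𝓝 (u', v₀)) :=
        Continuous.tendsto (by fun_prop) _
      exact hs.eventually (h3 u' hu').eventually_nhds
  exact (main v hv u right_mem_uIcc).self_of_nhds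

/-- Being reparametrizations of each other is a closed relation between a null curve and the first
coordinate lines of a null parametrization. -/
theorem NullNear.reparam_curve_of_frequently [T2Space X] {c : ℝ → X} {t : ℝ}
    (hQ : g.NullNear Q w) (hc : g.NullCurveAt c t)
    (hf : ∃ᶠ p in 𝓝 (t, w), Reparam c p.1 (fun s ↦ Q (s, p.2.2)) p.2.1) :
    Reparam c t (fun s ↦ Q (s, w.2)) w.1 := by
  obtain ⟨K, hK, hKc⟩ := hc
  have hm : Tendsto (fun p : ℝ × (ℝ × ℝ) ↦ ((p.1, (0 : ℝ)), p.2)) (𝓝 (t, w)) (𝓝 ((t, 0), w)) :=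
    Continuous.tendsto (by fun_prop) _
  have hfst : Tendsto Prod.fst (𝓝 (t, w)) (𝓝 t) := continuousAt_fst
  have hf' : ∃ᶠ p in 𝓝 (t, w), Reparam (fun s ↦ K (s, 0)) p.1 (fun s ↦ Q (s, p.2.2)) p.2.1 := by
    refine (hf.and_eventually (hfst.eventually hKc.eventually_nhds)).mono ?_
    rintro p ⟨h1, h2⟩
    exact (Reparam.of_eventuallyEq (h2.mono fun s hs ↦ hs.symm)).trans h1
  have h0 : K (t, 0) = Q w := by
    refine tendsto_nhds_unique_of_frequently_eq (hK.continuousAt.tendsto.comp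
      (continuousAt_fst.prodMk continuousAt_const : Tendsto (fun p : ℝ × (ℝ × ℝ) ↦ (p.1, (0 : ℝ)))
        (𝓝 (t, w)) (𝓝 (t, 0)))) (hQ.continuousAt.tendsto.comp
      (continuousAt_snd : Tendsto Prod.snd (𝓝 (t, w)) (𝓝 w))) (hf'.mono fun p hp ↦ ?_)
    exact hp.eq
  have h1 := hK.reparam_of_frequently hQ h0 (hm.frequently (p := fun p ↦
    Reparam (fun t ↦ K (t, p.1.2)) p.1.1 (fun t ↦ Q (t, p.2.2)) p.2.1) hf')
  exact (Reparam.of_eventuallyEq hKc).trans h1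

namespace NullCurveAt

variable {c c' : ℝ → X} {t s : ℝ}

theorem reparam_of_frequently [T2Space X] (hc : g.NullCurveAt c t) (hc' : g.NullCurveAt c' s)
    (hf : ∃ᶠ p in 𝓝 (s, t), Reparam c p.2 c' p.1) : Reparam c t c' s := by
  obtain ⟨K, hK, hKc⟩ := hc'
  have hm : Tendsto (fun p : ℝ × ℝ ↦ (p.2, (p.1, (0 : ℝ)))) (𝓝 (s, t)) (𝓝 (t, (s, 0))) :=
    Continuous.tendsto (by fun_prop) _
  have hfst : Tendsto Prod.fst (𝓝 (s, t)) (𝓝 s) := continuousAt_fst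
  have h1 := hK.reparam_curve_of_frequently hc (hm.frequently (p := fun p ↦
    Reparam c p.1 (fun s ↦ K (s, p.2.2)) p.2.1) ?_)
  · exact h1.trans (.of_eventuallyEq (hKc.mono fun r hr ↦ hr.symm))
  · refine (hf.and_eventually (hfst.eventually hKc.eventually_nhds)).mono ?_
    rintro p ⟨h1, h2⟩
    exact h1.trans (.of_eventuallyEq h2)

theorem exists_injOn (hc : g.NullCurveAt c t) : ∃ U ∈ 𝓝 t, InjOn c U := by
  obtain ⟨K, hK, hKc⟩ := hc
  obtain ⟨V, hV, hVi⟩ := hK.exists_injOn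
  have hl : Tendsto (fun s ↦ (s, (0 : ℝ))) (𝓝 t) (𝓝 (t, 0)) := Continuous.tendsto (by fun_prop) _
  refine ⟨_, (hl.eventually hV).and hKc, fun s hs s' hs' h ↦ ?_⟩
  rw [← hs.2, ← hs'.2] at h
  exact congrArg Prod.fst (hVi hs.1 hs'.1 h)

end NullCurveAt

/-- Near `s`, the increasing map `h` lifts the curve `c₁` to the curve `c₂`. -/
def _root_.LiftNear {X : Type*} (c₂ c₁ : ℝ → X) (h : ℝ → ℝ) (s : ℝ) : Prop :=
  SmoothIncrNear h s ∧ ∀ᶠ τ in 𝓝 s, c₁ τ = c₂ (h τ)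

theorem _root_.LiftNear.reparam {X : Type*} {c₂ c₁ : ℝ → X} {h : ℝ → ℝ} {s : ℝ}
    (hh : LiftNear c₂ c₁ h s) : Reparam c₂ (h s) c₁ s := ⟨h, rfl, hh⟩

namespace IsClosedNullCurve

variable {c c₁ : ℝ → X}

theorem add_int (hc : g.IsClosedNullCurve c) (t : ℝ) (n : ℤ) : c (t + n) = c t := by
  have h : Function.Periodic c 1 := hc.add_one
  simpa using (h.int_mul n) t

theorem reparam_add_int (hc : g.IsClosedNullCurve c) (t : ℝ) (n : ℤ) :
    Reparam c t c (t - n) :=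
  ⟨fun s ↦ s + n, by simp, .add_const _ _, .of_forall fun s ↦ (hc.add_int s n).symm⟩

/-- By periodicity it suffices to let `t` range over `[0, 1]`, where compactness gives a common `ε`.
Near a given `t₀`, either `c₁` lifts through `t₀`, and local injectivity of `c` makes this lift pass
through each nearby admissible `t`, or closedness of `Reparam` rules out all nearby pairs. -/
theorem exists_uniform_lift [T2Space X] (hc : g.IsClosedNullCurve c) {s₀ : ℝ}
    (h₁ : g.NullCurveAt c₁ s₀) : ∃ ε > 0, ∀ s ∈ Ioo (s₀ - ε) (s₀ + ε), ∀ t, Reparam c t c₁ s →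
      ∃ h, h s = t ∧ ∀ r ∈ Ioo (s₀ - ε) (s₀ + ε), LiftNear c c₁ h r := by
  have key : ∃ ε > 0, ∀ s ∈ Ioo (s₀ - ε) (s₀ + ε), ∀ t ∈ Icc (0 : ℝ) 1, Reparam c t c₁ s →
      ∃ h, h s = t ∧ ∀ r ∈ Ioo (s₀ - ε) (s₀ + ε), LiftNear c c₁ h r := by
    refine isCompact_Icc.induction_on (p := fun S ↦ ∃ ε > 0, ∀ s ∈ Ioo (s₀ - ε) (s₀ + ε), ∀ t ∈ S,
      Reparam c t c₁ s → ∃ h, h s = t ∧ ∀ r ∈ Ioo (s₀ - ε) (s₀ + ε), LiftNear c c₁ h r)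
      ⟨1, one_pos, by simp⟩ ?_ ?_ ?_
    · rintro S S' hSS ⟨ε, hε, h⟩
      exact ⟨ε, hε, fun s hs t ht ↦ h s hs t (hSS ht)⟩
    · rintro S S' ⟨ε, hε, h⟩ ⟨ε', hε', h'⟩
      have i1 : Ioo (s₀ - min ε ε') (s₀ + min ε ε') ⊆ Ioo (s₀ - ε) (s₀ + ε) :=
        Ioo_subset_Ioo (by linarith [min_le_left ε ε']) (by linarith [min_le_left ε ε'])
      have i2 : Ioo (s₀ - min ε ε') (s₀ + min ε ε') ⊆ Ioo (s₀ - ε') (s₀ + ε') :=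
        Ioo_subset_Ioo (by linarith [min_le_right ε ε']) (by linarith [min_le_right ε ε'])
      refine ⟨min ε ε', lt_min hε hε', fun s hs t ht hR ↦ ?_⟩
      rcases ht with ht | ht
      · obtain ⟨k, h1, h2⟩ := h s (i1 hs) t ht hR
        exact ⟨k, h1, fun r hr ↦ h2 r (i1 hr)⟩
      · obtain ⟨k, h1, h2⟩ := h' s (i2 hs) t ht hR
        exact ⟨k, h1, fun r hr ↦ h2 r (i2 hr)⟩
    · intro t₀ _
      by_cases hR : Reparam c t₀ c₁ s₀
      · obtain ⟨k, hk0, hk, hkc⟩ := hR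
        obtain ⟨V, hV, hVi⟩ := (hc.nullCurveAt t₀).exists_injOn
        have hkV : ∀ᶠ r in 𝓝 s₀, k r ∈ V := by
          rw [← hk0] at hV
          exact hk.continuousAt.eventually hV
        obtain ⟨ε, hε, h⟩ := Metric.eventually_nhds_iff.1
          ((hk.eventually_nhds.and hkc.eventually_nhds).and hkV)
        have h' (r) (hr : r ∈ Ioo (s₀ - ε) (s₀ + ε)) := h (y := r) (by
          rw [Real.dist_eq, abs_lt]; constructor <;> linarith [hr.1, hr.2])
        refine ⟨V, mem_nhdsWithin_of_mem_nhds hV, ε, hε, fun s hs t ht hst ↦ ⟨k, ?_, fun r hr ↦ (h' r hr).1⟩⟩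
        refine hVi (h' s hs).2 ht ?_
        rw [hst.eq, (h' s hs).1.2.self_of_nhds]
      · have hn : ∀ᶠ p in 𝓝 (s₀, t₀), ¬ Reparam c p.2 c₁ p.1 := by
          rw [← not_frequently]
          exact fun hf ↦ hR ((hc.nullCurveAt t₀).reparam_of_frequently h₁ hf)
        rw [nhds_prod_eq] at hn
        obtain ⟨pa, hpa, pb, hpb, h⟩ := eventually_prod_iff.1 hn
        obtain ⟨ε, hε, hpa⟩ := Metric.eventually_nhds_iff.1 hpa
        refine ⟨_, mem_nhdsWithin_of_mem_nhds hpb, ε, hε, fun s hs t ht hst ↦ ?_⟩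
        refine absurd hst (h (hpa ?_) ht)
        rw [Real.dist_eq, abs_lt]
        constructor <;> linarith [hs.1, hs.2]
  obtain ⟨ε, hε, h⟩ := key
  refine ⟨ε, hε, fun s hs t hR ↦ ?_⟩
  obtain ⟨k, hk, hkl⟩ := h s hs (Int.fract t) ⟨Int.fract_nonneg t, (Int.fract_lt_one t).le⟩
    ((hc.reparam_add_int t ⌊t⌋).symm.trans hR)
  refine ⟨fun r ↦ k r + ⌊t⌋, by simp only [hk, Int.fract_add_floor], fun r hr ↦ ⟨?_, ?_⟩⟩
  · exact SmoothIncrNear.comp (k := fun x ↦ x + (⌊t⌋ : ℝ)) (.add_const _ _) (hkl r hr).1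
  · simpa only [hc.add_int] using (hkl r hr).2

/-- Lifting of null curves to closed null curves. -/
theorem exists_lift [T2Space X] (hc : g.IsClosedNullCurve c) {I : Set ℝ} (hIo : IsOpen I)
    (hI : IsPreconnected I) (h₁ : ∀ s ∈ I, g.NullCurveAt c₁ s) {s₀ t₀ : ℝ} (hs₀ : s₀ ∈ I)
    (h₀ : Reparam c t₀ c₁ s₀) : ∃ h, h s₀ = t₀ ∧ ∀ s ∈ I, LiftNear c c₁ h s := by
  obtain ⟨h₀, rfl, hh₀⟩ := h₀
  refine exists_continuation (Good := LiftNear c c₁) ?_ ?_ hIo hI ?_ hs₀ hh₀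
  · rintro f f' x hff ⟨h1, h2⟩
    refine ⟨h1.congr hff, ?_⟩
    filter_upwards [h2, hff] with τ h3 h4
    rw [h3, h4]
  · intro U hUo hU f f' hf hf' y hy hyy
    refine hU.forall_of_frequently (Q := fun x ↦ f x = f' x) hy hyy fun x hx hfreq ↦ ?_
    have h1 : f x = f' x := tendsto_nhds_unique_of_frequently_eq (hf x hx).1.continuousAt
      (hf' x hx).1.continuousAt hfreq
    obtain ⟨V, hV, hVi⟩ := (hc.nullCurveAt (f x)).exists_injOn
    filter_upwards [(hf x hx).1.continuousAt.eventually hV,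
      (hf' x hx).1.continuousAt.eventually (h1 ▸ hV), (hf x hx).2, (hf' x hx).2] with r e1 e2 e3 e4
    exact hVi e1 e2 (e3.symm.trans e4)
  · intro x hx
    obtain ⟨ε, hε, h⟩ := hc.exists_uniform_lift (h₁ x hx)
    refine ⟨Ioo (x - ε) (x + ε), isOpen_Ioo, isPreconnected_Ioo, ⟨by linarith, by linarith⟩, ?_⟩
    exact fun y hy f hf ↦ h y hy (f y) hf.reparam

end IsClosedNullCurve

end LorentzianMetric

/-! ### Strips along closed null curves and their holonomy -/

/-- A property that holds near a horizontal unit segment holds on a uniform neighbourhood of it. -/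
theorem exists_uniform_near_segment {Q : ℝ × ℝ → Prop} {V : ℝ}
    (h : ∀ u ∈ Icc (0 : ℝ) 1, ∀ᶠ z in 𝓝 (u, V), Q z) :
    ∃ δ > 0, ∀ u ∈ Ioo (-δ) (1 + δ), ∀ v ∈ Ioo (V - δ) (V + δ), Q (u, v) := by
  have hK : IsCompact (Icc (0 : ℝ) 1 ×ˢ ({V} : Set ℝ)) := isCompact_Icc.prod isCompact_singleton
  obtain ⟨δ, hδ, hsub⟩ := hK.exists_thickening_subset_open
    (isOpen_setOfPred_eventually_nhds (p := Q)) (by rintro ⟨u, v⟩ ⟨hu, rfl⟩; exact h u hu)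
  refine ⟨δ, hδ, fun u hu v hv ↦ (hsub ?_ : ∀ᶠ z in 𝓝 (u, v), Q z).self_of_nhds⟩
  refine Metric.mem_thickening_iff.2 ⟨(max 0 (min u 1), V), ⟨?_, rfl⟩, ?_⟩
  · exact ⟨le_max_left _ _, max_le zero_le_one (min_le_right _ _)⟩
  · rw [Prod.dist_eq, max_lt_iff, Real.dist_eq, Real.dist_eq, abs_lt, abs_lt]
    obtain ⟨h1, h2⟩ := hu
    obtain ⟨h3, h4⟩ := hv
    refine ⟨?_, ⟨by simp only; linarith, by simp only; linarith⟩⟩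
    simp only
    rcases le_total u 1 with h5 | h5 <;> rcases le_total 0 u with h6 | h6 <;>
      constructor <;> simp [h5, h6] <;> linarith

/-- An increasing map with a fixed point `b` that preserves a finite set fixes its points. -/
theorem eq_of_finite_invariant {φ : ℝ → ℝ} {L D : Set ℝ} {b v : ℝ} (hD : D.OrdConnected)
    (hb : b ∈ D) (hv : v ∈ D) (hφv : φ v ∈ D) (hφ : StrictMonoOn φ D) (hc : ContinuousOn φ D)
    (hφb : φ b = b) (hL : ∀ x ∈ D, x ∈ L ↔ φ x ∈ L) (hfin : (L ∩ D).Finite) (hvL : v ∈ L) :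
    φ v = v := by
  have hsub : uIcc b v ⊆ D := hD.uIcc_subset hb hv
  have hsub' : uIcc b (φ v) ⊆ D := hD.uIcc_subset hb hφv
  have himg : φ '' (L ∩ uIcc b v) = L ∩ uIcc b (φ v) := by
    have h1 := (hc.mono hsub).image_uIcc_of_monotoneOn (hφ.monotoneOn.mono hsub)
    rw [hφb] at h1
    rw [← h1]
    ext x
    constructor
    · rintro ⟨y, ⟨hy, hy'⟩, rfl⟩
      exact ⟨(hL y (hsub hy')).1 hy, y, hy', rfl⟩
    · rintro ⟨hx, y, hy', rfl⟩
      exact ⟨y, ⟨(hL y (hsub hy')).2 hx, hy'⟩, rfl⟩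
  -- One of the two intervals from `b` contains the other. Their finite intersections with `L` are
  -- nested and of equal size, hence equal, so each interval contains the endpoint of the other.
  have hcard : (L ∩ uIcc b (φ v)).ncard = (L ∩ uIcc b v).ncard := by
    rw [← himg]
    exact (hφ.injOn.mono (inter_subset_right.trans hsub)).ncard_image
  have hφL : φ v ∈ L := (hL v hv).1 hvL
  have hf1 : (L ∩ uIcc b v).Finite := hfin.subset (inter_subset_inter_right L hsub)
  have hf2 : (L ∩ uIcc b (φ v)).Finite := hfin.subset (inter_subset_inter_right L hsub')
  have hside : v ∈ uIcc b (φ v) ∨ φ v ∈ uIcc b v := by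
    rcases le_total b v with h | h
    · have h1 := hφ.monotoneOn hb hv h
      rw [hφb] at h1
      rw [uIcc_of_le h, uIcc_of_le h1]
      rcases le_total v (φ v) with h2 | h2
      · exact .inl ⟨h, h2⟩
      · exact .inr ⟨h1, h2⟩
    · have h1 := hφ.monotoneOn hv hb h
      rw [hφb] at h1
      rw [uIcc_of_ge h, uIcc_of_ge h1]
      rcases le_total v (φ v) with h2 | h2
      · exact .inr ⟨h2, h1⟩
      · exact .inl ⟨h2, h⟩
  have hboth : v ∈ uIcc b (φ v) ∧ φ v ∈ uIcc b v := by
    rcases hside with h | h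
    · have h1 : L ∩ uIcc b v ⊆ L ∩ uIcc b (φ v) :=
        inter_subset_inter_right L (uIcc_subset_uIcc_left h)
      have h2 := eq_of_subset_of_ncard_le h1 hcard.le hf2
      exact ⟨h, (h2.symm ▸ ⟨hφL, right_mem_uIcc⟩ : φ v ∈ L ∩ uIcc b v).2⟩
    · have h1 : L ∩ uIcc b (φ v) ⊆ L ∩ uIcc b v :=
        inter_subset_inter_right L (uIcc_subset_uIcc_left h)
      have h2 := eq_of_subset_of_ncard_le h1 hcard.ge hf1
      exact ⟨(h2.symm ▸ ⟨hvL, right_mem_uIcc⟩ : v ∈ L ∩ uIcc b (φ v)).2, h⟩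
  rw [mem_uIcc, mem_uIcc] at hboth
  rcases hboth with ⟨h1 | h1, h2 | h2⟩ <;> linarith [h1.1, h1.2, h2.1, h2.2]

namespace LorentzianMetric

variable {X : Type*} [TopologicalSpace X] [ChartedSpace (EuclideanSpace ℝ (Fin 2)) X]
  [IsManifold (𝓡 2) ∞ X] {g : LorentzianMetric X} {P Q : ℝ × ℝ → X} {z w : ℝ × ℝ}

/-- Charts adapted to `c` are glued successively along the segment. Where two of them meet, both
have `c` as a coordinate line, so they differ only by a change `b` of the transverse variable, which
is absorbed into the new chart. -/
theorem NullNear.exists_strip {c : ℝ → X} (hc : ∀ u ∈ Icc (0 : ℝ) 1, g.NullCurveAt c u) {V : ℝ}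
    (hP : g.NullNear P (0, V)) (h : ∀ᶠ u in 𝓝 0, P (u, V) = c u) :
    ∃ S, S =ᶠ[𝓝 (0, V)] P ∧
      ∀ u ∈ Icc (0 : ℝ) 1, g.NullNear S (u, V) ∧ ∀ᶠ u' in 𝓝 u, S (u', V) = c u' := by
  have hline (u v : ℝ) : Tendsto (fun u' ↦ (u', v)) (𝓝 u) (𝓝 (u, v)) :=
    Continuous.tendsto (by fun_prop) _
  have key : ∀ s ∈ Icc (0 : ℝ) 1, ∃ S, S =ᶠ[𝓝 (0, V)] P ∧
      ∀ u ∈ Icc (0 : ℝ) s, g.NullNear S (u, V) ∧ ∀ᶠ u' in 𝓝 u, S (u', V) = c u' := by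
    refine isPreconnected_Icc.forall_of_frequently ⟨le_rfl, zero_le_one⟩ ?_ fun x hx hf ↦ ?_
    · refine ⟨P, .rfl, fun u hu ↦ ?_⟩
      obtain rfl : u = 0 := le_antisymm hu.2 hu.1
      exact ⟨hP, h⟩
    rcases hx.1.eq_or_lt with rfl | hx0
    · obtain ⟨ε, hε, h1⟩ := Metric.eventually_nhds_iff.1
        (((hline 0 V).eventually hP.eventually).and h.eventually_nhds)
      filter_upwards [gt_mem_nhds hε] with y hy
      refine ⟨P, .rfl, fun u hu ↦ h1 ?_⟩
      rw [Real.dist_eq, sub_zero, abs_of_nonneg hu.1]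
      exact hu.2.trans_lt hy
    · obtain ⟨K, hK, hKc⟩ := hc x hx
      obtain ⟨ε, hε, h1⟩ := Metric.eventually_nhds_iff.1
        (((hline x 0).eventually hK.eventually).and hKc.eventually_nhds)
      have hnear : ∀ᶠ y in 𝓝 x, dist y x < ε := Metric.ball_mem_nhds x hε
      obtain ⟨y, ⟨S, hSP, hS⟩, hy, hy0⟩ :=
        (hf.and_eventually (hnear.and (lt_mem_nhds hx0))).exists
      obtain ⟨hSy, hSc⟩ := hS y ⟨hy0.le, le_rfl⟩
      obtain ⟨b, hb0, hb, hSb⟩ := NullNear.exists_eq_prod (z := (y, 0)) (w := (y, V)) (h1 hy).1 hSy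
        (.id _) rfl (by filter_upwards [hSc, (h1 hy).2] with t e1 e2; rw [e1, e2])
      dsimp only at hb0 hb
      filter_upwards [hnear] with y' hy'
      refine ⟨fun p ↦ if p.1 ≤ y then S p else K (p.1, b p.2), ?_, fun u hu ↦ ?_⟩
      · have : ∀ᶠ p : ℝ × ℝ in 𝓝 (0, V), p.1 < y :=
          continuousAt_fst.eventually (gt_mem_nhds hy0)
        filter_upwards [this, hSP] with p h2 h3
        rw [if_pos h2.le, h3]
      rcases le_or_gt u y with huy | huy
      · have heq : (fun p ↦ if p.1 ≤ y then S p else K (p.1, b p.2)) =ᶠ[𝓝 (u, V)] S := by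
          rcases huy.lt_or_eq with huy | rfl
          · have : ∀ᶠ p : ℝ × ℝ in 𝓝 (u, V), p.1 < y :=
              continuousAt_fst.eventually (gt_mem_nhds huy)
            filter_upwards [this] with p h2
            rw [if_pos h2.le]
          · filter_upwards [hSb] with p h2
            split_ifs
            · rfl
            · exact h2.symm
        obtain ⟨h2, h3⟩ := hS u ⟨hu.1, huy⟩
        refine ⟨h2.congr heq, ?_⟩
        filter_upwards [h3, (hline u V).eventually heq] with t e1 e2
        rw [e2, e1]
      · have heq : (fun p ↦ if p.1 ≤ y then S p else K (p.1, b p.2)) =ᶠ[𝓝 (u, V)]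
            fun p ↦ K (p.1, b p.2) := by
          have : ∀ᶠ p : ℝ × ℝ in 𝓝 (u, V), y < p.1 :=
            continuousAt_fst.eventually (lt_mem_nhds huy)
          filter_upwards [this] with p h2
          rw [if_neg h2.not_ge]
        have hu' : dist u x < ε := by
          rw [Real.dist_eq, abs_lt] at hy hy' ⊢
          constructor <;> linarith [hy.1, hy'.2, hu.2]
        obtain ⟨h2, h3⟩ := h1 hu'
        refine ⟨NullNear.congr ?_ heq, ?_⟩
        · exact NullNear.comp_prod (a := fun s ↦ s) (w := (u, V)) (by simpa [hb0] using h2) (.id _) hb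
        · filter_upwards [h3, (hline u V).eventually heq] with t e1 e2
          rw [e2, hb0, e1]
  exact key 1 ⟨zero_le_one, le_rfl⟩

namespace IsClosedNullCurve

variable {c : ℝ → X}

/-- A closed null curve meets a transversal in a discrete set. -/
theorem eventually_not_reparam [T2Space X] (hc : g.IsClosedNullCurve c) {a b : ℝ}
    (hS : g.NullNear P (a, b)) :
    ∀ᶠ v in 𝓝 b, v ≠ b → ¬ ∃ t, Reparam c t (fun u ↦ P (u, v)) a := by
  by_contra hf
  have hf1 : ∃ᶠ v in 𝓝 b, ∃ t ∈ Icc (0 : ℝ) 1, v ≠ b ∧ Reparam c t (fun u ↦ P (u, v)) a := by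
    refine (not_eventually.1 hf).mono fun v hv ↦ ?_
    simp only [not_forall, not_not] at hv
    obtain ⟨hne, t, ht⟩ := hv
    exact ⟨Int.fract t, ⟨Int.fract_nonneg t, (Int.fract_lt_one t).le⟩, hne,
      (hc.reparam_add_int t ⌊t⌋).symm.trans ht⟩
  obtain ⟨t, -, hf2⟩ := isCompact_Icc.exists_frequently hf1
  have hm : Tendsto (fun p : ℝ × ℝ ↦ (p.2, (a, p.1))) (𝓝 (b, t)) (𝓝 (t, (a, b))) :=
    Continuous.tendsto (by fun_prop) _
  -- At an accumulation of hits the curve itself runs along the line of height `b`; injectivity of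
  -- `P` then forbids nearby hits at other heights.
  have hR := hS.reparam_curve_of_frequently (hc.nullCurveAt t) (hm.frequently (p := fun p ↦
    Reparam c p.1 (fun s ↦ P (s, p.2.2)) p.2.1) (hf2.mono fun p hp ↦ hp.2))
  obtain ⟨k, hk0, hk, hkc⟩ := hR.symm
  obtain ⟨U, hU, hUi⟩ := hS.exists_injOn
  have ht1 : Tendsto (fun p : ℝ × ℝ ↦ (a, p.1)) (𝓝 (b, t)) (𝓝 (a, b)) :=
    Continuous.tendsto (by fun_prop) _
  have hsnd : Tendsto Prod.snd (𝓝 (b, t)) (𝓝 t) := continuousAt_snd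
  have ht2 : Tendsto (fun p : ℝ × ℝ ↦ (k p.2, b)) (𝓝 (b, t)) (𝓝 (a, b)) := by
    have : Tendsto k (𝓝 t) (𝓝 a) := by simpa [ContinuousAt, hk0] using hk.continuousAt
    exact (this.comp hsnd).prodMk_nhds tendsto_const_nhds
  obtain ⟨p, ⟨h1, h2⟩, h3, h4, h5⟩ := (hf2.and_eventually ((ht1.eventually hU).and
    ((ht2.eventually hU).and (hsnd.eventually hkc)))).exists
  have h6 := h2.eq
  rw [h5] at h6
  exact h1 (congrArg Prod.snd (hUi h4 h3 h6)).symm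

end IsClosedNullCurve

/-- The holonomy around a closed null line is trivial if all null lines are closed. -/
theorem AllLightlikeGeodesicsClosed.eventually_add_one_eq [T2Space X]
    (hg : g.AllLightlikeGeodesicsClosed) {δ b r : ℝ} (hδ : 0 < δ) (hr : 0 < r)
    (hS : ∀ u ∈ Ioo (-δ) (1 + δ), ∀ v ∈ Ioo (b - r) (b + r), g.NullNear P (u, v))
    (h1 : ∀ᶠ s in 𝓝 0, P (1 + s, b) = P (s, b)) :
    ∀ᶠ z in 𝓝 ((0 : ℝ), b), P (1 + z.1, z.2) = P z := by
  have m0 : (0 : ℝ) ∈ Ioo (-δ) (1 + δ) := ⟨by linarith, by linarith⟩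
  have m1 : (1 : ℝ) ∈ Ioo (-δ) (1 + δ) := ⟨by linarith, by linarith⟩
  have mb : b ∈ Ioo (b - r) (b + r) := ⟨by linarith, by linarith⟩
  have t1 : Tendsto (fun t : ℝ ↦ t + -1) (𝓝 1) (𝓝 0) := by
    have : ContinuousAt (fun t : ℝ ↦ t + -1) 1 := by fun_prop
    simpa [ContinuousAt] using this
  -- `φ` is the return map of the transversal: the common line at height `b` makes the charts at `u
  -- = 1` and `u = 0` differ only by it in the transverse variable.
  obtain ⟨φ, hφb, hφ, hφS⟩ := NullNear.exists_eq_prod (z := (0, b)) (w := (1, b))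
    (hS 0 m0 b mb) (hS 1 m1 b mb) (h := fun u ↦ u + -1) (.add_const _ _) (by simp) (by
      filter_upwards [t1.eventually h1] with t ht
      rw [← ht]
      congr 2
      ring)
  dsimp only at hφb hφ
  have hv1 : Tendsto (fun v : ℝ ↦ ((1 : ℝ), v)) (𝓝 b) (𝓝 (1, b)) :=
    Continuous.tendsto (by fun_prop) _
  have hφr : ∀ᶠ v in 𝓝 b, φ v ∈ Ioo (b - r) (b + r) := by
    have : Ioo (b - r) (b + r) ∈ 𝓝 (φ b) := by rw [hφb]; exact Ioo_mem_nhds mb.1 mb.2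
    exact hφ.continuousAt.eventually this
  obtain ⟨ρ, hρ, hD⟩ := Metric.eventually_nhds_iff.1
    ((hφ.and (hv1.eventually hφS.eventually_nhds)).and (hφr.and (Ioo_mem_nhds mb.1 mb.2)))
  set D := Icc (b - ρ / 2) (b + ρ / 2) with hDdef
  have hD' (v) (hv : v ∈ D) := hD (y := v) (by
    rw [Real.dist_eq, abs_lt]; constructor <;> linarith [hv.1, hv.2])
  have hDb : D ∈ 𝓝 b := Icc_mem_nhds (by linarith) (by linarith)
  have hcont : ContinuousOn φ D := fun v hv ↦ (hD' v hv).1.1.1.continuousAt.continuousWithinAt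
  have hmono : StrictMonoOn φ D := strictMonoOn_of_deriv_pos (convex_Icc _ _) hcont
    fun v hv ↦ (hD' v (interior_subset hv)).1.1.2
  have hrep (v) (hv : v ∈ D) : Reparam (fun u ↦ P (u, φ v)) 0 (fun u ↦ P (u, v)) 1 := by
    have hl : Tendsto (fun u : ℝ ↦ (u, v)) (𝓝 1) (𝓝 (1, v)) := Continuous.tendsto (by fun_prop) _
    exact ⟨fun u ↦ u + -1, by simp, .add_const _ _, hl.eventually (hD' v hv).1.2⟩
  have hlift {c : ℝ → X} (hc : g.IsClosedNullCurve c) {v : ℝ} (hv : v ∈ D) {s s' : ℝ}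
      (hs : s ∈ Ioo (-δ) (1 + δ)) (hs' : s' ∈ Ioo (-δ) (1 + δ))
      (h : ∃ t, Reparam c t (fun u ↦ P (u, v)) s) : ∃ t, Reparam c t (fun u ↦ P (u, v)) s' := by
    obtain ⟨t, ht⟩ := h
    obtain ⟨k, -, hk⟩ := hc.exists_lift isOpen_Ioo isPreconnected_Ioo
      (fun s hs ↦ NullCurveAt.of_nullNear (hS s hs v (hD' v hv).2.2)) hs ht
    exact ⟨_, (hk s' hs').reparam⟩
  have hfix : ∀ᶠ v in 𝓝 b, φ v = v := by
    have hφD : ∀ᶠ v in 𝓝 b, φ v ∈ D := hφ.continuousAt.eventually (by rwa [hφb])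
    filter_upwards [hDb, hφD] with v hv hφv
    obtain ⟨c, hc, hcv⟩ := hg.exists_isClosedNullCurve (hS 0 m0 v (hD' v hv).2.2)
    -- `L` is the set of heights at which the closed null curve through height `v` meets the
    -- transversal. It is invariant because a row on this curve at one end of the strip lies on it
    -- at the other end, by lifting, and finite in `D` because hits do not accumulate.
    refine eq_of_finite_invariant (L := {x | ∃ t, Reparam c t (fun u ↦ P (u, x)) 0}) ordConnected_Icc
      (mem_of_mem_nhds hDb) hv hφv hmono hcont hφb (fun x hx ↦ ⟨fun h ↦ ?_, fun h ↦ ?_⟩) ?_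
      ⟨0, hcv.symm⟩
    · obtain ⟨t, ht⟩ := hlift hc hx m0 m1 h
      exact ⟨t, ht.trans (hrep x hx).symm⟩
    · obtain ⟨t, ht⟩ := h
      exact hlift hc hx m1 m0 ⟨t, ht.trans (hrep x hx)⟩
    · by_contra hinf
      obtain ⟨x, hx, hacc⟩ := Set.Infinite.exists_accPt_of_subset_isCompact hinf
        (isCompact_Icc (a := b - ρ / 2) (b := b + ρ / 2)) inter_subset_right
      rw [accPt_iff_frequently] at hacc
      obtain ⟨y, ⟨h2, h3, -⟩, h4⟩ := (hacc.and_eventually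
        (hc.eventually_not_reparam (hS 0 m0 x (hD' x hx).2.2))).exists
      exact h4 h2 h3
  have t2 : Tendsto (fun z : ℝ × ℝ ↦ (1 + z.1, z.2)) (𝓝 (0, b)) (𝓝 (1, b)) := by
    have : ContinuousAt (fun z : ℝ × ℝ ↦ (1 + z.1, z.2)) (0, b) := by fun_prop
    simpa [ContinuousAt] using this
  have hsnd : Tendsto Prod.snd (𝓝 ((0 : ℝ), b)) (𝓝 b) := continuousAt_snd
  filter_upwards [t2.eventually hφS, hsnd.eventually hfix] with z h2 h3
  rw [h2]
  simp only [h3]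
  congr 2
  ring

/-- A closed null curve is a coordinate line of a null parametrization of a strip that is periodic
in the direction of the curve. -/
theorem AllLightlikeGeodesicsClosed.exists_periodic_strip [T2Space X]
    (hg : g.AllLightlikeGeodesicsClosed) {c : ℝ → X} (hc : g.IsClosedNullCurve c) {V : ℝ}
    (hP : g.NullNear P (0, V)) (h : ∀ᶠ u in 𝓝 0, P (u, V) = c u) :
    ∃ S ε, 0 < ε ∧ (∀ u, ∀ v ∈ Ioo (V - ε) (V + ε), g.NullNear S (u, v) ∧ S (u + 1, v) = S (u, v)) ∧
      (∀ u, S (u, V) = c u) ∧ S =ᶠ[𝓝 (0, V)] P := by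
  obtain ⟨S, hSP, hS⟩ := hP.exists_strip (fun u _ ↦ hc.nullCurveAt u) h
  obtain ⟨δ, hδ, hnull⟩ := exists_uniform_near_segment
    (Q := fun z ↦ g.NullNear S z) (fun u hu ↦ (hS u hu).1.eventually)
  have hcirc : ∀ᶠ s in 𝓝 0, S (1 + s, V) = S (s, V) := by
    have t1 : Tendsto (fun s : ℝ ↦ 1 + s) (𝓝 0) (𝓝 1) := by
      have : ContinuousAt (fun s : ℝ ↦ 1 + s) 0 := by fun_prop
      simpa [ContinuousAt] using this
    filter_upwards [t1.eventually (hS 1 ⟨zero_le_one, le_rfl⟩).2, (hS 0 ⟨le_rfl, zero_le_one⟩).2]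
      with s h1 h2
    rw [h1, h2, add_comm, hc.add_one]
  have hhol := hg.eventually_add_one_eq hδ hδ hnull hcirc
  rw [nhds_prod_eq] at hhol
  obtain ⟨pa, hpa, pb, hpb, hab⟩ := eventually_prod_iff.1 hhol
  obtain ⟨ε, hε, hpb⟩ := Metric.eventually_nhds_iff.1
    (hpb.and (Ioo_mem_nhds (show V - δ < V by linarith) (show V < V + δ by linarith)))
  have hpb' (v) (hv : v ∈ Ioo (V - ε) (V + ε)) := hpb (y := v) (by
    rw [Real.dist_eq, abs_lt]; constructor <;> linarith [hv.1, hv.2])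
  -- Equality is stated between functions of `v`, so that `eventually_fract_eq` applies uniformly in
  -- the transverse variable.
  have hF : ∀ᶠ s in 𝓝 (0 : ℝ), (fun (v : Ioo (V - ε) (V + ε)) ↦ S (1 + s, (v : ℝ)))
      = fun v : Ioo (V - ε) (V + ε) ↦ S (s, (v : ℝ)) := by
    filter_upwards [hpa] with s hs
    funext v
    exact hab hs (hpb' v v.2).1
  have hloc (u v : ℝ) (hv : v ∈ Ioo (V - ε) (V + ε)) :
      (fun y : ℝ × ℝ ↦ S (Int.fract y.1, y.2)) =ᶠ[𝓝 (u, v)] fun y ↦ S (y.1 + -⌊u⌋, y.2) := by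
    have h1 := eventually_fract_eq (F := fun s (v : Ioo (V - ε) (V + ε)) ↦ S (s, (v : ℝ))) hF u
    have hfst : Tendsto Prod.fst (𝓝 (u, v)) (𝓝 u) := continuousAt_fst
    have hsnd : Tendsto Prod.snd (𝓝 (u, v)) (𝓝 v) := continuousAt_snd
    filter_upwards [hfst.eventually h1, hsnd.eventually (Ioo_mem_nhds hv.1 hv.2)] with y h2 h3
    exact congrFun h2 ⟨y.2, h3⟩
  have hSc : ∀ u ∈ Icc (0 : ℝ) 1, S (u, V) = c u := fun u hu ↦ (hS u hu).2.self_of_nhds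
  refine ⟨fun y ↦ S (Int.fract y.1, y.2), ε, hε, fun u v hv ↦ ⟨?_, by simp⟩, fun u ↦ ?_, ?_⟩
  · refine NullNear.congr ?_ (hloc u v hv)
    refine NullNear.comp_prod (w := (u, v)) (a := fun s ↦ s + -(⌊u⌋ : ℝ)) (b := fun s ↦ s) ?_
      (.add_const _ _) (.id _)
    refine hnull _ ⟨?_, ?_⟩ _ (hpb' v hv).2
    · have := Int.fract_nonneg u
      rw [Int.fract] at this
      linarith
    · have := Int.fract_lt_one u
      rw [Int.fract] at this
      linarith
  · refine (hSc _ ⟨Int.fract_nonneg u, (Int.fract_lt_one u).le⟩).trans ?_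
    conv_rhs => rw [← Int.fract_add_floor u, hc.add_int]
  · filter_upwards [hloc 0 V ⟨by linarith, by linarith⟩, hSP] with y h1 h2
    rw [h1, ← h2]
    simp

end LorentzianMetric

/-! ### The doubly periodic null parametrization -/

namespace LorentzianMetric

variable {X : Type*} [TopologicalSpace X] [ChartedSpace (EuclideanSpace ℝ (Fin 2)) X]
  [IsManifold (𝓡 2) ∞ X] {g : LorentzianMetric X} {P Q : ℝ × ℝ → X} {z w : ℝ × ℝ}

/-- A null parametrization of `X` by the plane that is periodic along one line is periodic. -/
theorem AllLightlikeGeodesicsClosed.add_one_eq [T2Space X] (hg : g.AllLightlikeGeodesicsClosed)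
    (hP : ∀ z, g.NullNear P z) (h0 : ∀ u, P (u + 1, 0) = P (u, 0)) (u v : ℝ) :
    P (u + 1, v) = P (u, v) := by
  have key : ∀ v ∈ (univ : Set ℝ), ∀ u, P (u + 1, v) = P (u, v) := by
    refine isPreconnected_univ.forall_of_frequently (mem_univ 0) h0 fun b _ hf ↦ ?_
    have hline (u v : ℝ) : Tendsto (fun v' ↦ (u, v')) (𝓝 v) (𝓝 (u, v)) :=
      Continuous.tendsto (by fun_prop) _
    have hb (u : ℝ) : P (u + 1, b) = P (u, b) :=
      tendsto_nhds_unique_of_frequently_eq ((hP _).continuousAt.tendsto.comp (hline (u + 1) b))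
        ((hP _).continuousAt.tendsto.comp (hline u b)) (hf.mono fun v hv ↦ hv u)
    have h1 := hg.eventually_add_one_eq (b := b) one_pos one_pos (fun u _ v _ ↦ hP (u, v))
      (.of_forall fun s ↦ by rw [add_comm, hb])
    obtain ⟨ρ, hρ, h2⟩ := Metric.eventually_nhds_iff.1 ((hline 0 b).eventually h1)
    filter_upwards [Ioo_mem_nhds (show b - ρ < b by linarith) (show b < b + ρ by linarith)]
      with v hv u
    -- Trivial holonomy gives the period only near `u = 0`. Uniqueness on the full horizontal strip
    -- extends it to every `u`.
    refine eqOn_prod (g := g) (P := fun y ↦ P (y.1 + 1, y.2)) (Q := P) (a := 0) isOpen_univ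
      isPreconnected_univ isOpen_Ioo isPreconnected_Ioo (fun z _ ↦ ?_) (fun z _ ↦ hP z) (mem_univ 0)
      (show b ∈ Ioo (b - ρ) (b + ρ) from ⟨by linarith, by linarith⟩) (fun u _ ↦ hb u)
      (fun v hv ↦ ?_) (⟨mem_univ u, hv⟩ : (u, v) ∈ univ ×ˢ Ioo (b - ρ) (b + ρ))
    · exact NullNear.comp_prod (a := fun s ↦ s + 1) (b := fun s ↦ s) (hP _) (.add_const _ _) (.id _)
    · have h3 := h2 (y := v) (by rw [Real.dist_eq, abs_lt]; constructor <;> linarith [hv.1, hv.2])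
      simpa [add_comm] using h3
  exact key v (mem_univ v) u

/-- If all null geodesics are closed, then a closed null curve and the closed null curve of the
other kind through one of its points extend to a null parametrization of `X` by the plane. -/
theorem AllLightlikeGeodesicsClosed.exists_global [T2Space X]
    (hg : g.AllLightlikeGeodesicsClosed) {α β : ℝ → X} (hα : g.IsClosedNullCurve α)
    (hβ : g.IsClosedNullCurve β) (hP : g.NullNear P 0) (hPα : ∀ᶠ u in 𝓝 0, P (u, 0) = α u)
    (hPβ : ∀ᶠ v in 𝓝 0, P (0, v) = β v) :
    ∃ Q : ℝ × ℝ → X, (∀ z, g.NullNear Q z) ∧ (∀ u, Q (u, 0) = α u) ∧ ∀ v, Q (0, v) = β v := by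
  have hline (u v : ℝ) : Tendsto (fun v' ↦ (u, v')) (𝓝 v) (𝓝 (u, v)) :=
    Continuous.tendsto (by fun_prop) _
  have strip (V : ℝ) : ∃ S ε, 0 < ε ∧ (∀ u, ∀ v ∈ Ioo (V - ε) (V + ε),
      g.NullNear S (u, v) ∧ S (u + 1, v) = S (u, v)) ∧
      ∀ v ∈ Ioo (V - ε) (V + ε), S (0, v) = β v := by
    obtain ⟨K, hK, hKβ⟩ := hβ.nullCurveAt V
    have hK' : g.NullNear (K ∘ Prod.swap) (0, V) := NullNear.swap (w := (0, V)) hK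
    obtain ⟨c, hc, k, hk0, hk, hkc⟩ := hg.exists_isClosedNullCurve hK'
    have hK2 : g.NullNear (fun y ↦ (K ∘ Prod.swap) (k y.1, y.2)) (0, V) :=
      NullNear.comp_prod (w := (0, V)) (b := fun s ↦ s) (by simpa [hk0] using hK') hk (.id _)
    obtain ⟨S, ε, hε, hS, -, hSK⟩ :=
      hg.exists_periodic_strip hc hK2 (hkc.mono fun u hu ↦ hu.symm)
    obtain ⟨ε', hε', h1⟩ := Metric.eventually_nhds_iff.1 (((hline 0 V).eventually hSK).and hKβ)
    refine ⟨S, min ε ε', lt_min hε hε', fun u v hv ↦ hS u v ?_, fun v hv ↦ ?_⟩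
    · have := min_le_left ε ε'
      exact ⟨by linarith [hv.1], by linarith [hv.2]⟩
    · have := min_le_right ε ε'
      obtain ⟨h2, h3⟩ := h1 (y := v) (by
        rw [Real.dist_eq, abs_lt]; constructor <;> linarith [hv.1, hv.2])
      rw [h2, ← h3]
      simp only [Function.comp_apply, Prod.swap_prod_mk]
      rw [hk0]
  obtain ⟨S₀, ε₀, hε₀, hS₀, hS₀α, hS₀P⟩ := hg.exists_periodic_strip (V := 0) hα hP hPα
  -- The object being continued in `v` is the whole row `f v`, a curve in `u`, pinned down by its
  -- value on `β`.
  have hext : ∃ f : ℝ → ℝ → X, f 0 = (fun u ↦ S₀ (u, 0)) ∧ ∀ v ∈ univ,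
      (∀ u, g.NullNear (fun y ↦ f y.2 y.1) (u, v)) ∧ ∀ᶠ v' in 𝓝 v, f v' 0 = β v' := by
    refine exists_continuation (Good := fun (f : ℝ → ℝ → X) v ↦
      (∀ u, g.NullNear (fun y ↦ f y.2 y.1) (u, v)) ∧ ∀ᶠ v' in 𝓝 v, f v' 0 = β v')
      (I := univ) (x₀ := 0) (f₀ := fun v u ↦ S₀ (u, v)) ?_ ?_ isOpen_univ isPreconnected_univ ?_
      (mem_univ _) ⟨fun u ↦ (hS₀ u 0 ⟨by linarith, by linarith⟩).1, ?_⟩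
    · rintro f f' v hff ⟨h1, h2⟩
      refine ⟨fun u ↦ (h1 u).congr ?_, ?_⟩
      · have hsnd : Tendsto Prod.snd (𝓝 (u, v)) (𝓝 v) := continuousAt_snd
        filter_upwards [hsnd.eventually hff] with y hy
        rw [hy]
      · filter_upwards [h2, hff] with v' e1 e2
        rw [e2, e1]
    · intro U hUo hU f f' hf hf' y hy hyy v hv
      funext u
      exact eqOn_prod (g := g) (P := fun y ↦ f y.2 y.1) (Q := fun y ↦ f' y.2 y.1) (a := 0)
        isOpen_univ isPreconnected_univ hUo hU (fun z hz ↦ (hf z.2 hz.2).1 z.1)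
        (fun z hz ↦ (hf' z.2 hz.2).1 z.1) (mem_univ 0) hy (fun u _ ↦ congrFun hyy u)
        (fun v hv ↦ ((hf v hv).2.self_of_nhds).trans ((hf' v hv).2.self_of_nhds).symm)
        (⟨mem_univ u, hv⟩ : (u, v) ∈ univ ×ˢ U)
    · intro V _
      obtain ⟨S, ε, hε, hS, hSβ⟩ := strip V
      refine ⟨Ioo (V - ε) (V + ε), isOpen_Ioo, isPreconnected_Ioo, ⟨by linarith, by linarith⟩,
        fun y hy f hf ↦ ?_⟩
      have hSy : ∀ᶠ v in 𝓝 y, S (0, v) = β v := by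
        filter_upwards [Ioo_mem_nhds hy.1 hy.2] with v hv using hSβ v hv
      obtain ⟨b, hb0, hb, hSb⟩ := NullNear.exists_eq_prod (z := (y, 0)) (w := (y, 0))
        (P := S ∘ Prod.swap) (Q := (fun y ↦ f y.2 y.1) ∘ Prod.swap) (h := fun s ↦ s)
        (NullNear.swap (w := (y, 0)) (hS 0 y hy).1) (NullNear.swap (w := (y, 0)) (hf.1 0)) (.id _) rfl
        (by filter_upwards [hSy, hf.2] with v e1 e2; exact e2.trans e1.symm)
      dsimp only at hb0 hb
      have hS' : g.IsClosedNullCurve fun u ↦ S (u, y) :=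
        ⟨fun u ↦ (hS u y hy).2, fun u ↦ .of_nullNear (hS u y hy).1⟩
      -- The row `f y` is lifted as a whole to the closed row of the strip at height `y`; composing
      -- with `S` then extends it to all heights of the strip, whose width does not depend on `f`.
      obtain ⟨k, hk0, hk⟩ := hS'.exists_lift (c₁ := f y) isOpen_univ isPreconnected_univ
        (fun u _ ↦ NullCurveAt.of_nullNear (hf.1 u)) (mem_univ 0)
        ⟨b, hb0, hb, (hline y 0).eventually hSb⟩
      refine ⟨fun v u ↦ S (k u, v), ?_, fun v hv ↦ ⟨fun u ↦ ?_, ?_⟩⟩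
      · funext u
        exact ((hk u (mem_univ u)).2.self_of_nhds).symm
      · exact NullNear.comp_prod (w := (u, v)) (b := fun s ↦ s) (hS (k u) v hv).1
          (hk u (mem_univ u)).1 (.id _)
      · filter_upwards [Ioo_mem_nhds hv.1 hv.2] with v' hv'
        rw [hk0, hSβ v' hv']
    · filter_upwards [(hline 0 0).eventually hS₀P, hPβ] with v e1 e2
      rw [e1, e2]
  obtain ⟨f, hf0, hf⟩ := hext
  refine ⟨fun y ↦ f y.2 y.1, fun z ↦ (hf z.2 (mem_univ _)).1 z.1, fun u ↦ ?_, fun v ↦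
    (hf v (mem_univ _)).2.self_of_nhds⟩
  change f 0 u = α u
  rw [hf0, ← hS₀α]

/-- If all null geodesics are closed, then there is a doubly periodic null parametrization of the
surface by the plane. -/
theorem AllLightlikeGeodesicsClosed.exists_periodic [T2Space X] [Nonempty X]
    (hg : g.AllLightlikeGeodesicsClosed) :
    ∃ P : ℝ × ℝ → X, (∀ z, g.NullNear P z) ∧ (∀ u v, P (u + 1, v) = P (u, v)) ∧
      ∀ u v, P (u, v + 1) = P (u, v) := by
  obtain ⟨P₀, -, hP₀⟩ := g.exists_nullNear (Classical.arbitrary X)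
  obtain ⟨α, hα, h, hh0, hh, hhα⟩ := hg.exists_isClosedNullCurve hP₀
  have hsw : g.NullNear (P₀ ∘ Prod.swap) 0 := NullNear.swap (by simpa using hP₀)
  obtain ⟨β, hβ, k, hk0, hk, hkβ⟩ := hg.exists_isClosedNullCurve hsw
  dsimp only [Prod.fst_zero, Prod.snd_zero] at hh0 hh hhα hk0 hk hkβ
  -- The initial chart is reparametrized separately in each variable, so that its axes become `α`
  -- and `β`.
  obtain ⟨P, hP, hPα, hPβ⟩ := hg.exists_global hα hβ
    (NullNear.comp_prod (P := P₀) (w := 0) (by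
      rwa [show (h (0 : ℝ × ℝ).1, k (0 : ℝ × ℝ).2) = 0 from Prod.ext hh0 hk0]) hh hk)
    (by filter_upwards [hhα] with u hu; rw [hu, hk0])
    (by filter_upwards [hkβ] with u hu; rw [hu, hh0]; rfl)
  refine ⟨P, hP, hg.add_one_eq hP fun u ↦ ?_, fun u v ↦ ?_⟩
  · rw [hPα, hPα, hα.add_one]
  · refine hg.add_one_eq (P := P ∘ Prod.swap) (fun z ↦ NullNear.swap (hP _)) (fun v ↦ ?_) v u
    change P (0, v + 1) = P (0, v)
    rw [hPβ, hPβ, hβ.add_one]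

end LorentzianMetric

/-! ### Null coordinates on the torus -/

/-- The logarithm on the circle with its branch cut opposite to `a₀`. -/
noncomputable def circleLog (a₀ a : Circle) : ℝ :=
  Complex.arg a₀ + Complex.arg ((a / a₀ : Circle) : ℂ)

theorem exp_circleLog (a₀ a : Circle) : Circle.exp (circleLog a₀ a) = a := by
  rw [circleLog, Circle.exp_add, Circle.exp_arg, Circle.exp_arg, mul_div_cancel]

theorem contMDiff_coe_circle : ContMDiff (𝓡 1) 𝓘(ℝ, ℂ) ∞ (fun a : Circle ↦ (a : ℂ)) :=
  haveI := finrank_real_complex_fact'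
  contMDiff_coe_sphere (n := 1) (E := ℂ)

/-- Near `a₀`, the function is the restriction to the circle of the imaginary part of a branch of
the complex logarithm, plus a constant. -/
theorem eventually_contMDiffAt_circleLog (a₀ : Circle) :
    ∀ᶠ a in 𝓝 a₀, ContMDiffAt (𝓡 1) 𝓘(ℝ, ℝ) ∞ (circleLog a₀) a := by
  have hc : ContinuousAt (fun a : Circle ↦ ((a / a₀ : Circle) : ℂ)) a₀ := by fun_prop
  have h0 : ∀ᶠ a in 𝓝 a₀, ((a / a₀ : Circle) : ℂ) ∈ Complex.slitPlane :=
    hc.eventually (Complex.isOpen_slitPlane.mem_nhds (by simp))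
  filter_upwards [h0] with a ha
  have hF : ContDiffAt ℝ ∞ (fun w : ℂ ↦ Complex.arg (a₀ : ℂ) + (Complex.log (w / a₀)).im) a := by
    have h1 : ContDiffAt ℝ ∞ (fun w : ℂ ↦ Complex.log (w / a₀)) a := by
      refine ContDiffAt.comp (a : ℂ) ((Complex.contDiffAt_log (by simpa using ha)).restrict_scalars ℝ) ?_
      fun_prop
    exact contDiffAt_const.add (Complex.imCLM.contDiff.contDiffAt.comp (a : ℂ) h1)
  have h2 := hF.contMDiffAt.comp a (contMDiff_coe_circle a)
  refine h2.congr_of_eventuallyEq (.of_forall fun b ↦ ?_)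
  change circleLog a₀ b = Complex.arg (a₀ : ℂ) + (Complex.log ((b : ℂ) / a₀)).im
  rw [circleLog, Complex.log_im, Circle.coe_div]

/-- The angle form on the circle. -/
noncomputable def circleAngleForm (a : Circle) : TangentSpace (𝓡 1) a →L[ℝ] ℝ :=
  mfderiv (𝓡 1) 𝓘(ℝ, ℝ) (circleLog a) a

theorem hasMFDerivAt_circleLog (a : Circle) :
    HasMFDerivAt (𝓡 1) 𝓘(ℝ, ℝ) (circleLog a) a (circleAngleForm a) :=
  ((eventually_contMDiffAt_circleLog a).self_of_nhds.mdifferentiableAt (by simp)).hasMFDerivAt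

/-- Since `Circle.exp` is a left inverse of the logarithm, the derivative of the inclusion in `ℂ` at
`a` is the angle form times the unit vector `a * I`. -/
theorem circleMetric_eq (a : Circle) (v w : TangentSpace (𝓡 1) a) :
    circleMetric a v w = circleAngleForm a v * circleAngleForm a w := by
  have hE : HasDerivAt (fun θ : ℝ ↦ (Circle.exp θ : ℂ)) ((a : ℂ) * Complex.I) (circleLog a a) := by
    have h1 : HasDerivAt (fun θ : ℝ ↦ Complex.exp ((θ : ℂ) * Complex.I))
        (Complex.exp ((circleLog a a : ℝ) * Complex.I) * (1 * Complex.I)) (circleLog a a) :=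
      ((Complex.ofRealCLM.hasDerivAt (x := circleLog a a)).mul_const Complex.I).cexp
    rw [← Circle.coe_exp, exp_circleLog, one_mul] at h1
    simpa only [Circle.coe_exp] using h1
  have h2 := hE.hasFDerivAt.hasMFDerivAt.comp a (hasMFDerivAt_circleLog a)
  have h3 : (fun θ : ℝ ↦ (Circle.exp θ : ℂ)) ∘ circleLog a = fun b : Circle ↦ (b : ℂ) := by
    funext b
    exact congrArg (fun c : Circle ↦ (c : ℂ)) (exp_circleLog a b)
  rw [h3] at h2
  have h4 (v : TangentSpace (𝓡 1) a) :
      (mfderiv (𝓡 1) 𝓘(ℝ, ℂ) (fun a : Circle ↦ (a : ℂ)) a v : ℂ)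
        = circleAngleForm a v • ((a : ℂ) * Complex.I) := by
    rw [h2.mfderiv]
    rfl
  have h5 : @inner ℝ ℂ _ ((a : ℂ) * Complex.I) ((a : ℂ) * Complex.I) = 1 := by
    rw [real_inner_self_eq_norm_sq, norm_mul, Circle.norm_coe, Complex.norm_I]
    norm_num
  unfold circleMetric
  rw [h4, h4, real_inner_smul_left, real_inner_smul_right, h5, mul_one]

/-- The change from angle coordinates on the torus to null coordinates of period `1`. -/
noncomputable def nullCoord : ℝ × ℝ →L[ℝ] ℝ × ℝ :=
  ((2 * Real.pi)⁻¹ • (ContinuousLinearMap.fst ℝ ℝ ℝ + ContinuousLinearMap.snd ℝ ℝ ℝ)).prod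
    ((2 * Real.pi)⁻¹ • (ContinuousLinearMap.fst ℝ ℝ ℝ - ContinuousLinearMap.snd ℝ ℝ ℝ))

theorem nullCoord_apply (p : ℝ × ℝ) :
    nullCoord p = ((2 * Real.pi)⁻¹ * (p.1 + p.2), (2 * Real.pi)⁻¹ * (p.1 - p.2)) := rfl

/-- Null coordinates on the torus near `z₀`. -/
noncomputable def torusLog (z₀ z : Circle × Circle) : ℝ × ℝ :=
  nullCoord (circleLog z₀.1 z.1, circleLog z₀.2 z.2)

/-- The map from the plane with null coordinates of period `1` to the torus. -/
noncomputable def torusExp (p : ℝ × ℝ) : Circle × Circle :=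
  (Circle.exp (Real.pi * (p.1 + p.2)), Circle.exp (Real.pi * (p.1 - p.2)))

/-- The map on the torus induced by a doubly periodic map. -/
noncomputable def torusDescend {A : Type*} (F : ℝ × ℝ → A) (z : Circle × Circle) : A := F (torusLog z z)

theorem torusExp_torusLog (z₀ z : Circle × Circle) : torusExp (torusLog z₀ z) = z := by
  have hπ := Real.pi_ne_zero
  simp only [torusExp, torusLog, nullCoord_apply]
  refine Prod.ext ?_ ?_
  · refine Eq.trans (congrArg Circle.exp ?_) (exp_circleLog z₀.1 z.1)
    field_simp
    ring
  · refine Eq.trans (congrArg Circle.exp ?_) (exp_circleLog z₀.2 z.2)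
    field_simp
    ring

theorem torusDescend_torusExp {A : Type*} {F : ℝ × ℝ → A} (h1 : ∀ u v, F (u + 1, v) = F (u, v))
    (h2 : ∀ u v, F (u, v + 1) = F (u, v)) (p : ℝ × ℝ) : torusDescend F (torusExp p) = F p := by
  have hπ := Real.pi_ne_zero
  have hm (u v : ℝ) (m : ℤ) : F (u + m, v) = F (u, v) := by
    have h : Function.Periodic (fun u ↦ F (u, v)) 1 := fun u ↦ h1 u v
    simpa using (h.int_mul m) u
  have hn (u v : ℝ) (n : ℤ) : F (u, v + n) = F (u, v) := by
    have h : Function.Periodic (fun v ↦ F (u, v)) 1 := fun v ↦ h2 u v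
    simpa using (h.int_mul n) v
  obtain ⟨m, hm'⟩ := Circle.exp_eq_exp.1 (exp_circleLog (torusExp p).1 (torusExp p).1)
  obtain ⟨n, hn'⟩ := Circle.exp_eq_exp.1 (exp_circleLog (torusExp p).2 (torusExp p).2)
  -- Angle ambiguities `2πm`, `2πn` shift the null coordinates by `(m + n, m - n)`. These shifts
  -- form a proper subgroup of `ℤ²`, so invariance under `ℤ²` suffices.
  have h3 : torusLog (torusExp p) (torusExp p) = (p.1 + (m + n : ℤ), p.2 + (m - n : ℤ)) := by
    rw [torusLog, nullCoord_apply, hm', hn']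
    push_cast
    refine Prod.ext ?_ ?_ <;> field_simp <;> ring
  rw [torusDescend, h3, hm, hn]

theorem torusDescend_eq {A : Type*} {F : ℝ × ℝ → A} (h1 : ∀ u v, F (u + 1, v) = F (u, v))
    (h2 : ∀ u v, F (u, v + 1) = F (u, v)) (z₀ z : Circle × Circle) :
    torusDescend F z = F (torusLog z₀ z) := by
  conv_lhs => rw [← torusExp_torusLog z₀ z]
  exact torusDescend_torusExp h1 h2 _

theorem contMDiff_torusExp : ContMDiff 𝓘(ℝ, ℝ × ℝ) ((𝓡 1).prod (𝓡 1)) ∞ torusExp := by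
  have h1 : ContMDiff 𝓘(ℝ, ℝ × ℝ) 𝓘(ℝ, ℝ) ∞ (fun p : ℝ × ℝ ↦ Real.pi * (p.1 + p.2)) :=
    ContDiff.contMDiff (by fun_prop)
  have h2 : ContMDiff 𝓘(ℝ, ℝ × ℝ) 𝓘(ℝ, ℝ) ∞ (fun p : ℝ × ℝ ↦ Real.pi * (p.1 - p.2)) :=
    ContDiff.contMDiff (by fun_prop)
  exact (contMDiff_circleExp.comp h1).prodMk (contMDiff_circleExp.comp h2)

theorem eventually_contMDiffAt_torusLog (z₀ : Circle × Circle) :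
    ∀ᶠ z in 𝓝 z₀, ContMDiffAt ((𝓡 1).prod (𝓡 1)) 𝓘(ℝ, ℝ × ℝ) ∞ (torusLog z₀) z := by
  filter_upwards [continuousAt_fst.eventually (eventually_contMDiffAt_circleLog z₀.1),
    continuousAt_snd.eventually (eventually_contMDiffAt_circleLog z₀.2)] with z h1 h2
  have h3 := (h1.comp z contMDiffAt_fst).prodMk_space (h2.comp z contMDiffAt_snd)
  exact (nullCoord.contDiff.contMDiff _).comp z h3

theorem mfderiv_torusLog (z : Circle × Circle) (v : TangentSpace ((𝓡 1).prod (𝓡 1)) z) :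
    (mfderiv ((𝓡 1).prod (𝓡 1)) 𝓘(ℝ, ℝ × ℝ) (torusLog z) z v : ℝ × ℝ) = nullCoord
      (circleAngleForm z.1 (mfderiv ((𝓡 1).prod (𝓡 1)) (𝓡 1) Prod.fst z v),
        circleAngleForm z.2 (mfderiv ((𝓡 1).prod (𝓡 1)) (𝓡 1) Prod.snd z v)) := by
  have h1 := (hasMFDerivAt_circleLog z.1).comp z
    (mdifferentiableAt_fst (I := 𝓡 1) (I' := 𝓡 1) (x := z)).hasMFDerivAt
  have h2 := (hasMFDerivAt_circleLog z.2).comp z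
    (mdifferentiableAt_snd (I := 𝓡 1) (I' := 𝓡 1) (x := z)).hasMFDerivAt
  have h3 : HasMFDerivAt ((𝓡 1).prod (𝓡 1)) 𝓘(ℝ, ℝ × ℝ)
      (fun z' : Circle × Circle ↦ (circleLog z.1 z'.1, circleLog z.2 z'.2)) z
      (((circleAngleForm z.1).comp (mfderiv ((𝓡 1).prod (𝓡 1)) (𝓡 1) Prod.fst z)).prod
        ((circleAngleForm z.2).comp (mfderiv ((𝓡 1).prod (𝓡 1)) (𝓡 1) Prod.snd z))) := by
    rw [modelWithCornersSelf_prod, ← chartedSpaceSelf_prod]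
    exact h1.prodMk h2
  have h4 := HasMFDerivAt.comp (I' := 𝓘(ℝ, ℝ × ℝ)) (g := nullCoord) z
    (nullCoord.hasMFDerivAt (x := (circleLog z.1 z.1, circleLog z.2 z.2))) h3
  have h5 : mfderiv ((𝓡 1).prod (𝓡 1)) 𝓘(ℝ, ℝ × ℝ) (torusLog z) z = _ := h4.mfderiv
  rw [h5]
  rfl

theorem contMDiff_torusDescend {F : ℝ × ℝ → ℝ} (hF : ContDiff ℝ ∞ F)
    (h1 : ∀ u v, F (u + 1, v) = F (u, v)) (h2 : ∀ u v, F (u, v + 1) = F (u, v)) :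
    ContMDiff ((𝓡 1).prod (𝓡 1)) 𝓘(ℝ, ℝ) ∞ (torusDescend F) := by
  intro z
  have h3 : torusDescend F = F ∘ torusLog z := funext fun z' ↦ torusDescend_eq h1 h2 z z'
  rw [h3]
  exact (hF.contMDiff _).comp z (eventually_contMDiffAt_torusLog z).self_of_nhds

/-! ### Descent to the torus -/

namespace LorentzianMetric

variable {X : Type*} [TopologicalSpace X] [ChartedSpace (EuclideanSpace ℝ (Fin 2)) X]
  [IsManifold (𝓡 2) ∞ X] {g : LorentzianMetric X} {P : ℝ × ℝ → X}

theorem isLocalDiffeomorph_torusDescend (hP : ∀ z, g.NullNear P z)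
    (h1 : ∀ u v, P (u + 1, v) = P (u, v)) (h2 : ∀ u v, P (u, v + 1) = P (u, v)) :
    IsLocalDiffeomorph ((𝓡 1).prod (𝓡 1)) (𝓡 2) ∞ (torusDescend P) := by
  intro z₀
  obtain ⟨e, he, heP, hes⟩ := (hP (torusLog z₀ z₀)).exists_openPartialHomeomorph
  have hsrc : ∀ᶠ z in 𝓝 z₀, torusLog z₀ z ∈ e.source :=
    (eventually_contMDiffAt_torusLog z₀).self_of_nhds.continuousAt.eventually
      (e.open_source.mem_nhds he)
  obtain ⟨U, hU, hUo, hzU⟩ := eventually_nhds_iff.1 (hsrc.and (eventually_contMDiffAt_torusLog z₀))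
  have hq : torusDescend P = P ∘ torusLog z₀ := funext fun z ↦ torusDescend_eq h1 h2 z₀ z
  have hqe (z) (hz : z ∈ U) : torusDescend P z = e (torusLog z₀ z) := by
    rw [hq, Function.comp_apply, (heP _ (hU z hz).1).1]
  have hleft (z) (hz : z ∈ U) : torusExp (e.symm (torusDescend P z)) = z := by
    rw [hqe z hz, e.left_inv (hU z hz).1, torusExp_torusLog]
  have hinv (x) (hx : x ∈ e.target) :
      ContMDiffAt (𝓡 2) ((𝓡 1).prod (𝓡 1)) ∞ (torusExp ∘ e.symm) x :=
    (contMDiff_torusExp _).comp x (hes x hx)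
  let Φ : PartialDiffeomorph ((𝓡 1).prod (𝓡 1)) (𝓡 2) (Circle × Circle) X ∞ :=
    { toFun := torusDescend P
      invFun := torusExp ∘ e.symm
      source := U
      target := e.target ∩ (torusExp ∘ e.symm) ⁻¹' U
      map_source' := fun z hz ↦ ⟨by rw [hqe z hz]; exact e.map_source (hU z hz).1, by
        rw [mem_preimage, Function.comp_apply, hleft z hz]; exact hz⟩
      map_target' := fun x hx ↦ hx.2
      left_inv' := hleft
      right_inv' := fun x hx ↦ by
        rw [Function.comp_apply, torusDescend_torusExp h1 h2, ← (heP _ (e.map_target hx.1)).1,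
          e.right_inv hx.1]
      open_source := hUo
      open_target := ContinuousOn.isOpen_inter_preimage
        (fun x hx ↦ (hinv x hx).continuousAt.continuousWithinAt) e.open_target hUo
      contMDiffOn_toFun := fun z hz ↦ by
        rw [hq]
        exact ((hP _).nullAt.contMDiffAt.comp z (hU z hz).2).contMDiffWithinAt
      contMDiffOn_invFun := fun x hx ↦ (hinv x hx.1).contMDiffWithinAt }
  exact ⟨Φ, hzU, fun z _ ↦ rfl⟩

/-- Translations have identity derivative, so the conformal factor inherits the periods of `P` and
descends with it. -/
theorem pull_add (hP : ∀ z, g.NullNear P z) {c : ℝ × ℝ} (hc : ∀ z, P (z + c) = P z) (z a b : ℝ × ℝ) :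
    g.pull P (z + c) a b = g.pull P z a b := by
  have h1 : HasFDerivAt (fun z : ℝ × ℝ ↦ z + c) (.id ℝ (ℝ × ℝ)) z := (hasFDerivAt_id z).add_const c
  have h2 := g.pull_comp (P := P) (Φ := fun z ↦ z + c) (w := z) (hP _).nullAt.mdifferentiableAt
    h1.differentiableAt a b
  rw [h1.fderiv] at h2
  have h3 : P ∘ (fun z ↦ z + c) = P := funext hc
  rw [h3] at h2
  exact h2.symm

/-- In the angles, `du ⊗ dv + dv ⊗ du = (dθ₁² - dθ₂²) / (2π²)`, which accounts for the constant. -/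
theorem inner_mfderiv_torusDescend (hP : ∀ z, g.NullNear P z)
    (h1 : ∀ u v, P (u + 1, v) = P (u, v)) (h2 : ∀ u v, P (u, v + 1) = P (u, v))
    (z : Circle × Circle) (v w : TangentSpace ((𝓡 1).prod (𝓡 1)) z) :
    g.inner (torusDescend P z) (mfderiv ((𝓡 1).prod (𝓡 1)) (𝓡 2) (torusDescend P) z v)
      (mfderiv ((𝓡 1).prod (𝓡 1)) (𝓡 2) (torusDescend P) z w)
      = torusDescend (fun p ↦ g.pull P p (1, 0) (0, 1) / (2 * Real.pi ^ 2)) z * einsteinMetric z v w := by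
  have hq : torusDescend P = P ∘ torusLog z := funext fun z' ↦ torusDescend_eq h1 h2 z z'
  have hd (v : TangentSpace ((𝓡 1).prod (𝓡 1)) z) :
      (mfderiv ((𝓡 1).prod (𝓡 1)) (𝓡 2) (torusDescend P) z v : EuclideanSpace ℝ (Fin 2))
        = mfderiv 𝓘(ℝ, ℝ × ℝ) (𝓡 2) P (torusLog z z)
          (mfderiv ((𝓡 1).prod (𝓡 1)) 𝓘(ℝ, ℝ × ℝ) (torusLog z) z v) := by
    have h3 := mfderiv_comp z (hP (torusLog z z)).nullAt.mdifferentiableAt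
      ((eventually_contMDiffAt_torusLog z).self_of_nhds.mdifferentiableAt (by simp))
    rw [← hq] at h3
    rw [h3]
    rfl
  have h4 : g.inner (torusDescend P z) (mfderiv ((𝓡 1).prod (𝓡 1)) (𝓡 2) (torusDescend P) z v)
      (mfderiv ((𝓡 1).prod (𝓡 1)) (𝓡 2) (torusDescend P) z w) = g.pull P (torusLog z z)
        (mfderiv ((𝓡 1).prod (𝓡 1)) 𝓘(ℝ, ℝ × ℝ) (torusLog z) z v)
        (mfderiv ((𝓡 1).prod (𝓡 1)) 𝓘(ℝ, ℝ × ℝ) (torusLog z) z w) :=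
    congrArg₂ (fun a b : TangentSpace (𝓡 2) (torusDescend P z) ↦ g.inner (torusDescend P z) a b) (hd v) (hd w)
  have hπ := Real.pi_ne_zero
  refine h4.trans ((congrArg₂ (fun a b : ℝ × ℝ ↦ g.pull P (torusLog z z) a b)
    (mfderiv_torusLog z v) (mfderiv_torusLog z w)).trans ?_)
  rw [(hP _).nullAt.pull_eq, einsteinMetric, circleMetric_eq, circleMetric_eq, torusDescend]
  simp only [nullCoord_apply]
  field_simp
  ring

end LorentzianMetric

theorem mainTheorem7 {X : Type*} [TopologicalSpace X] [T2Space X] [SecondCountableTopology X]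
    [ConnectedSpace X] [ChartedSpace (EuclideanSpace ℝ (Fin 2)) X] [IsManifold (𝓡 2) ∞ X]
    (g : LorentzianMetric X) (hg : g.AllLightlikeGeodesicsClosed) :
    (∃ p : Circle × Circle → X,
      IsCoveringMap p ∧ Function.Surjective p ∧
      IsLocalDiffeomorph ((𝓡 1).prod (𝓡 1)) (𝓡 2) ∞ p ∧
      ∃ f : Circle × Circle → ℝ,
        ContMDiff ((𝓡 1).prod (𝓡 1)) 𝓘(ℝ, ℝ) ∞ f ∧ (∀ z, 0 < f z) ∧
        ∀ (z : Circle × Circle) (v w : TangentSpace ((𝓡 1).prod (𝓡 1)) z),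
          g.inner (p z) (mfderiv ((𝓡 1).prod (𝓡 1)) (𝓡 2) p z v)
            (mfderiv ((𝓡 1).prod (𝓡 1)) (𝓡 2) p z w) = f z * einsteinMetric z v w) ∧
    CompactSpace X := by
  obtain ⟨P, hP, h1, h2⟩ := hg.exists_periodic
  have hloc := LorentzianMetric.isLocalDiffeomorph_torusDescend hP h1 h2
  have hcont : Continuous (torusDescend P) := hloc.isLocalHomeomorph.continuous
  -- The image is closed by compactness of the torus, open for a local diffeomorphism, and nonempty.
  have hrange : range (torusDescend P) = univ :=
    IsClopen.eq_univ ⟨(isCompact_range hcont).isClosed, hloc.isOpen_range⟩ (range_nonempty _)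
  have hF1 (u v : ℝ) : g.pull P (u + 1, v) (1, 0) (0, 1) = g.pull P (u, v) (1, 0) (0, 1) := by
    simpa using LorentzianMetric.pull_add hP (c := (1, 0)) (fun z ↦ by
      rw [show z + (1, 0) = (z.1 + 1, z.2) from Prod.ext rfl (add_zero _)]; exact h1 z.1 z.2)
      (u, v) (1, 0) (0, 1)
  have hF2 (u v : ℝ) : g.pull P (u, v + 1) (1, 0) (0, 1) = g.pull P (u, v) (1, 0) (0, 1) := by
    simpa using LorentzianMetric.pull_add hP (c := (0, 1)) (fun z ↦ by
      rw [show z + (0, 1) = (z.1, z.2 + 1) from Prod.ext (add_zero _) rfl]; exact h2 z.1 z.2)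
      (u, v) (1, 0) (0, 1)
  refine ⟨⟨torusDescend P, isLocalHomeomorph_iff_isCoveringMap.1 hloc.isLocalHomeomorph,
    range_eq_univ.1 hrange, hloc, _, contMDiff_torusDescend (contDiff_iff_contDiffAt.2 fun z ↦
      (g.contDiffAt_pull_apply (hP z).nullAt.contMDiffAt (1, 0) (0, 1)).div_const _) ?_ ?_, ?_,
    LorentzianMetric.inner_mfderiv_torusDescend hP h1 h2⟩, ⟨hrange ▸ isCompact_range hcont⟩⟩
  · intro u v
    rw [hF1]
  · intro u v
    rw [hF2]
  · intro z
    exact div_pos (hP _).nullAt.pull_pos (by positivity)
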